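/- Let $k$ be a field and let $n\ge 1$, $m\ge 3$ be integers. For $\mathbf i=(i_1,\dots,i_n)\in\mathbb Z^n$ put $\mathbf i(1)=\mathbf i+\mathbf e_1$ and $\mathbf i(t)=\mathbf i-\mathbf e_{t-1}+\mathbf e_t$ for $2\le t\le n$. The $n$-cubic pyramid quiver $Q(n)$ of height $m$ has the vertices $\mathbf i$ with $i_t\ge 1$ for all $t$ and $\sum_{t=1}^s i_t\le m+s-1$ for $1\le s\le n$, and one arrow $\gamma_{t,\mathbf i}:\mathbf i\to\mathbf i(t)$ of type $t$ whenever $\mathbf i,\mathbf i(t)$ are vertices. Let $d=(d_{s,t,\mathbf i})_{t<s}$ be nonzero scalars such that, for $t<u<s$ and each vertex $\mathbf i$ at which the whole cube spanned by arrows of types $t,u,s$ lies in $Q(n)$, $$d_{s,u,\mathbf i(t)}\,d_{s,t,\mathbf i}\,d_{u,t,\mathbf i(s)}=d_{u,t,\mathbf i}\,d_{s,t,\mathbf i(u)}\,d_{s,u,\mathbf i}.$$ Let $\rho(n)$ consist of the elements $d_{s,t,\mathbf i}\gamma_{t,\mathbf i(s)}\gamma_{s,\mathbf i}-\gamma_{s,\mathbf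 i(t)}\gamma_{t,\mathbf i}$ for $t<s$ and $\gamma_{t,\mathbf i(t)}\gamma_{t,\mathbf i}$, whenever all vertices involved are in $Q(n)$. The $n$-cubic pyramid algebra is $\Lambda(n)=kQ(n)/(\rho(n))$ (products are composed from right to left), graded by path length. Definitions, for a finite quiver $Q$ with relations $\rho$ that are homogeneous of degree $\ge 2$, $\Lambda=kQ/(\rho)$ and $N\ge 0$. A path, or a linear combination of paths of one length with common end points, is *bound* if it is nonzero in $\Lambda$. $(Q,\rho)$ is an *$N$-translation quiver* with translation a bijection $\tau:Q_0\setminus\mathcal P\to Q_0\setminus\mathcal I$ ($\mathcal P$: projective vertices, $\mathcal I$: injective vertices) if: (1) each maximal bound path has length $N+1$ and goes from $\tau i$ to $i$ for some $i\notin\mathcal P$; (2) any two bound paths of length $N+1$ from $\tau i$ to $i$ are linearly dependent; (3) for $i\notin\mathcal P$ and a bound element $x$ of degree $t\le N+1$ from $j$ to $i$ there is a path $q$ of length $N+1-t$ from $\tau i$ to $j$ with $xq\ne0$ in $\Lambda$; (4) for $i\notin\mathcal I$ and a bound element $x$ of degree $t\le N+1$ from $i$ to $j$ there is a path $p$ of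 length $N+1-t$ from $j$ to $\tau^{-1}i$ with $px\neq0$ in $\Lambda$. It is *admissible* if: (i) each bound path $p$ extends to a bound path $q'pq''$ of length $N+1$; (ii) each bound path from a non-injective to a non-projective vertex is in $\Lambda$ a linear combination of shiftable ones, where a bound path is *shiftable* if it is a linear combination of products $p'p''$ with $p''$ trivial or a linear combination of paths through no injective vertex, and $p'$ trivial or a linear combination of paths through no projective vertex (end points included); (iii) if $i\notin\mathcal P$, $p$ is a bound path ending at $i$ and passing a projective vertex, $q$ is a bound path starting at $\tau i$ and passing an injective vertex, and $l(p)+l(q)\le N$, then, with $t=N+1-l(p)-l(q)$, $p$ is left stark of degree $t$ with respect to the end of $q$, or $q$ is right stark of degree $t$ with respect to the start of $p$. Here a bound path $p:i\to j$, on which all bound paths from $i$ to $j$ of the same length are linearly dependent, is left (right) stark of degree $t<N+1-l(p)$ with respect to $v$ if $pw\ne0$ for every bound element $w$ of degree $t$ from $v$ to $i$ ($wp\neq0$ for every bound element $w$ of degree $t$ from $j$ to $v$). $\Lambda$ is *$(p,q)$-Koszul* ($q\in\{1,2,\dots\}\cup\{\infty\}$) if $\Lambda_t=0$ for $t>p$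 and, for each simple $S(i)=\Lambda_0e_i$, in the first $q+1$ terms $P^q\xrightarrow{f_q}\cdots\to P^0\xrightarrow{f_0}S(i)\to0$ of a minimal graded projective resolution, $P^t$ is generated in degree $t$ for all $t\le q$ and, if $q<\infty$, $\ker f_q$ is concentrated in degree $p+q$. An algebra is an *$N$-translation algebra* if it is isomorphic to some $kQ/(\rho)$ such that $(Q,\rho)$ is an $N$-translation quiver and $kQ/(\rho)$ is $(N+1,q)$-Koszul for some such $q$. An $N$-translation algebra $\Lambda=kQ/(\rho)$ is *extendible* if for every degree-preserving $k$-algebra automorphism $\sigma$ of $\Lambda$ fixing all the idempotents $e_i$ (in particular $\sigma=1$) the trivial extension $\Lambda\ltimes D\Lambda$, with $D\Lambda=\mathrm{Hom}_k(\Lambda,k)$ twisted by $\sigma$ on one side, is an $(N+1)$-translation algebra. **Theorem.** $(Q(n),\rho(n))$ is an admissible $(n-1)$-translation quiver with $\mathcal P=\{\mathbf i\mid i_n=1\}$, $\mathcal I=\{\mathbf i\mid i_1+\dots+i_n=n+m-1\}$ and translation $\tau:\mathbf i\mapsto\mathbf i-\mathbf e_n$; the algebra $\Lambda(n)$ is $(n,q)$-Koszul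 for some $q\in\{1,2,\dots\}\cup\{\infty\}$, and hence an $(n-1)$-translation algebra; and $\Lambda(n)$ is extendible. -/

import Mathlib

open scoped DirectSum

universe u

noncomputable section

namespace NCubic

/-! ## Path algebras and bound quivers

All quivers have finitely many vertices.  Paths and products are composed as in
the left-module convention: an arrow `f : a ⟶ b` lies in `e_b (kQ) e_a`, and `x * y` means
"first `y`, then `x`". -/

/-- Generators of the path algebra: the trivial paths and the arrows. -/
inductive Gen (V : Type) [Quiver.{0} V] : Type
  | vertex (i : V) : Gen V
  | arrow {i j : V} (f : i ⟶ j) : Gen V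

/-- Defining relations of the path algebra of a quiver with finitely many vertices: the trivial
paths form a complete set of orthogonal idempotents and `f = e_j f e_i` for `f : i ⟶ j`. -/
inductive PathRel (k : Type u) [Field k] (V : Type) [Quiver.{0} V] [Fintype V] :
    FreeAlgebra k (Gen V) → FreeAlgebra k (Gen V) → Prop
  | idem (i : V) : PathRel k V
      (FreeAlgebra.ι k (Gen.vertex i) * FreeAlgebra.ι k (Gen.vertex i))
      (FreeAlgebra.ι k (Gen.vertex i))
  | orth (i j : V) (h : i ≠ j) : PathRel k V
      (FreeAlgebra.ι k (Gen.vertex i) * FreeAlgebra.ι k (Gen.vertex j)) 0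
  | complete : PathRel k V (∑ i : V, FreeAlgebra.ι k (Gen.vertex i)) 1
  | target {i j : V} (f : i ⟶ j) : PathRel k V
      (FreeAlgebra.ι k (Gen.vertex j) * FreeAlgebra.ι k (Gen.arrow f))
      (FreeAlgebra.ι k (Gen.arrow f))
  | source {i j : V} (f : i ⟶ j) : PathRel k V
      (FreeAlgebra.ι k (Gen.arrow f) * FreeAlgebra.ι k (Gen.vertex i))
      (FreeAlgebra.ι k (Gen.arrow f))

/-- The path algebra `kQ`. -/
def PathAlg (k : Type u) [Field k] (V : Type) [Quiver.{0} V] [Fintype V] : Type u :=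
  (ringConGen (PathRel k V)).Quotient

instance (k : Type u) [Field k] (V : Type) [Quiver.{0} V] [Fintype V] : Ring (PathAlg k V) :=
  inferInstanceAs (Ring (ringConGen (PathRel k V)).Quotient)

instance (k : Type u) [Field k] (V : Type) [Quiver.{0} V] [Fintype V] : Algebra k (PathAlg k V) :=
  inferInstanceAs (Algebra k (ringConGen (PathRel k V)).Quotient)

/-- The projection from the free algebra onto `kQ`. -/
def PathAlg.mk (k : Type u) [Field k] (V : Type) [Quiver.{0} V] [Fintype V] :
    FreeAlgebra k (Gen V) →ₐ[k] PathAlg k V :=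
  (ringConGen (PathRel k V)).mkₐ (α := k)

section PathAlg

variable (k : Type u) [Field k] {V : Type} [Quiver.{0} V] [Fintype V]

/-- The trivial path at `i`. -/
def vertexElt (i : V) : PathAlg k V :=
  PathAlg.mk k V (FreeAlgebra.ι k (Gen.vertex i))

/-- An arrow as an element of `kQ`. -/
def arrowElt {i j : V} (f : i ⟶ j) : PathAlg k V :=
  PathAlg.mk k V (FreeAlgebra.ι k (Gen.arrow f))

/-- A path as an element of `kQ`. -/
def pathElt {i : V} : {j : V} → Quiver.Path i j → PathAlg k V
  | _, Quiver.Path.nil => vertexElt k i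
  | _, Quiver.Path.cons p f => arrowElt k f * pathElt p

end PathAlg

section BoundQuiver

variable {k : Type u} [Field k] {V : Type} [Quiver.{0} V] [Fintype V]

/-- `ρ` is a set of relations: every element of `ρ` is a linear combination of paths of one
length `t ≥ 2` with a common source and a common target.  (The quotients below are graded.) -/
def IsRelationSet (ρ : Set (PathAlg k V)) : Prop :=
  ∀ r ∈ ρ, ∃ (i j : V) (t : ℕ), 2 ≤ t ∧
    r ∈ Submodule.span k {x | ∃ p : Quiver.Path i j, p.length = t ∧ x = pathElt k p}

/-- The algebra `kQ/(ρ)` of the bound quiver `(Q, ρ)`. -/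
def BoundAlg (ρ : Set (PathAlg k V)) : Type u :=
  (TwoSidedIdeal.span ρ).ringCon.Quotient

instance (ρ : Set (PathAlg k V)) : Ring (BoundAlg ρ) :=
  inferInstanceAs (Ring (TwoSidedIdeal.span ρ).ringCon.Quotient)

instance (ρ : Set (PathAlg k V)) : Algebra k (BoundAlg ρ) :=
  inferInstanceAs (Algebra k (TwoSidedIdeal.span ρ).ringCon.Quotient)

/-- The projection `kQ → kQ/(ρ)`. -/
def proj (ρ : Set (PathAlg k V)) : PathAlg k V →ₐ[k] BoundAlg ρ :=
  (TwoSidedIdeal.span ρ).ringCon.mkₐ (α := k)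

/-- The idempotent `e_i` of `kQ/(ρ)`. -/
def idem (ρ : Set (PathAlg k V)) (i : V) : BoundAlg ρ := proj ρ (vertexElt k i)

/-- The image of a path in `kQ/(ρ)`. -/
def img (ρ : Set (PathAlg k V)) {i j : V} (p : Quiver.Path i j) : BoundAlg ρ :=
  proj ρ (pathElt k p)

/-- The degree `t` component `Λ_t` of `Λ = kQ/(ρ)`. -/
def comp (ρ : Set (PathAlg k V)) (t : ℕ) : Submodule k (BoundAlg ρ) :=
  Submodule.span k {x | ∃ (i j : V) (p : Quiver.Path i j), p.length = t ∧ x = img ρ p}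

/-- The space `e_j Λ_t e_i` of (images of) linear combinations of paths of length `t`
from `i` to `j`. -/
def homComp (ρ : Set (PathAlg k V)) (t : ℕ) (i j : V) : Submodule k (BoundAlg ρ) :=
  Submodule.span k {x | ∃ p : Quiver.Path i j, p.length = t ∧ x = img ρ p}

/-- A path is bound if its image in `kQ/(ρ)` is nonzero. -/
def IsBound (ρ : Set (PathAlg k V)) {i j : V} (p : Quiver.Path i j) : Prop := img ρ p ≠ 0

/-- A bound path is maximal if it cannot be prolonged to a longer bound path at either end. -/
def IsMaximalBound (ρ : Set (PathAlg k V)) {i j : V} (p : Quiver.Path i j) : Prop :=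
  IsBound ρ p ∧
    (∀ (l : V) (f : j ⟶ l), ¬ IsBound ρ (p.cons f)) ∧
    (∀ (l : V) (f : l ⟶ i), ¬ IsBound ρ (f.toPath.comp p))

/-- Two elements are linearly dependent over `k`. -/
def Dependent {A : Type u} [Ring A] [Algebra k A] (x y : A) : Prop :=
  ¬ LinearIndependent k ![x, y]

/-! ## Translation quivers -/

/-- `(Q, ρ)` is an `N`-translation quiver with projective vertices `P`, injective vertices `I`
and `N`-translation `τ`. -/
structure IsTranslationQuiver (N : ℕ) (ρ : Set (PathAlg k V)) (P I : Set V)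
    (τ : ↥(Pᶜ) ≃ ↥(Iᶜ)) : Prop where
  maximal : ∀ (a b : V) (p : Quiver.Path a b), IsMaximalBound ρ p →
    p.length = N + 1 ∧ ∃ i : ↥(Pᶜ), (i : V) = b ∧ (τ i : V) = a
  dependent : ∀ (i : ↥(Pᶜ)) (p q : Quiver.Path (τ i : V) (i : V)),
    p.length = N + 1 → q.length = N + 1 → IsBound ρ p → IsBound ρ q →
      Dependent (k := k) (img ρ p) (img ρ q)
  extend_left : ∀ (i : ↥(Pᶜ)) (j : V) (t : ℕ), t ≤ N + 1 →
    ∀ x ∈ homComp ρ t j (i : V), x ≠ 0 →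
      ∃ q : Quiver.Path (τ i : V) j, q.length + t = N + 1 ∧ x * img ρ q ≠ 0
  extend_right : ∀ (i : ↥(Iᶜ)) (j : V) (t : ℕ), t ≤ N + 1 →
    ∀ x ∈ homComp ρ t (i : V) j, x ≠ 0 →
      ∃ p : Quiver.Path j (τ.symm i : V), p.length + t = N + 1 ∧ img ρ p * x ≠ 0

/-- The path `p` passes through some vertex in `S` (its end points included). -/
def PassesThrough {i j : V} (p : Quiver.Path i j) (S : Set V) : Prop :=
  ∃ v ∈ S, v ∈ p.vertices

/-- The bound path `p` is shiftable: it is linearly dependent on paths `p' p''` such that `p''` is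
trivial or linearly dependent on paths through no injective vertex, and `p'` is trivial or linearly
dependent on paths through no projective vertex. -/
def IsShiftable (ρ : Set (PathAlg k V)) (P I : Set V) {i j : V} (p : Quiver.Path i j) : Prop :=
  IsBound ρ p ∧
  img ρ p ∈ Submodule.span k {x | ∃ (v : V) (p'' : Quiver.Path i v) (p' : Quiver.Path v j),
    x = img ρ p' * img ρ p'' ∧
    (p''.length = 0 ∨ img ρ p'' ∈ Submodule.span k
      {y | ∃ q : Quiver.Path i v, ¬ PassesThrough q I ∧ y = img ρ q}) ∧
    (p'.length = 0 ∨ img ρ p' ∈ Submodule.span k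
      {y | ∃ q : Quiver.Path v j, ¬ PassesThrough q P ∧ y = img ρ q})}

/-- Any bound path with the end points and the length of `p` is linearly dependent on `p`. -/
def IsEssentiallyUnique (ρ : Set (PathAlg k V)) {i j : V} (p : Quiver.Path i j) : Prop :=
  ∀ q : Quiver.Path i j, q.length = p.length → IsBound ρ q →
    Dependent (k := k) (img ρ p) (img ρ q)

/-- `p : i → j` is left stark of degree `t` with respect to `i'`. -/
def IsLeftStark (N : ℕ) (ρ : Set (PathAlg k V)) {i j : V} (p : Quiver.Path i j) (i' : V)
    (t : ℕ) : Prop :=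
  IsBound ρ p ∧ IsEssentiallyUnique ρ p ∧ t + p.length < N + 1 ∧
    ∀ w ∈ homComp ρ t i' i, w ≠ 0 → img ρ p * w ≠ 0

/-- `p : i → j` is right stark of degree `t` with respect to `j'`. -/
def IsRightStark (N : ℕ) (ρ : Set (PathAlg k V)) {i j : V} (p : Quiver.Path i j) (j' : V)
    (t : ℕ) : Prop :=
  IsBound ρ p ∧ IsEssentiallyUnique ρ p ∧ t + p.length < N + 1 ∧
    ∀ w ∈ homComp ρ t j j', w ≠ 0 → w * img ρ p ≠ 0

/-- The additional conditions for an `N`-translation quiver to be admissible. -/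
structure IsAdmissible (N : ℕ) (ρ : Set (PathAlg k V)) (P I : Set V)
    (τ : ↥(Pᶜ) ≃ ↥(Iᶜ)) : Prop where
  prolong : ∀ (a b : V) (p : Quiver.Path a b), IsBound ρ p →
    ∃ (a' b' : V) (q'' : Quiver.Path a' a) (q' : Quiver.Path b b'),
      ((q''.comp p).comp q').length = N + 1 ∧ IsBound ρ ((q''.comp p).comp q')
  shift : ∀ (a b : V) (p : Quiver.Path a b), IsBound ρ p → a ∉ I → b ∉ P →
    img ρ p ∈ Submodule.span k {x | ∃ q : Quiver.Path a b, IsShiftable ρ P I q ∧ x = img ρ q}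
  stark : ∀ (i : ↥(Pᶜ)) (a b : V) (p : Quiver.Path a (i : V)) (q : Quiver.Path (τ i : V) b),
    IsBound ρ p → IsBound ρ q → p.length + q.length ≤ N →
    PassesThrough p P → PassesThrough q I →
      IsLeftStark N ρ p b (N + 1 - (p.length + q.length)) ∨
      IsRightStark N ρ q a (N + 1 - (p.length + q.length))

/-! ## Koszulity and translation algebras -/

/-- The left ideal generated by the arrows and by the `e_j` with `j ≠ i`. -/
def simpleIdeal (ρ : Set (PathAlg k V)) (i : V) : Submodule (BoundAlg ρ) (BoundAlg ρ) :=
  Submodule.span (BoundAlg ρ) ({x | ∃ j : V, j ≠ i ∧ x = idem ρ j} ∪ (comp ρ 1 : Set (BoundAlg ρ)))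

/-- The simple left module `S(i) = Λ_0 e_i`. -/
abbrev Simple (ρ : Set (PathAlg k V)) (i : V) : Type u := BoundAlg ρ ⧸ simpleIdeal ρ i

/-- The submodule `Λ_1 M + Λ_2 M + ⋯` of a `Λ`-module. -/
def radModule (ρ : Set (PathAlg k V)) (M : Type u) [AddCommGroup M] [Module (BoundAlg ρ) M] :
    Submodule (BoundAlg ρ) M :=
  Submodule.span (BoundAlg ρ) {y | ∃ (s : ℕ) (a : BoundAlg ρ) (x : M), 1 ≤ s ∧ a ∈ comp ρ s ∧
    y = a • x}

/-- `gr` makes the `Λ`-module `M` a graded module (with degrees in `ℕ`). -/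
structure IsGradedModule (ρ : Set (PathAlg k V)) (M : Type u) [AddCommGroup M]
    [Module (BoundAlg ρ) M] (gr : ℕ → AddSubgroup M) : Prop where
  internal : DirectSum.IsInternal gr
  smul_mem : ∀ (s t : ℕ) (a : BoundAlg ρ) (x : M), a ∈ comp ρ s → x ∈ gr t → a • x ∈ gr (s + t)

/-- The first `q + 1` terms `P^q ⟶ ⋯ ⟶ P^0 ⟶ S(i) ⟶ 0` of a minimal graded projective resolution
of the simple module `S(i)` over `Λ = kQ/(ρ)`; if `q = ∞`, a whole minimal graded projective
resolution.  The modules are `X 0 ≃ S(i)` in degree `0` and `X (t + 1) = P^t`, with the maps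
`map t = f_t : P^t ⟶ P^(t-1)`; for `t > q` the terms carry no information. -/
structure MinimalResolution (ρ : Set (PathAlg k V)) (i : V) (q : ℕ∞) : Type (u + 1) where
  X : ℕ → Type u
  [grp : ∀ t, AddCommGroup (X t)]
  [mod : ∀ t, Module (BoundAlg ρ) (X t)]
  gr : ∀ t, ℕ → AddSubgroup (X t)
  graded : ∀ t, IsGradedModule ρ (X t) (gr t)
  simple : Nonempty (X 0 ≃ₗ[BoundAlg ρ] Simple ρ i)
  simple_degree : gr 0 0 = ⊤
  projective : ∀ t, Module.Projective (BoundAlg ρ) (X (t + 1))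
  map : ∀ t, X (t + 1) →ₗ[BoundAlg ρ] X t
  map_mem : ∀ t s, ∀ x ∈ gr (t + 1) s, map t x ∈ gr t s
  surjective : Function.Surjective (map 0)
  exact : ∀ t : ℕ, ((t + 1 : ℕ) : ℕ∞) ≤ q → LinearMap.range (map (t + 1)) = LinearMap.ker (map t)
  minimal : ∀ t : ℕ, (t : ℕ∞) ≤ q → LinearMap.ker (map t) ≤ radModule ρ (X (t + 1))

attribute [instance] MinimalResolution.grp MinimalResolution.mod

/-- `Λ = kQ/(ρ)` is `(p, q)`-Koszul: `Λ_t = 0` for `t > p`, the term `P^t` of the minimal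
projective resolution of each simple module is generated in degree `t` for `t ≤ q`, and, when `q` is
finite, the kernel of `f_q` is concentrated in degree `p + q`. -/
def IsKoszulOfType (ρ : Set (PathAlg k V)) (p : ℕ) (q : ℕ∞) : Prop :=
  (∀ t : ℕ, p < t → comp ρ t = ⊥) ∧
  ∀ i : V, ∃ R : MinimalResolution ρ i q,
    (∀ t : ℕ, (t : ℕ∞) ≤ q →
      Submodule.span (BoundAlg ρ) (R.gr (t + 1) t : Set (R.X (t + 1))) = ⊤) ∧
    (∀ t : ℕ, (t : ℕ∞) = q → ∀ x ∈ LinearMap.ker (R.map t), x ∈ R.gr (t + 1) (p + t))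

/-- The algebra `A` is an `N`-translation algebra: it is the algebra of a bound quiver that is an
`N`-translation quiver, and it is `(N + 1, q)`-Koszul for some `q ∈ {1, 2, …} ∪ {∞}`. -/
def IsTranslationAlgebra (k : Type u) [Field k] (N : ℕ) (A : Type u) [Ring A] [Algebra k A] :
    Prop :=
  ∃ (W : Type) (_ : Quiver.{0} W) (_ : Fintype W) (ρ : Set (PathAlg k W)),
    IsRelationSet ρ ∧ Nonempty (A ≃ₐ[k] BoundAlg ρ) ∧
    (∃ (P I : Set W) (τ : ↥(Pᶜ) ≃ ↥(Iᶜ)), IsTranslationQuiver N ρ P I τ) ∧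
    ∃ q : ℕ∞, 1 ≤ q ∧ IsKoszulOfType ρ (N + 1) q

end BoundQuiver

/-! ## Twisted trivial extensions -/

section TrivialExtension

variable {k : Type u} [Field k] {A : Type u} [Ring A] [Algebra k A]

/-- The dual bimodule `DA = Hom_k(A, k)`, twisted by the automorphism `σ` on the right:
`(a φ)(x) = φ(x a)` and `(φ a)(x) = φ(σ(a) x)`. -/
def TwistedDual (_σ : A ≃ₐ[k] A) : Type u := Module.Dual k A

variable (σ : A ≃ₐ[k] A)

instance : AddCommGroup (TwistedDual σ) := inferInstanceAs (AddCommGroup (Module.Dual k A))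

instance : Module k (TwistedDual σ) := inferInstanceAs (Module k (Module.Dual k A))

namespace TwistedDual

/-- An element of the twisted dual as a linear form on `A`. -/
def form {σ : A ≃ₐ[k] A} : TwistedDual σ ≃ₗ[k] Module.Dual k A := LinearEquiv.refl k _

theorem ext {σ : A ≃ₐ[k] A} {φ ψ : TwistedDual σ} (h : ∀ x, form φ x = form ψ x) : φ = ψ :=
  form.injective (LinearMap.ext h)

instance : SMul A (TwistedDual σ) where
  smul a φ := form.symm ((form φ).comp (LinearMap.mulRight k a))

instance : SMul Aᵐᵒᵖ (TwistedDual σ) where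
  smul a φ := form.symm ((form φ).comp (LinearMap.mulLeft k (σ a.unop)))

theorem smul_apply (a : A) (φ : TwistedDual σ) (x : A) : form (a • φ) x = form φ (x * a) := rfl

theorem op_smul_apply (a : Aᵐᵒᵖ) (φ : TwistedDual σ) (x : A) :
    form (a • φ) x = form φ (σ a.unop * x) := rfl

instance : Module A (TwistedDual σ) where
  one_smul φ := ext fun x => by simp [smul_apply]
  mul_smul a b φ := ext fun x => by simp [smul_apply, mul_assoc]
  smul_zero a := ext fun x => by simp [smul_apply]
  smul_add a φ ψ := ext fun x => by simp [smul_apply]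
  add_smul a b φ := ext fun x => by simp [smul_apply, mul_add]
  zero_smul φ := ext fun x => by simp [smul_apply]

instance : Module Aᵐᵒᵖ (TwistedDual σ) where
  one_smul φ := ext fun x => by simp [op_smul_apply]
  mul_smul a b φ := ext fun x => by simp [op_smul_apply, mul_assoc]
  smul_zero a := ext fun x => by simp [op_smul_apply]
  smul_add a φ ψ := ext fun x => by simp [op_smul_apply]
  add_smul a b φ := ext fun x => by simp [op_smul_apply, add_mul]
  zero_smul φ := ext fun x => by simp [op_smul_apply]

instance : SMulCommClass A Aᵐᵒᵖ (TwistedDual σ) where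
  smul_comm a b φ := ext fun x => by simp [smul_apply, op_smul_apply, mul_assoc]

instance : IsScalarTower k A (TwistedDual σ) where
  smul_assoc c a φ := ext fun x => by simp [smul_apply]

instance : IsScalarTower k Aᵐᵒᵖ (TwistedDual σ) where
  smul_assoc c a φ := ext fun x => by simp [op_smul_apply]

end TwistedDual

/-- The twisted trivial extension `A ⋉ DA`, with `DA` twisted by `σ`. -/
abbrev TwistedTrivialExtension : Type u := TrivSqZeroExt A (TwistedDual σ)

end TrivialExtension

/-- The `N`-translation algebra `Λ = kQ/(ρ)` is extendible: each of its trivial extensions, twisted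
by a graded automorphism fixing the vertices (the untwisted one included), is an
`(N + 1)`-translation algebra. -/
def IsExtendible {k : Type u} [Field k] {V : Type} [Quiver.{0} V] [Fintype V] (N : ℕ)
    (ρ : Set (PathAlg k V)) : Prop :=
  ∀ σ : BoundAlg ρ ≃ₐ[k] BoundAlg ρ, (∀ i : V, σ (idem ρ i) = idem ρ i) →
    (∀ (t : ℕ), ∀ x ∈ comp ρ t, σ x ∈ comp ρ t) →
      IsTranslationAlgebra k (N + 1) (TwistedTrivialExtension σ)

/-! ## The `n`-cubic pyramid quiver and algebra

Coordinates are numbered from `0`: the coordinate, or the type of an arrow, that is usually numbered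
`t + 1` is `t : Fin n` here. -/

/-- `i(t)`: add `1` to the coordinate `t` and subtract `1` from the preceding one, if any. -/
def step {n : ℕ} (t : Fin n) (i : Fin n → ℤ) : Fin n → ℤ := fun j =>
  i j + (if j = t then 1 else 0) - (if (j : ℕ) + 1 = (t : ℕ) then 1 else 0)

/-- The vertices `(i_1, …, i_n)` with `i_t ≥ 1` and `i_1 + ⋯ + i_s ≤ m + s - 1` for all `s`. -/
def Vertex (n m : ℕ) : Type :=
  {i : Fin n → ℤ // (∀ t, 1 ≤ i t) ∧ ∀ s : Fin n, ∑ t ∈ Finset.Iic s, i t ≤ (m : ℤ) + (s : ℕ)}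

theorem finite_vertex (n m : ℕ) : Finite (Vertex n m) := by
  apply Set.Finite.to_subtype
  apply Set.Finite.subset (Set.finite_Icc (fun _ : Fin n => (1 : ℤ)) (fun _ => (m : ℤ) + n))
  rintro i ⟨h1, h2⟩
  refine ⟨fun t => h1 t, fun t => ?_⟩
  have h3 : i t ≤ ∑ s ∈ Finset.Iic t, i s :=
    Finset.single_le_sum (f := i) (fun s _ => le_trans zero_le_one (h1 s))
      (Finset.mem_Iic.2 le_rfl)
  have h4 := h2 t
  have h5 : ((t : ℕ) : ℤ) < n := by exact_mod_cast t.isLt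
  show i t ≤ (m : ℤ) + n
  linarith

instance (n m : ℕ) : Fintype (Vertex n m) :=
  haveI := finite_vertex n m
  Fintype.ofFinite _

/-- The `n`-cubic pyramid quiver of height `m`: an arrow of type `t` from `i` to `i(t)`. -/
instance (n m : ℕ) : Quiver.{0} (Vertex n m) where
  Hom i j := {t : Fin n // j.1 = step t i.1}

/-- The scalars `d_{s,t,i}` of a family `g_1 = 1, g_2, …, g_n` with
`g_s(γ_{t,i}) = d_{s,t,i} γ_{t, g_s(i)}` for `t < s`: they are nonzero, and the maps `g_s` are
compatible with the relations among the arrows of types `< s`, that is, for `t < u < s` and any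
`3`-cube of `Q(n)` spanned at `i` by arrows of types `t, u, s`, the two scalars by which the relations
of the faces compare the path with types `t, u, s` to the one with types `s, u, t` agree. -/
structure IsTwistFamily {k : Type u} [Field k] {n m : ℕ} (d : Fin n → Fin n → Vertex n m → k) :
    Prop where
  ne_zero : ∀ (s t : Fin n) (i : Vertex n m), t < s → d s t i ≠ 0
  compatible : ∀ (t u s : Fin n), t < u → u < s →
    ∀ i it iu is itu its ius itus : Vertex n m,
      it.1 = step t i.1 → iu.1 = step u i.1 → is.1 = step s i.1 →
      itu.1 = step u it.1 → its.1 = step s it.1 → ius.1 = step s iu.1 →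
      itus.1 = step s itu.1 →
        d s u it * d s t i * d u t is = d u t i * d s t iu * d s u i

/-- The relation set `ρ^g(n)`: the commutation relations
`d_{s,t,i} γ_{t,i(s)} γ_{s,i} - γ_{s,i(t)} γ_{t,i}` for `t < s`, and `γ_{t,i(t)} γ_{t,i}`,
whenever all the vertices involved are in `Q(n)`. -/
def pyramidRel {k : Type u} [Field k] {n m : ℕ} (d : Fin n → Fin n → Vertex n m → k) :
    Set (PathAlg k (Vertex n m)) :=
  {r | ∃ (t s : Fin n) (i x y z : Vertex n m) (hx : x.1 = step s i.1) (hy : y.1 = step t i.1)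
      (hxz : z.1 = step t x.1) (hyz : z.1 = step s y.1), t < s ∧
      r = d s t i • (arrowElt k (show x ⟶ z from ⟨t, hxz⟩) * arrowElt k (show i ⟶ x from ⟨s, hx⟩))
        - arrowElt k (show y ⟶ z from ⟨s, hyz⟩) * arrowElt k (show i ⟶ y from ⟨t, hy⟩)} ∪
  {r | ∃ (t : Fin n) (i x y : Vertex n m) (hx : x.1 = step t i.1) (hy : y.1 = step t x.1),
      r = arrowElt k (show x ⟶ y from ⟨t, hy⟩) * arrowElt k (show i ⟶ x from ⟨t, hx⟩)}

/-- The projective vertices: those with `i_n = 1`. -/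
def projectiveVertices {n : ℕ} (m : ℕ) (hn : 1 ≤ n) : Set (Vertex n m) :=
  {i | i.1 ⟨n - 1, by omega⟩ = 1}

/-- The injective vertices: those with `i_1 + ⋯ + i_n = n + m - 1`. -/
def injectiveVertices (n m : ℕ) : Set (Vertex n m) :=
  {i | ∑ t, i.1 t = (n : ℤ) + m - 1}

end NCubic

end

/-!
A vertex `i` of the pyramid quiver is a configuration of `m - 1` particles on the sites `0, …, n`:
there are `i t - 1` particles on the site `t + 1`, and the remaining ones are on the site `0`
(`occ`). An arrow of type `t` moves one particle to the site `t + 1` from the site before it. If the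
sites are ordered cyclically, then the one move that is missing, from the last site to the site `0`,
is the move `0`. A *cube* `(a, T)` is a configuration `a` with a set `T` of moves such that
`a + disp T` is a configuration again.

The pyramid algebra has a basis indexed by the cubes `(a, T)` with `0 ∉ T`, and a product of
composable basis elements is a nonzero multiple of a basis element if no move is repeated and zero
otherwise; this is a `CubicalBasis` (`pyramidBasis`). The basis consists of the paths that make the
moves in ascending order. They span because the commutation relations sort any path, and they are
linearly independent because the regular representation can be written down explicitly: the scalars
`sortFactor` picked up when a move is sorted in define a representation of the path algebra, and the
condition on the `3`-cubes is exactly what makes the commutation relations hold in it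
(`sortFactor_comm`, `regularPathRep_eq_zero`). A twisted trivial extension has a cubical basis, too,
in which the cubes with `0 ∈ T` are the linear forms dual to the complementary cubes
(`CubicalBasis.trivialExtension`): the trivial extension merely adds the missing move. This works
for every twist, because a graded automorphism that fixes the vertices can only rescale the basis.

All remaining claims are proved for an arbitrary bound quiver whose algebra has a cubical basis with
the set `D` of allowed moves (`Realizes`), where `D` contains all moves with the possible exception
of the move `0`. The maximal bound paths make each allowed move once, which gives the translation
(`Realizes.isTranslationQuiver`). The condition of admissibility on shiftable paths amounts to the
observation that the moves of a path from a vertex that is not injective to one that is not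
projective can be reordered so that it leaves the projective vertices before it enters the injective
ones (`Realizes.exists_intermediate`); for the condition on stark paths it suffices that three sets
of moves are disjoint if together they have the displacement of all allowed moves
(`Realizes.disjoint_of_disp_add`).

For the Koszul property, the simple module at `a` is resolved by a Koszul complex
(`CubicalBasis.koszulTerm`, `CubicalBasis.bd`) whose term of degree `N` is the sum of the projective
modules at the configurations reached from `a` by `N` moves, in which each particle moves at most
once (`IsBox`). As only the products up to scalars are known, the coefficients of the differential
have to be chosen recursively (`CubicalBasis.kappa`); associativity, in the form of
`CubicalBasis.swap_hexagon`, implies that the square of the differential is zero. In coordinates the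
complex is a sum of small complexes with one component `(r, T)` for each way to write a multiset of
moves as the sum of a box `r` and a set `T`, and it is exact as soon as one move may belong to
either of them (`CubicalBasis.exists_bd_eq`). By `eq_of_forall_not_isFree`, the only exceptions are
the empty multiset, which gives the simple module, and, if all moves are allowed, the multiset in
which every particle moves once and in addition one particle enters each site. Hence the complex is
exact for the pyramid algebra, and for the trivial extension it is exact up to the degree `m - 1`,
where the kernel is concentrated in one degree. Finally, a presentation of the trivial extension by
a bound quiver is obtained from its cubical basis (`configEquiv`).
-/

namespace NCubic

/-! ### Configurations and cubes -/

section Configurations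

variable {n : ℕ}

/-- The displacement of a configuration of particles on `n + 1` cyclically ordered sites when, for
each `t ∈ T`, one particle moves from the site `t - 1` to the site `t`. -/
def disp (T : Finset (Fin (n + 1))) : Fin (n + 1) → ℤ := fun j =>
  (if j ∈ T then 1 else 0) - (if j + 1 ∈ T then 1 else 0)

/-- A configuration of `p` particles on `n + 1` sites. -/
def IsConfig (p : ℕ) (a : Fin (n + 1) → ℤ) : Prop := (∀ j, 0 ≤ a j) ∧ ∑ j, a j = p

/-- The set `T` of moves, all of them allowed by `D`, leads from the configuration `a` to a
configuration. -/
def IsCube (p : ℕ) (D : Finset (Fin (n + 1))) (a : Fin (n + 1) → ℤ) (T : Finset (Fin (n + 1))) :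
    Prop :=
  T ⊆ D ∧ IsConfig p a ∧ IsConfig p (a + disp T)

@[simp] theorem disp_empty : disp (∅ : Finset (Fin (n + 1))) = 0 := by
  ext j; simp [disp]

@[simp] theorem disp_univ : disp (Finset.univ : Finset (Fin (n + 1))) = 0 := by
  ext j; simp [disp]

theorem disp_union {S T : Finset (Fin (n + 1))} (h : Disjoint S T) :
    disp (S ∪ T) = disp S + disp T := by
  ext j
  have h1 := fun i (hi : i ∈ S) => Finset.disjoint_left.1 h hi
  simp only [disp, Finset.mem_union, Pi.add_apply]
  by_cases a1 : j ∈ S <;> by_cases a2 : j ∈ T <;> by_cases a3 : j + 1 ∈ S <;>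
    by_cases a4 : j + 1 ∈ T <;> simp [a1, a2, a3, a4] <;>
    first | exact h1 _ a1 a2 | exact h1 _ a3 a4

theorem disp_sdiff {S T : Finset (Fin (n + 1))} (h : S ⊆ T) :
    disp S + disp (T \ S) = disp T := by
  rw [← disp_union Finset.disjoint_sdiff, Finset.union_sdiff_of_subset h]

theorem disp_compl (T : Finset (Fin (n + 1))) : disp T + disp Tᶜ = 0 := by
  rw [← disp_union disjoint_compl_right, Finset.union_compl, disp_univ]

theorem sum_disp (T : Finset (Fin (n + 1))) : ∑ j, disp T j = 0 := by
  have h := Equiv.sum_comp (Equiv.addRight (1 : Fin (n + 1)))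
    (fun j => if j ∈ T then (1 : ℤ) else 0)
  simp only [Equiv.coe_addRight] at h
  simp only [disp, Finset.sum_sub_distrib]
  exact sub_eq_zero.2 h.symm

/-- A function on the cyclically ordered sites that is invariant under the rotation is constant. -/
theorem eq_zero_apply_of_rotate {α : Type*} {f : Fin (n + 1) → α} (h : ∀ j, f j = f (j + 1))
    (j : Fin (n + 1)) : f j = f 0 := by
  induction j using Fin.induction with
  | zero => rfl
  | succ i ih => rw [← ih, h i.castSucc, Fin.coeSucc_eq_succ]

theorem eq_empty_or_univ_of_rotate {T : Finset (Fin (n + 1))} (h : ∀ j, j ∈ T ↔ j + 1 ∈ T) :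
    T = ∅ ∨ T = Finset.univ := by
  have h2 := eq_zero_apply_of_rotate (f := fun j => j ∈ T) (fun j => propext (h j))
  by_cases h0 : (0 : Fin (n + 1)) ∈ T
  · right
    ext j
    simpa [h0] using h2 j
  · left
    ext j
    simpa [h0] using h2 j

/-- The set of moves is determined by its displacement up to the rotation of all particles. -/
theorem mem_sub_mem_eq {S T : Finset (Fin (n + 1))} (h : disp S = disp T) (j : Fin (n + 1)) :
    ((if j ∈ S then 1 else 0 : ℤ) - if j ∈ T then 1 else 0) =
      (if (0 : Fin (n + 1)) ∈ S then 1 else 0) - if (0 : Fin (n + 1)) ∈ T then 1 else 0 := by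
  refine eq_zero_apply_of_rotate (f := fun j =>
    ((if j ∈ S then 1 else 0 : ℤ) - if j ∈ T then 1 else 0)) (fun j => ?_) j
  have h1 := congrFun h j
  simp only [disp] at h1
  show ((if j ∈ S then 1 else 0 : ℤ) - if j ∈ T then 1 else 0) =
    (if j + 1 ∈ S then 1 else 0) - if j + 1 ∈ T then 1 else 0
  linarith

theorem eq_of_disp_eq_of_zero_mem_iff {S T : Finset (Fin (n + 1))} (h : disp S = disp T)
    (h0 : (0 : Fin (n + 1)) ∈ S ↔ (0 : Fin (n + 1)) ∈ T) : S = T := by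
  ext j
  have h1 := mem_sub_mem_eq h j
  simp only [h0, sub_self] at h1
  by_cases a1 : j ∈ S <;> by_cases a2 : j ∈ T <;> simp [a1, a2] at h1 ⊢

theorem eq_of_disp_eq_of_card_eq {S T : Finset (Fin (n + 1))} (h : disp S = disp T)
    (hc : S.card = T.card) : S = T := by
  apply eq_of_disp_eq_of_zero_mem_iff h
  have h1 : ∑ j : Fin (n + 1), ((if j ∈ S then 1 else 0 : ℤ) - if j ∈ T then 1 else 0) = 0 := by
    simp [Finset.sum_sub_distrib, hc]
  simp only [mem_sub_mem_eq h, Finset.sum_const, Finset.card_univ, Fintype.card_fin,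
    nsmul_eq_mul] at h1
  have h2 := (mul_eq_zero.1 h1).resolve_left (by positivity)
  by_cases a1 : (0 : Fin (n + 1)) ∈ S <;> by_cases a2 : (0 : Fin (n + 1)) ∈ T <;>
    simp [a1, a2] at h2 ⊢

theorem isConfig_add_disp_iff {p : ℕ} {a : Fin (n + 1) → ℤ} (ha : IsConfig p a)
    (T : Finset (Fin (n + 1))) :
    IsConfig p (a + disp T) ↔ ∀ j, j + 1 ∈ T → j ∉ T → 1 ≤ a j := by
  constructor
  · intro h j h1 h2
    have := h.1 j
    simp [disp, h1, h2] at this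
    linarith
  · intro h
    refine ⟨fun j => ?_, ?_⟩
    · have h0 := ha.1 j
      have h1 := h j
      by_cases a1 : j + 1 ∈ T <;> by_cases a2 : j ∈ T <;> simp [disp, a1, a2] at h1 ⊢ <;> linarith
    · simp only [Pi.add_apply, Finset.sum_add_distrib, sum_disp, ha.2, add_zero]

theorem isCube_empty {p : ℕ} {D : Finset (Fin (n + 1))} {a : Fin (n + 1) → ℤ} :
    IsCube p D a ∅ ↔ IsConfig p a := by
  simp [IsCube]

namespace IsCube

variable {p : ℕ} {D : Finset (Fin (n + 1))} {a : Fin (n + 1) → ℤ} {S T : Finset (Fin (n + 1))}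

theorem union (h : IsCube p D a T) (h' : IsCube p D (a + disp T) S) (hd : Disjoint T S) :
    IsCube p D a (T ∪ S) :=
  ⟨Finset.union_subset h.1 h'.1, h.2.1, by rw [disp_union hd, ← add_assoc]; exact h'.2.2⟩

theorem right_of_union (h : IsCube p D a (T ∪ S)) (hd : Disjoint T S)
    (h' : IsConfig p (a + disp T)) : IsCube p D (a + disp T) S :=
  ⟨Finset.union_subset_right h.1, h', by
    rw [add_assoc, ← disp_union hd]; exact h.2.2⟩

/-- Every nonempty set of moves has one that can be made last. -/
theorem exists_last (hp : 1 ≤ p) (h : IsCube p D a T) (hT : T.Nonempty) :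
    ∃ t ∈ T, IsCube p D a (T.erase t) := by
  by_cases h1 : ∃ t ∈ T, t + 1 ∉ T
  · obtain ⟨t, ht, ht'⟩ := h1
    refine ⟨t, ht, (Finset.erase_subset _ _).trans h.1, h.2.1, ?_⟩
    have h2 := (isConfig_add_disp_iff h.2.1 _).1 h.2.2
    rw [isConfig_add_disp_iff h.2.1]
    intro j hj hj'
    refine h2 j (Finset.mem_of_mem_erase hj) fun hjT => ?_
    have : j = t := by
      by_contra hne
      exact hj' (Finset.mem_erase.2 ⟨hne, hjT⟩)
    subst this
    exact ht' (Finset.mem_of_mem_erase hj)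
  · push Not at h1
    -- Here all particles rotate, and any occupied site may be entered last.
    have hu : T = Finset.univ := by
      refine (eq_empty_or_univ_of_rotate fun j => ⟨h1 j, fun hj => ?_⟩).resolve_left hT.ne_empty
      have h2 : T.map (Equiv.addRight (1 : Fin (n + 1))).toEmbedding = T :=
        Finset.eq_of_subset_of_card_le
          (fun i hi => by
            obtain ⟨j, hj, rfl⟩ := Finset.mem_map.1 hi
            exact h1 j hj)
          (by rw [Finset.card_map])
      rw [← h2] at hj
      simpa using hj
    have h3 : ∃ t, 1 ≤ a t := by
      by_contra h4
      push Not at h4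
      have h5 : ∑ j, a j ≤ ∑ j : Fin (n + 1), (0 : ℤ) :=
        Finset.sum_le_sum fun j _ => by have := h4 j; omega
      rw [h.2.1.2] at h5
      simp at h5
      omega
    obtain ⟨t, ht⟩ := h3
    refine ⟨t, hu ▸ Finset.mem_univ t, (Finset.erase_subset _ _).trans h.1, h.2.1, ?_⟩
    rw [isConfig_add_disp_iff h.2.1]
    intro j _ hj'
    have : j = t := by
      by_contra hne
      exact hj' (Finset.mem_erase.2 ⟨hne, hu ▸ Finset.mem_univ j⟩)
    rwa [this]

/-- A cube that does not use all allowed moves is a face of a larger one that starts or ends at the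
same vertex. -/
theorem exists_extension (hD : ∀ s, s ≠ 0 → s ∈ D) (hp : 1 ≤ p) (h : IsCube p D a T)
    (hT : T ≠ D) :
    ∃ t ∈ D, t ∉ T ∧ (IsCube p D (a + disp T) {t} ∨ IsCube p D (a - disp {t}) {t}) := by
  by_contra hcon
  push Not at hcon
  have key : ∀ t ∈ D, t ∉ T → (t - 1 ∉ T ∧ a (t - 1) = 0) ∧ (t + 1 ∉ T ∧ a t = 0) := by
    intro t htD htT
    obtain ⟨h1, h2⟩ := hcon t htD htT
    constructor
    · have h3 : ¬ IsConfig p (a + disp T + disp {t}) := fun h4 =>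
        h1 ⟨by simpa using htD, h.2.2, h4⟩
      rw [isConfig_add_disp_iff h.2.2] at h3
      push Not at h3
      obtain ⟨j, hj, -, hj'⟩ := h3
      have hjt : j = t - 1 := by simpa [eq_sub_iff_add_eq] using hj
      subst hjt
      have h5 := h.2.1.1 (t - 1)
      simp only [Pi.add_apply, disp, sub_add_cancel, htT, if_false] at hj'
      by_cases h6 : t - 1 ∈ T
      · simp [h6] at hj'; omega
      · simp [h6] at hj'; exact ⟨h6, by omega⟩
    · have h3 : ¬ IsConfig p (a - disp {t}) := fun h4 =>
        h2 ⟨by simpa using htD, h4, by simpa using h.2.1⟩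
      have h4 : a t = 0 := by
        by_contra h5
        apply h3
        have h6 := h.2.1.1
        refine ⟨fun j => ?_, ?_⟩
        · have h7 := h6 j
          simp only [Pi.sub_apply, disp, Finset.mem_singleton]
          by_cases h8 : j = t
          · subst h8
            split_ifs <;> omega
          · simp only [h8, if_false]
            split_ifs <;> omega
        · simp only [Pi.sub_apply, Finset.sum_sub_distrib, sum_disp, h.2.1.2, sub_zero]
      refine ⟨fun h5 => ?_, h4⟩
      have h6 := h.2.2.1 t
      simp [disp, htT, h5, h4] at h6
  have hTe : ∀ t, t ∉ T := by
    obtain ⟨t, htD, htT⟩ : ∃ t ∈ D, t ∉ T := by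
      by_contra h1
      push Not at h1
      exact hT (Finset.Subset.antisymm h.1 h1)
    -- Going around the sites from `t`, in both directions as far as `0`.
    have up : ∀ s, t ≤ s → s ∉ T := by
      intro s
      induction s using Fin.induction with
      | zero => intro hs; rwa [Fin.le_zero_iff.1 hs] at htT
      | succ i ih =>
        intro hs
        rcases hs.eq_or_lt with rfl | hs
        · exact htT
        have hi : t ≤ i.castSucc := Fin.le_castSucc_iff.2 hs
        have h1 : i.castSucc ∈ D := by
          by_cases h2 : i.castSucc = 0
          · rw [h2] at hi ⊢
            rwa [Fin.le_zero_iff.1 hi] at htD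
          · exact hD _ h2
        have := (key _ h1 (ih hi)).2.1
        rwa [Fin.coeSucc_eq_succ] at this
    have down : ∀ s, s ≤ t → s ∉ T := by
      intro s
      induction s using Fin.reverseInduction with
      | last => intro hs; rwa [← Fin.last_le_iff.1 hs]
      | cast i ih =>
        intro hs
        rcases hs.eq_or_lt with hs | hs
        · rwa [hs]
        have := (key _ (hD _ (Fin.succ_ne_zero i)) (ih (Fin.castSucc_lt_iff_succ_le.1 hs))).1.1
        rwa [← Fin.coeSucc_eq_succ, add_sub_cancel_right] at this
    exact fun s => (le_total t s).elim (up s) (down s)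
  have ha : ∀ j, a j = 0 := by
    intro j
    by_cases hj : j ∈ D
    · exact (key j hj (hTe j)).2.2
    · have hj0 : j = 0 := by
        by_contra h1
        exact hj (hD j h1)
      have h1 : j + 1 ∈ D := by
        by_contra h2
        have h3 : j + 1 = 0 := by
          by_contra h3
          exact h2 (hD _ h3)
        have h4 : ∀ i : Fin (n + 1), i = 0 := by
          intro i
          have h5 : (1 : Fin (n + 1)) = 0 := by simpa [hj0] using h3
          exact eq_zero_apply_of_rotate (f := fun i => i) (fun i => by simp [h5]) i
        apply hT
        ext i
        rw [h4 i, ← hj0]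
        simp [hj, hTe j]
      have := (key (j + 1) h1 (hTe _)).1.2
      simpa using this
  have := h.2.1.2
  simp [ha] at this
  omega

end IsCube

end Configurations

/-! ### Algebras with a cubical basis -/

/-- A basis of an algebra that is indexed by the cubes `(a, T)` of configurations and multiplicative
up to nonzero scalars: `x a ∅` are orthogonal idempotents, `x a T` leads from `a` to `a + disp T`,
and a product of two composable basis elements is a nonzero multiple of a basis element if no move
is repeated, and zero otherwise.  By convention `x a T = 0` if `(a, T)` is not a cube. -/
structure CubicalBasis (k : Type u) [Field k] (A : Type u) [Ring A] [Algebra k A] (n p : ℕ)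
    (D : Finset (Fin (n + 1))) where
  x : (Fin (n + 1) → ℤ) → Finset (Fin (n + 1)) → A
  eq_zero : ∀ a T, ¬ IsCube p D a T → x a T = 0
  indep : LinearIndependent k
    fun c : {c : (Fin (n + 1) → ℤ) × Finset (Fin (n + 1)) // IsCube p D c.1 c.2} => x c.1.1 c.1.2
  span_eq_top : Submodule.span k {y | ∃ a T, y = x a T} = ⊤
  mul_of_ne : ∀ a b S T, b ≠ a + disp T → x b S * x a T = 0
  mul_of_not_disjoint : ∀ a S T, ¬ Disjoint T S → x (a + disp T) S * x a T = 0
  mul_of_disjoint : ∀ a S T, IsCube p D a T → IsCube p D (a + disp T) S → Disjoint T S →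
    ∃ c : k, c ≠ 0 ∧ x (a + disp T) S * x a T = c • x a (T ∪ S)
  idem_mul : ∀ a T, x (a + disp T) ∅ * x a T = x a T
  mul_idem : ∀ a T, x a T * x a ∅ = x a T

namespace CubicalBasis

variable {k : Type u} [Field k] {A : Type u} [Ring A] [Algebra k A] {n p : ℕ}
  {D : Finset (Fin (n + 1))} (C : CubicalBasis k A n p D)

/-- A linear property of elements of `A` holds if it holds for the elements of the basis. -/
theorem induction {P : A → Prop} (hx : ∀ a T, IsCube p D a T → P (C.x a T)) (h0 : P 0)
    (hadd : ∀ y z, P y → P z → P (y + z)) (hsmul : ∀ (c : k) y, P y → P (c • y)) (y : A) : P y := by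
  have hy : y ∈ Submodule.span k {y | ∃ a T, y = C.x a T} := by simp [C.span_eq_top]
  induction hy using Submodule.span_induction with
  | mem y h =>
    obtain ⟨a, T, rfl⟩ := h
    by_cases h : IsCube p D a T
    · exact hx a T h
    · rwa [C.eq_zero a T h]
  | zero => exact h0
  | add y z _ _ h1 h2 => exact hadd y z h1 h2
  | smul c y _ h => exact hsmul c y h

/-- The cubes `(a, T)` form a basis of `A`. -/
noncomputable def basis : Module.Basis
    {c : (Fin (n + 1) → ℤ) × Finset (Fin (n + 1)) // IsCube p D c.1 c.2} k A :=
  Module.Basis.mk C.indep (by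
    rw [← C.span_eq_top]
    refine Submodule.span_le.2 ?_
    rintro _ ⟨a, T, rfl⟩
    by_cases h : IsCube p D a T
    · exact Submodule.subset_span ⟨⟨(a, T), h⟩, rfl⟩
    · rw [C.eq_zero a T h]; exact Submodule.zero_mem _)

open Classical in
/-- The coordinate at the cube `(a, T)`; it is zero if this is not a cube. -/
noncomputable def coord (a : Fin (n + 1) → ℤ) (T : Finset (Fin (n + 1))) : A →ₗ[k] k :=
  if h : IsCube p D a T then C.basis.coord ⟨(a, T), h⟩ else 0

open Classical in
theorem coord_x (a b : Fin (n + 1) → ℤ) (S T : Finset (Fin (n + 1))) :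
    C.coord a T (C.x b S) = if b = a ∧ S = T ∧ IsCube p D a T then 1 else 0 := by
  by_cases h : IsCube p D a T
  · by_cases h' : IsCube p D b S
    · have h1 : C.x b S = C.basis ⟨(b, S), h'⟩ := by simp [basis]
      rw [coord, dif_pos h, h1, Module.Basis.coord_apply, Module.Basis.repr_self,
        Finsupp.single_apply]
      simp [h]
    · rw [C.eq_zero b S h', map_zero, if_neg]
      rintro ⟨rfl, rfl, -⟩
      exact h' h
  · simp [coord, h]

theorem coord_x_self {a : Fin (n + 1) → ℤ} {T : Finset (Fin (n + 1))} (h : IsCube p D a T) :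
    C.coord a T (C.x a T) = 1 := by
  simp [coord_x, h]

theorem coord_of_not_isCube {a : Fin (n + 1) → ℤ} {T : Finset (Fin (n + 1))}
    (h : ¬ IsCube p D a T) : C.coord a T = 0 := by
  simp [coord, h]

theorem x_ne_zero {a : Fin (n + 1) → ℤ} {T : Finset (Fin (n + 1))} (h : IsCube p D a T) :
    C.x a T ≠ 0 := by
  intro h0
  have := C.coord_x_self h
  simp [h0] at this

/-- The scalar by which the product of composable basis elements differs from a basis element. -/
noncomputable def coeff (a : Fin (n + 1) → ℤ) (T S : Finset (Fin (n + 1))) : k :=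
  C.coord a (T ∪ S) (C.x (a + disp T) S * C.x a T)

theorem x_mul_x (a : Fin (n + 1) → ℤ) (S T : Finset (Fin (n + 1))) :
    C.x (a + disp T) S * C.x a T = C.coeff a T S • C.x a (T ∪ S) := by
  by_cases hd : Disjoint T S
  swap
  · simp [coeff, C.mul_of_not_disjoint a S T hd]
  by_cases h1 : IsCube p D a T
  swap
  · simp [coeff, C.eq_zero a T h1]
  by_cases h2 : IsCube p D (a + disp T) S
  swap
  · simp [coeff, C.eq_zero _ S h2]
  obtain ⟨c, -, hc⟩ := C.mul_of_disjoint a S T h1 h2 hd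
  rw [coeff, hc, map_smul, C.coord_x_self (h1.union h2 hd), smul_eq_mul, mul_one]

theorem coeff_ne_zero {a : Fin (n + 1) → ℤ} {S T : Finset (Fin (n + 1))} (h1 : IsCube p D a T)
    (h2 : IsCube p D (a + disp T) S) (hd : Disjoint T S) : C.coeff a T S ≠ 0 := by
  obtain ⟨c, hc0, hc⟩ := C.mul_of_disjoint a S T h1 h2 hd
  rwa [coeff, hc, map_smul, C.coord_x_self (h1.union h2 hd), smul_eq_mul, mul_one]

theorem coeff_of_not_disjoint {a : Fin (n + 1) → ℤ} {S T : Finset (Fin (n + 1))}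
    (hd : ¬ Disjoint T S) : C.coeff a T S = 0 := by
  rw [coeff, C.mul_of_not_disjoint a S T hd, map_zero]

theorem mul_idem_eq_sum (v : Fin (n + 1) → ℤ) (y : A) :
    y * C.x v ∅ = ∑ T, C.coord v T y • C.x v T := by
  classical
  induction y using C.induction with
  | hx b S h =>
    by_cases hb : b = v
    · subst hb
      rw [C.mul_idem, Finset.sum_eq_single S]
      · rw [C.coord_x_self h, one_smul]
      · intro T _ hT
        simp [coord_x, hT.symm]
      · simp
    · rw [C.mul_of_ne _ _ _ _ (by simpa using hb), Finset.sum_eq_zero]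
      intro T _
      simp [coord_x, hb]
  | h0 => simp
  | hadd y z h1 h2 => simp [add_mul, h1, h2, add_smul, Finset.sum_add_distrib]
  | hsmul c y h => simp [h, Finset.smul_sum, smul_smul]

theorem eq_sum_of_mul_idem {v : Fin (n + 1) → ℤ} {y : A} (h : y * C.x v ∅ = y) :
    y = ∑ T, C.coord v T y • C.x v T := by
  rw [← mul_idem_eq_sum, h]

open Classical in
theorem coord_mul_x (v : Fin (n + 1) → ℤ) (S U : Finset (Fin (n + 1))) (y : A) :
    C.coord v U (y * C.x v S) =
      if S ⊆ U then C.coeff v S (U \ S) * C.coord (v + disp S) (U \ S) y else 0 := by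
  induction y using C.induction with
  | hx b R h =>
    by_cases hb : b = v + disp S
    · subst hb
      rw [C.x_mul_x, map_smul, C.coord_x, C.coord_x, smul_eq_mul]
      by_cases hd : Disjoint S R
      · by_cases hU : S ∪ R = U
        · subst hU
          have h1 : (S ∪ R) \ S = R := by
            rw [Finset.union_sdiff_left, Finset.sdiff_eq_self_of_disjoint hd.symm]
          by_cases h2 : IsCube p D v (S ∪ R)
          · simp [h1, h2, h]
          · have h3 : C.coeff v S R = 0 := by
              rw [coeff, C.coord_of_not_isCube h2]; rfl
            simp [h1, h3]
        · rw [if_neg (by simp [hU])]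
          by_cases hS : S ⊆ U
          · rw [if_pos hS, if_neg, mul_zero, mul_zero]
            rintro ⟨-, rfl, -⟩
            exact hU (Finset.union_sdiff_of_subset hS)
          · rw [if_neg hS, mul_zero]
      · rw [C.coeff_of_not_disjoint hd, zero_mul]
        split_ifs with h1 h2
        · exact absurd (h2.2.1 ▸ Finset.disjoint_sdiff) hd
        · simp
        · rfl
    · rw [C.mul_of_ne _ _ _ _ hb, map_zero, C.coord_x]
      simp [hb]
  | h0 => simp
  | hadd y z h1 h2 => rw [add_mul, map_add, h1, h2, map_add]; split_ifs <;> ring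
  | hsmul c y h =>
    rw [smul_mul_assoc, map_smul, h, map_smul, smul_eq_mul, smul_eq_mul]; split_ifs <;> ring

open Classical in
theorem coord_x_mul (v a : Fin (n + 1) → ℤ) (T U : Finset (Fin (n + 1))) (y : A) :
    C.coord v U (C.x a T * y) =
      if T ⊆ U ∧ a + disp T = v + disp U then C.coeff v (U \ T) T * C.coord v (U \ T) y else 0 := by
  induction y using C.induction with
  | hx w R h =>
    have haux : T ⊆ U → (a + disp T = v + disp U ↔ a = v + disp (U \ T)) := by
      intro hT
      rw [← disp_sdiff hT, add_comm (disp T), ← add_assoc, add_left_inj]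
    by_cases ha : a = w + disp R
    · subst ha
      rw [C.x_mul_x, map_smul, C.coord_x, C.coord_x, smul_eq_mul]
      by_cases hd : Disjoint R T
      · by_cases hU : w = v ∧ R ∪ T = U
        · obtain ⟨rfl, rfl⟩ := hU
          have h1 : (R ∪ T) \ T = R := by
            rw [Finset.union_sdiff_right, Finset.sdiff_eq_self_of_disjoint hd]
          have h4 : w + disp R + disp T = w + disp (R ∪ T) := by rw [disp_union hd, add_assoc]
          by_cases h2 : IsCube p D w (R ∪ T)
          · simp [h1, h2, h, h4]
          · have h3 : C.coeff w R T = 0 := by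
              rw [coeff, C.coord_of_not_isCube h2]; rfl
            simp [h1, h3]
        · rw [if_neg (by tauto)]
          by_cases hS : T ⊆ U
          · rw [if_neg (c := w = v ∧ R = U \ T ∧ _)]
            · simp
            rintro ⟨rfl, rfl, -⟩
            exact hU ⟨rfl, Finset.sdiff_union_of_subset hS⟩
          · rw [if_neg (by tauto), mul_zero]
      · rw [C.coeff_of_not_disjoint hd, zero_mul]
        split_ifs with h1 h2
        · exact absurd (h2.2.1 ▸ Finset.sdiff_disjoint) hd
        · simp
        · rfl
    · rw [C.mul_of_ne _ _ _ _ ha, map_zero, C.coord_x]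
      split_ifs with h1 h2
      · rw [haux h1.1] at h1
        exact absurd (by rw [h1.2, h2.1, h2.2.1]) ha
      · simp
      · rfl
  | h0 => simp
  | hadd y z h1 h2 => rw [mul_add, map_add, h1, h2, map_add]; split_ifs <;> ring
  | hsmul c y h =>
    rw [mul_smul_comm, map_smul, h, map_smul, smul_eq_mul, smul_eq_mul]; split_ifs <;> ring

/-- A cubical basis is transported along an isomorphism of algebras. -/
def map {B : Type u} [Ring B] [Algebra k B] (e : A ≃ₐ[k] B) : CubicalBasis k B n p D where
  x a T := e (C.x a T)
  eq_zero a T h := by rw [C.eq_zero a T h, map_zero]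
  indep := C.indep.map' e.toLinearMap (LinearMap.ker_eq_bot.2 e.injective)
  span_eq_top := by
    have h := congrArg (Submodule.map e.toLinearMap) C.span_eq_top
    rw [Submodule.map_span, Submodule.map_top, LinearMap.range_eq_top.2 e.surjective] at h
    rw [← h]
    congr 1
    ext y
    constructor
    · rintro ⟨a, T, rfl⟩
      exact ⟨_, ⟨a, T, rfl⟩, rfl⟩
    · rintro ⟨_, ⟨a, T, rfl⟩, rfl⟩
      exact ⟨a, T, rfl⟩
  mul_of_ne a b S T h := by rw [← map_mul, C.mul_of_ne a b S T h, map_zero]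
  mul_of_not_disjoint a S T h := by rw [← map_mul, C.mul_of_not_disjoint a S T h, map_zero]
  mul_of_disjoint a S T h1 h2 h3 := by
    obtain ⟨c, hc, h⟩ := C.mul_of_disjoint a S T h1 h2 h3
    exact ⟨c, hc, by rw [← map_mul, h, map_smul]⟩
  idem_mul a T := by rw [← map_mul, C.idem_mul]
  mul_idem a T := by rw [← map_mul, C.mul_idem]

end CubicalBasis

/-! ### Boxes of repeated moves -/

section Box

variable {n : ℕ}

/-- The configuration reached from `a` when `r t` particles move from the site `t - 1` to the site
`t`, for each `t`. -/
def move (a : Fin (n + 1) → ℤ) (r : Fin (n + 1) → ℕ) : Fin (n + 1) → ℤ := fun j =>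
  a j + r j - r (j + 1)

/-- The numbers `r t` of moves are bounded by the numbers of particles that `a` has on the sites
`t - 1`, and only moves from `D` occur. -/
def IsBox (D : Finset (Fin (n + 1))) (a : Fin (n + 1) → ℤ) (r : Fin (n + 1) → ℕ) : Prop :=
  ∀ t, (t ∈ D → (r t : ℤ) ≤ a (t - 1)) ∧ (t ∉ D → r t = 0)

/-- The indicator function of a set of moves. -/
def ind (T : Finset (Fin (n + 1))) : Fin (n + 1) → ℕ := fun t => if t ∈ T then 1 else 0

theorem ind_singleton (t : Fin (n + 1)) : ind {t} = Pi.single t 1 := by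
  ext j; simp [ind, Pi.single_apply]

theorem ind_union {S T : Finset (Fin (n + 1))} (h : Disjoint S T) :
    ind (S ∪ T) = ind S + ind T := by
  ext j
  have h1 := fun hi : j ∈ S => Finset.disjoint_left.1 h hi
  by_cases a1 : j ∈ S <;> by_cases a2 : j ∈ T <;> simp [ind, a1, a2]
  exact h1 a1 a2

theorem ind_insert {t : Fin (n + 1)} {T : Finset (Fin (n + 1))} (h : t ∉ T) :
    ind (insert t T) = Pi.single t 1 + ind T := by
  rw [Finset.insert_eq, ind_union (by simpa using h), ind_singleton]

theorem single_add_ind_erase {t : Fin (n + 1)} {T : Finset (Fin (n + 1))} (h : t ∈ T) :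
    Pi.single t 1 + ind (T.erase t) = ind T := by
  rw [← ind_insert (Finset.notMem_erase t T), Finset.insert_erase h]

variable {a : Fin (n + 1) → ℤ} {D : Finset (Fin (n + 1))} {p : ℕ}

@[simp] theorem move_zero : move a 0 = a := by
  ext j; simp [move]

theorem move_add_ind (r : Fin (n + 1) → ℕ) (T : Finset (Fin (n + 1))) :
    move a (r + ind T) = move a r + disp T := by
  ext j
  simp only [move, ind, disp, Pi.add_apply]
  push_cast
  ring

theorem move_add_single (r : Fin (n + 1) → ℕ) (t : Fin (n + 1)) :
    move a (r + Pi.single t 1) = move a r + disp {t} := by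
  rw [← ind_singleton, move_add_ind]

theorem IsBox.mono {r r' : Fin (n + 1) → ℕ} (h : IsBox D a r) (hr : r' ≤ r) : IsBox D a r' := by
  intro t
  have h1 : r' t ≤ r t := hr t
  refine ⟨fun ht => le_trans (by exact_mod_cast h1) ((h t).1 ht), fun ht => ?_⟩
  have := (h t).2 ht
  omega

theorem IsBox.isConfig {r : Fin (n + 1) → ℕ} (h : IsBox D a r) (ha : IsConfig p a) :
    IsConfig p (move a r) := by
  constructor
  · intro j
    have h1 := h (j + 1)
    have h2 := ha.1 j
    rw [add_sub_cancel_right] at h1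
    simp only [move]
    by_cases hj : j + 1 ∈ D
    · have := h1.1 hj
      omega
    · have := h1.2 hj
      omega
  · have h1 := Equiv.sum_comp (Equiv.addRight (1 : Fin (n + 1))) (fun j => (r j : ℤ))
    simp only [Equiv.coe_addRight] at h1
    simp only [move, Finset.sum_sub_distrib, Finset.sum_add_distrib, h1, ha.2]
    ring

theorem IsBox.isCube {r : Fin (n + 1) → ℕ} {T : Finset (Fin (n + 1))}
    (h : IsBox D a (r + ind T)) (ha : IsConfig p a) : IsCube p D (move a r) T := by
  refine ⟨fun t ht => ?_, (h.mono le_self_add).isConfig ha, ?_⟩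
  · by_contra h1
    have := (h t).2 h1
    simp [ind, ht] at this
  · rw [← move_add_ind]
    exact h.isConfig ha

theorem sum_add_single (r : Fin (n + 1) → ℕ) (t : Fin (n + 1)) :
    ∑ j, (r + Pi.single t 1 : Fin (n + 1) → ℕ) j = ∑ j, r j + 1 := by
  simp [Finset.sum_add_distrib]

/-- The move `t` occurs in the multiset `w` of moves, and it may be counted among the moves of a box
as well as once outside of it. -/
def IsFree (D : Finset (Fin (n + 1))) (a : Fin (n + 1) → ℤ) (w : Fin (n + 1) → ℕ)
    (t : Fin (n + 1)) : Prop :=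
  t ∈ D ∧ 1 ≤ w t ∧ (w t : ℤ) ≤ a (t - 1)

/-- Without free moves there is either no move at all, or every particle moves once and in addition
one particle enters each site. -/
theorem eq_of_forall_not_isFree {r : Fin (n + 1) → ℕ} {T : Finset (Fin (n + 1))}
    (hr : IsBox D a r) (hT : IsCube p D (move a r) T) (h : ∀ t, ¬ IsFree D a (r + ind T) t) :
    (r = 0 ∧ T = ∅) ∨ (T = Finset.univ ∧ ∀ t, (r t : ℤ) = a (t - 1)) := by
  have h1 : ∀ t, t ∈ T → (r t : ℤ) = a (t - 1) := by
    intro t ht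
    have h2 := h t
    have h3 := (hr t).1 (hT.1 ht)
    simp only [IsFree, hT.1 ht, Pi.add_apply, ind, ht, if_true, true_and, not_and, not_le] at h2
    have := h2 (by omega)
    push_cast at this
    omega
  have h2 : ∀ t, t ∉ T → r t = 0 := by
    intro t ht
    by_cases htD : t ∈ D
    · have h2 := h t
      have h3 := (hr t).1 htD
      simp only [IsFree, htD, Pi.add_apply, ind, ht, if_false, true_and, not_and, not_le,
        add_zero] at h2
      by_contra h4
      have := h2 (by omega)
      omega
    · exact (hr t).2 htD
  have h3 : ∀ t, t + 1 ∈ T → t ∈ T := by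
    intro t ht
    by_contra ht'
    have h4 := (isConfig_add_disp_iff hT.2.1 T).1 hT.2.2 t ht ht'
    have h5 := h1 _ ht
    rw [add_sub_cancel_right] at h5
    simp only [move, h2 t ht', h5] at h4
    simp at h4
  have h4 : ∀ t, t ∈ T ↔ t + 1 ∈ T := by
    have h5 : T.map (Equiv.addRight (1 : Fin (n + 1))).symm.toEmbedding = T :=
      Finset.eq_of_subset_of_card_le
        (fun i hi => by
          obtain ⟨j, hj, rfl⟩ := Finset.mem_map.1 hi
          exact h3 _ (by simpa using hj))
        (by rw [Finset.card_map])
    intro t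
    refine ⟨fun ht => ?_, h3 t⟩
    rw [← h5] at ht
    obtain ⟨j, hj, rfl⟩ := Finset.mem_map.1 ht
    simpa using hj
  rcases eq_empty_or_univ_of_rotate h4 with rfl | rfl
  · exact Or.inl ⟨funext fun t => h2 t (by simp), rfl⟩
  · exact Or.inr ⟨rfl, fun t => h1 t (by simp)⟩

end Box

/-! ### The signs of the Koszul complex -/

namespace CubicalBasis

variable {k : Type u} [Field k] {A : Type u} [Ring A] [Algebra k A] {n p : ℕ}
  {D : Finset (Fin (n + 1))} (C : CubicalBasis k A n p D)

/-- The scalar by which the product of the moves `s` and then `t` differs from that of `t` and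
then `s`. -/
noncomputable def swap (v : Fin (n + 1) → ℤ) (s t : Fin (n + 1)) : k :=
  C.coeff v {s} {t} / C.coeff v {t} {s}

section Swap

variable {C} {v : Fin (n + 1) → ℤ} {s t u : Fin (n + 1)}

theorem isCube_right {S T : Finset (Fin (n + 1))} (hd : Disjoint T S)
    (h : IsCube p D v (T ∪ S)) (h' : IsCube p D v T) : IsCube p D (v + disp T) S :=
  h.right_of_union hd h'.2.2

theorem coeff_pair_ne_zero (hst : s ≠ t) (hs : IsCube p D v {s}) (h : IsCube p D v {s, t}) :
    C.coeff v {s} {t} ≠ 0 := by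
  have hd : Disjoint ({s} : Finset (Fin (n + 1))) {t} := by simpa using hst
  exact C.coeff_ne_zero hs (isCube_right hd h hs) hd

theorem swap_mul_swap (hst : s ≠ t) (hs : IsCube p D v {s}) (ht : IsCube p D v {t})
    (h : IsCube p D v {s, t}) : C.swap v s t * C.swap v t s = 1 := by
  have h1 := coeff_pair_ne_zero (C := C) hst hs h
  have h2 := coeff_pair_ne_zero (C := C) hst.symm ht (by rwa [Finset.pair_comm])
  rw [swap, swap]
  field_simp

theorem mul_eq_swap_smul (hst : s ≠ t) (ht : IsCube p D v {t}) (h : IsCube p D v {s, t}) :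
    C.x (v + disp {s}) {t} * C.x v {s} =
      C.swap v s t • (C.x (v + disp {t}) {s} * C.x v {t}) := by
  have h2 := coeff_pair_ne_zero (C := C) hst.symm ht (by rwa [Finset.pair_comm])
  rw [C.x_mul_x, C.x_mul_x, smul_smul, swap, div_mul_cancel₀ _ h2, Finset.union_comm]

/-- The two ways to reverse the order of three moves agree. -/
theorem swap_hexagon (hst : s ≠ t) (hsu : s ≠ u) (htu : t ≠ u)
    (h : ∀ T ⊆ ({s, t, u} : Finset (Fin (n + 1))), IsCube p D v T) :
    C.swap v s t * C.swap (v + disp {t}) s u * C.swap v t u =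
      C.swap (v + disp {s}) t u * C.swap v s u * C.swap (v + disp {u}) s t := by
  have hsing : ∀ i ∈ ({s, t, u} : Finset (Fin (n + 1))), IsCube p D v {i} := fun i hi =>
    h _ (by simpa using hi)
  have hpair : ∀ i ∈ ({s, t, u} : Finset (Fin (n + 1))), ∀ j ∈ ({s, t, u} : Finset (Fin (n + 1))),
      IsCube p D v {i, j} := fun i hi j hj =>
    h _ (Finset.insert_subset hi (by simpa using hj))
  have hr : ∀ i ∈ ({s, t, u} : Finset (Fin (n + 1))), ∀ T ⊆ ({s, t, u} : Finset (Fin (n + 1))),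
      i ∉ T → IsCube p D (v + disp {i}) T := fun i hi T hT hiT =>
    isCube_right (by simpa using hiT) (h _ (Finset.union_subset (by simpa using hi) hT))
      (hsing i hi)
  have ms : s ∈ ({s, t, u} : Finset (Fin (n + 1))) := by simp
  have mt : t ∈ ({s, t, u} : Finset (Fin (n + 1))) := by simp
  have mu : u ∈ ({s, t, u} : Finset (Fin (n + 1))) := by simp
  have hr1 : ∀ i ∈ ({s, t, u} : Finset (Fin (n + 1))), ∀ j ∈ ({s, t, u} : Finset (Fin (n + 1))),
      i ≠ j → IsCube p D (v + disp {i}) {j} := fun i hi j hj hij =>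
    hr i hi _ (by simpa using hj) (by simpa using hij)
  have hr2 : ∀ i ∈ ({s, t, u} : Finset (Fin (n + 1))), ∀ j ∈ ({s, t, u} : Finset (Fin (n + 1))),
      ∀ l ∈ ({s, t, u} : Finset (Fin (n + 1))), i ≠ j → i ≠ l →
      IsCube p D (v + disp {i}) {j, l} := fun i hi j hj l hl hij hil =>
    hr i hi _ (Finset.insert_subset hj (by simpa using hl)) (by simp [hij, hil])
  -- The three moves in the order `s, t, u`, reversed in both ways.
  have e1 : C.x (v + disp {s} + disp {t}) {u} * C.x (v + disp {s}) {t} * C.x v {s} =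
      (C.swap v s t * C.swap (v + disp {t}) s u * C.swap v t u) •
        (C.x (v + disp {u} + disp {t}) {s} * C.x (v + disp {u}) {t} * C.x v {u}) := by
    rw [mul_assoc, mul_eq_swap_smul hst (hsing t mt) (hpair s ms t mt), mul_smul_comm, ← mul_assoc,
      add_right_comm v, mul_eq_swap_smul hsu (hr1 t mt u mu htu) (hr2 t mt s ms u mu hst.symm htu),
      smul_mul_assoc, mul_assoc, mul_eq_swap_smul htu (hsing u mu) (hpair t mt u mu),
      mul_smul_comm, smul_smul, smul_smul, ← mul_assoc, add_right_comm v (disp {t})]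
  have e2 : C.x (v + disp {s} + disp {t}) {u} * C.x (v + disp {s}) {t} * C.x v {s} =
      (C.swap (v + disp {s}) t u * C.swap v s u * C.swap (v + disp {u}) s t) •
        (C.x (v + disp {u} + disp {t}) {s} * C.x (v + disp {u}) {t} * C.x v {u}) := by
    rw [mul_eq_swap_smul htu (hr1 s ms u mu hsu) (hr2 s ms t mt u mu hst hsu), smul_mul_assoc,
      mul_assoc, mul_eq_swap_smul hsu (hsing u mu) (hpair s ms u mu), mul_smul_comm, ← mul_assoc,
      add_right_comm v, mul_eq_swap_smul hst (hr1 u mu t mt htu.symm)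
        (hr2 u mu s ms t mt hsu.symm htu.symm), smul_mul_assoc, smul_smul, smul_smul]
  have hne : C.x (v + disp {u} + disp {t}) {s} * C.x (v + disp {u}) {t} * C.x v {u} ≠ 0 := by
    have hd : Disjoint ({u} : Finset (Fin (n + 1))) ({t} ∪ {s}) := by
      simp [hsu.symm, htu.symm]
    have hd' : Disjoint ({t} : Finset (Fin (n + 1))) {s} := by simpa using hst.symm
    rw [C.x_mul_x, smul_mul_assoc, C.x_mul_x, smul_smul]
    refine smul_ne_zero (mul_ne_zero (C.coeff_ne_zero (hr1 u mu t mt htu.symm) ?_ hd')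
      (C.coeff_ne_zero (hsing u mu) (hr2 u mu t mt s ms htu.symm hsu.symm) hd))
      (C.x_ne_zero (h _ ?_))
    · exact isCube_right hd' (hr2 u mu t mt s ms htu.symm hsu.symm) (hr1 u mu t mt htu.symm)
    · intro i hi
      simp only [Finset.mem_union, Finset.mem_singleton] at hi
      simp only [Finset.mem_insert, Finset.mem_singleton]
      tauto
  exact smul_left_injective k hne (e1.symm.trans e2)

end Swap

variable (a : Fin (n + 1) → ℤ)

/-- The least move that occurs in `r`. -/
noncomputable def lead (r : Fin (n + 1) → ℕ) : Fin (n + 1) :=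
  if h : (Finset.univ.filter fun t => r t ≠ 0).Nonempty then
    (Finset.univ.filter fun t => r t ≠ 0).min' h else 0

theorem lead_spec {r : Fin (n + 1) → ℕ} {t : Fin (n + 1)} (ht : r t ≠ 0) :
    r (lead r) ≠ 0 ∧ lead r ≤ t := by
  have h : (Finset.univ.filter fun t => r t ≠ 0).Nonempty := ⟨t, by simpa using ht⟩
  rw [lead, dif_pos h]
  exact ⟨(Finset.mem_filter.1 (Finset.min'_mem _ h)).2, Finset.min'_le _ _ (by simpa using ht)⟩

theorem eq_add_single_lead {r : Fin (n + 1) → ℕ} {t : Fin (n + 1)} (ht : r t ≠ 0) :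
    r - Pi.single t 1 + Pi.single t 1 = r := by
  ext j
  by_cases hj : j = t
  · subst hj
    simp
    omega
  · simp [hj]

open Classical in
/-- The coefficients of the differential of the Koszul complex.  They are normalized to be `1` when
the least move is removed; the other ones are then forced by the condition that the square of the
differential is zero. -/
noncomputable def kappa (r : Fin (n + 1) → ℕ) (s : Fin (n + 1)) : k :=
  if _h : ∃ t, t < s ∧ r t ≠ 0 then
    -(kappa (r - Pi.single (lead r) 1) s * C.swap (move a (r - Pi.single (lead r) 1)) s (lead r))
  else 1
termination_by ∑ j, r j
decreasing_by
  obtain ⟨t, -, ht⟩ := _h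
  have h1 := sum_add_single (r - Pi.single (lead r) 1) (lead r)
  rw [eq_add_single_lead (lead_spec ht).1] at h1
  omega

theorem kappa_eq_one {r : Fin (n + 1) → ℕ} {s : Fin (n + 1)} (h : ∀ t, t < s → r t = 0) :
    C.kappa a r s = 1 := by
  rw [kappa, dif_neg]
  push Not
  exact h

theorem kappa_add_single {r : Fin (n + 1) → ℕ} {s t : Fin (n + 1)} (hts : t < s)
    (h : ∀ u, u < t → r u = 0) :
    C.kappa a (r + Pi.single t 1) s = -(C.kappa a r s * C.swap (move a r) s t) := by
  have h1 : (r + Pi.single t 1 : Fin (n + 1) → ℕ) t ≠ 0 := by simp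
  have h2 : lead (r + Pi.single t 1) = t := by
    obtain ⟨h3, h4⟩ := lead_spec h1
    refine le_antisymm h4 (not_lt.1 fun h5 => h3 ?_)
    simp [h _ h5, h5.ne]
  rw [kappa, dif_pos ⟨t, hts, h1⟩, h2, add_tsub_cancel_right]

variable {a} in
theorem isCube_move_pair {r : Fin (n + 1) → ℕ} {s t : Fin (n + 1)} (ha : IsConfig p a) (hst : s ≠ t)
    (h : IsBox D a (r + Pi.single s 1 + Pi.single t 1)) :
    IsCube p D (move a r) {s} ∧ IsCube p D (move a r) {t} ∧ IsCube p D (move a r) {s, t} := by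
  refine ⟨IsBox.isCube (h.mono ?_) ha, IsBox.isCube (h.mono ?_) ha, IsBox.isCube (h.mono ?_) ha⟩
  · rw [ind_singleton]; exact le_self_add
  · rw [ind_singleton, add_right_comm]; exact le_self_add
  · rw [ind_insert (by simpa using hst), ind_singleton, add_assoc]

theorem kappa_ne_zero (ha : IsConfig p a) {r : Fin (n + 1) → ℕ} {s : Fin (n + 1)}
    (h : IsBox D a (r + Pi.single s 1)) : C.kappa a r s ≠ 0 := by
  induction hN : ∑ j, r j generalizing r with
  | zero => 
    rw [kappa_eq_one]
    · exact one_ne_zero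
    · intro t _
      exact (Finset.sum_eq_zero_iff.1 hN) t (Finset.mem_univ t)
  | succ N ih =>
    by_cases h1 : ∃ t, t < s ∧ r t ≠ 0
    · obtain ⟨t, hts, ht⟩ := h1
      obtain ⟨h2, h3⟩ := lead_spec ht
      have h4 : ∀ u, u < lead r → r u = 0 := fun u hu => by
        by_contra h5
        exact absurd (lead_spec h5).2 (not_le.2 hu)
      obtain ⟨r', hr'⟩ : ∃ r' : Fin (n + 1) → ℕ, r = r' + Pi.single (lead r) 1 :=
      ⟨_, (eq_add_single_lead h2).symm⟩
      have hlt := h3.trans_lt hts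
      generalize lead r = t0 at *
      subst hr'
      have h6 : ∀ u, u < t0 → r' u = 0 := fun u hu => by
        have := h4 u hu
        simp at this
        exact this.1
      obtain ⟨c1, c2, c3⟩ := isCube_move_pair (s := s) (t := t0) ha hlt.ne'
        (by rwa [add_right_comm] at h)
      rw [C.kappa_add_single a hlt h6]
      refine neg_ne_zero.2 (mul_ne_zero (ih ?_ ?_) ?_)
      · refine h.mono ?_
        rw [add_right_comm]
        exact le_self_add
      · rw [sum_add_single] at hN
        omega
      · exact left_ne_zero_of_mul_eq_one (swap_mul_swap hlt.ne' c1 c2 c3)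
    · push Not at h1
      rw [C.kappa_eq_one a h1]
      exact one_ne_zero

theorem kappa_mul_kappa_of_lt (ha : IsConfig p a) {r : Fin (n + 1) → ℕ} {s t : Fin (n + 1)}
    (hst : s < t) (h : IsBox D a (r + Pi.single s 1 + Pi.single t 1)) :
    C.kappa a r s * C.kappa a (r + Pi.single s 1) t * C.swap (move a r) s t =
      -(C.kappa a r t * C.kappa a (r + Pi.single t 1) s) := by
  induction hN : ∑ j, r j using Nat.strong_induction_on generalizing r with
  | _ N ih =>
  by_cases h1 : ∃ u, u < s ∧ r u ≠ 0
  · obtain ⟨u, hus, hu⟩ := h1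
    obtain ⟨h2, h3⟩ := lead_spec hu
    have h4 : ∀ u, u < lead r → r u = 0 := fun u hu => by
      by_contra h5
      exact absurd (lead_spec h5).2 (not_le.2 hu)
    obtain ⟨r', hr'⟩ : ∃ r' : Fin (n + 1) → ℕ, r = r' + Pi.single (lead r) 1 :=
      ⟨_, (eq_add_single_lead h2).symm⟩
    have hlt := h3.trans_lt hus
    generalize lead r = t0 at *
    subst hr'
    have h6 : ∀ u, u < t0 → r' u = 0 := fun u hu => by
      have := h4 u hu
      simp at this
      exact this.1
    have h7 : ∀ i, t0 < i → ∀ u, u < t0 → (r' + Pi.single i 1 : Fin (n + 1) → ℕ) u = 0 :=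
      fun i hi u hu => by
      simp [h6 u hu, (hu.trans hi).ne]
    have hlt' := hlt.trans hst
    have hex := swap_hexagon (C := C) (v := move a r') (s := s) (t := t) (u := t0) hst.ne hlt.ne'
      hlt'.ne' (fun T hT => by
        refine IsBox.isCube (h.mono ?_) ha
        have h8 : ind T ≤ ind {s, t, t0} := by
          intro j
          simp only [ind]
          split_ifs with h9 h10
          · exact le_rfl
          · exact absurd (hT h9) h10
          · exact zero_le_one
          · exact le_rfl
        refine (add_le_add_right h8 r').trans (le_of_eq ?_)
        rw [ind_insert (by simp [hst.ne, hlt.ne']), ind_insert (by simpa using hlt'.ne'),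
          ind_singleton]
        abel)
    have hih := ih (∑ j, r' j) (by rw [← hN, sum_add_single]; omega) (r := r')
      (h.mono fun j => by simp only [Pi.add_apply]; omega) rfl
    rw [add_right_comm r', add_right_comm r' (Pi.single t0 1), C.kappa_add_single a hlt h6,
      C.kappa_add_single a hlt' h6, C.kappa_add_single a hlt' (h7 s hlt),
      C.kappa_add_single a hlt (h7 t hlt'), move_add_single, move_add_single, move_add_single]
    linear_combination (C.swap (move a r') t t0 * C.swap (move a r' + disp {t}) s t0) * hih -
      (C.kappa a r' s * C.kappa a (r' + Pi.single s 1) t) * hex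
  · push Not at h1
    obtain ⟨c1, c2, c3⟩ := isCube_move_pair ha hst.ne h
    rw [C.kappa_eq_one a h1, C.kappa_add_single a hst h1, C.kappa_eq_one a (s := s)]
    · linear_combination -(C.kappa a r t) * swap_mul_swap (C := C) hst.ne c1 c2 c3
    · intro u hu
      simp [h1 u hu, (hu.trans hst).ne]

/-- The two ways to remove two moves cancel. -/
theorem kappa_mul_kappa (ha : IsConfig p a) {r : Fin (n + 1) → ℕ} {s t : Fin (n + 1)}
    (hst : s ≠ t) (h : IsBox D a (r + Pi.single s 1 + Pi.single t 1)) :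
    (C.kappa a r s * C.kappa a (r + Pi.single s 1) t) •
        (C.x (move a (r + Pi.single s 1)) {t} * C.x (move a r) {s}) +
      (C.kappa a r t * C.kappa a (r + Pi.single t 1) s) •
        (C.x (move a (r + Pi.single t 1)) {s} * C.x (move a r) {t}) = 0 := by
  wlog hlt : s < t generalizing s t
  · rw [add_comm]
    exact this hst.symm (by rwa [add_right_comm]) (lt_of_le_of_ne (not_lt.1 hlt) hst.symm)
  obtain ⟨-, c2, c3⟩ := isCube_move_pair ha hst h
  rw [move_add_single, move_add_single, mul_eq_swap_smul hst c2 c3, smul_smul,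
    C.kappa_mul_kappa_of_lt a ha hlt h, neg_smul, neg_add_cancel]

end CubicalBasis

/-! ### The Koszul complex -/

namespace CubicalBasis

variable {k : Type u} [Field k] {A : Type u} [Ring A] [Algebra k A] {n p : ℕ}
  {D : Finset (Fin (n + 1))} (C : CubicalBasis k A n p D) (a : Fin (n + 1) → ℤ)

open Classical in
/-- The term of degree `N` of the Koszul complex of the simple module at `a`: the direct sum of the
modules `A e_b`, where `b` is reached from `a` by a box of `N` moves, realized as a module of
functions. -/
noncomputable def koszulTerm (N : ℕ) : Submodule A ((Fin (n + 1) → ℕ) → A) where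
  carrier := {g | ∀ r, g r * (if IsBox D a r ∧ ∑ j, r j = N then C.x (move a r) ∅ else 0) = g r}
  add_mem' h1 h2 r := by rw [Pi.add_apply, add_mul, h1, h2]
  zero_mem' r := by simp
  smul_mem' c g h r := by rw [Pi.smul_apply, smul_eq_mul, mul_assoc, h]

variable {C a} {N : ℕ} {g : (Fin (n + 1) → ℕ) → A} {r : Fin (n + 1) → ℕ}

theorem mem_koszulTerm_iff : g ∈ C.koszulTerm a N ↔
    (∀ r, IsBox D a r → ∑ j, r j = N → g r * C.x (move a r) ∅ = g r) ∧
      ∀ r, ¬ (IsBox D a r ∧ ∑ j, r j = N) → g r = 0 := by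
  constructor
  · intro h
    refine ⟨fun r h1 h2 => ?_, fun r h1 => ?_⟩
    · have := h r
      rwa [if_pos ⟨h1, h2⟩] at this
    · have := h r
      rw [if_neg h1, mul_zero] at this
      exact this.symm
  · rintro ⟨h1, h2⟩ r
    by_cases h : IsBox D a r ∧ ∑ j, r j = N
    · rw [if_pos h, h1 r h.1 h.2]
    · rw [if_neg h, mul_zero, h2 r h]

theorem mul_idem_of_mem (h : g ∈ C.koszulTerm a N) (r : Fin (n + 1) → ℕ) :
    g r * C.x (move a r) ∅ = g r := by
  by_cases h1 : IsBox D a r ∧ ∑ j, r j = N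
  · exact (mem_koszulTerm_iff.1 h).1 r h1.1 h1.2
  · rw [(mem_koszulTerm_iff.1 h).2 r h1, zero_mul]

theorem eq_zero_of_mem (h : g ∈ C.koszulTerm a N) (h1 : ¬ (IsBox D a r ∧ ∑ j, r j = N)) : g r = 0 :=
  (mem_koszulTerm_iff.1 h).2 r h1

theorem eq_zero_of_mem_of_coord (h : g ∈ C.koszulTerm a N)
    (h1 : ∀ r T, IsBox D a r → ∑ j, r j = N → IsCube p D (move a r) T →
      C.coord (move a r) T (g r) = 0) : g = 0 := by
  ext r
  by_cases h2 : IsBox D a r ∧ ∑ j, r j = N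
  · rw [C.eq_sum_of_mul_idem (mul_idem_of_mem h r)]
    refine Finset.sum_eq_zero fun T _ => ?_
    by_cases hT : IsCube p D (move a r) T
    · rw [h1 r T h2.1 h2.2 hT, zero_smul]
    · rw [C.eq_zero _ _ hT, smul_zero]
  · exact eq_zero_of_mem h h2

variable (C a)

/-- The differential of the Koszul complex. -/
noncomputable def bd : ((Fin (n + 1) → ℕ) → A) →ₗ[A] ((Fin (n + 1) → ℕ) → A) where
  toFun g r := ∑ s, C.kappa a r s • (g (r + Pi.single s 1) * C.x (move a r) {s})
  map_add' g g' := by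
    ext r
    simp [add_mul, Finset.sum_add_distrib]
  map_smul' c g := by
    ext r
    simp [mul_assoc, Finset.mul_sum]

theorem bd_apply (g : (Fin (n + 1) → ℕ) → A) (r : Fin (n + 1) → ℕ) :
    C.bd a g r = ∑ s, C.kappa a r s • (g (r + Pi.single s 1) * C.x (move a r) {s}) := rfl

variable {C a}

theorem bd_mem (h : g ∈ C.koszulTerm a (N + 1)) : C.bd a g ∈ C.koszulTerm a N := by
  refine mem_koszulTerm_iff.2 ⟨fun r h1 h2 => ?_, fun r h1 => ?_⟩
  · rw [bd_apply, Finset.sum_mul]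
    refine Finset.sum_congr rfl fun s _ => ?_
    rw [smul_mul_assoc, mul_assoc, C.mul_idem]
  · rw [bd_apply]
    refine Finset.sum_eq_zero fun s _ => ?_
    rw [eq_zero_of_mem h, zero_mul, smul_zero]
    rintro ⟨h2, h3⟩
    rw [sum_add_single] at h3
    exact h1 ⟨h2.mono le_self_add, by omega⟩

theorem bd_eq_zero_of_mem_zero (h : g ∈ C.koszulTerm a 0) : C.bd a g = 0 := by
  ext r
  rw [bd_apply, Pi.zero_apply]
  refine Finset.sum_eq_zero fun s _ => ?_
  rw [eq_zero_of_mem h, zero_mul, smul_zero]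
  rintro ⟨-, h3⟩
  rw [sum_add_single] at h3
  omega

theorem bd_bd (ha : IsConfig p a) (h : g ∈ C.koszulTerm a N) : C.bd a (C.bd a g) = 0 := by
  ext r
  have h1 : C.bd a (C.bd a g) r = ∑ q : Fin (n + 1) × Fin (n + 1),
      g (r + Pi.single q.1 1 + Pi.single q.2 1) *
        ((C.kappa a r q.1 * C.kappa a (r + Pi.single q.1 1) q.2) •
          (C.x (move a (r + Pi.single q.1 1)) {q.2} * C.x (move a r) {q.1})) := by
    rw [Fintype.sum_prod_type, bd_apply]
    refine Finset.sum_congr rfl fun s _ => ?_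
    rw [bd_apply, Finset.sum_mul, Finset.smul_sum]
    refine Finset.sum_congr rfl fun t _ => ?_
    rw [smul_mul_assoc, smul_smul, mul_assoc, mul_smul_comm]
  rw [h1]
  refine Finset.sum_involution (fun q _ => q.swap) ?_ ?_ (fun _ _ => Finset.mem_univ _)
    (fun q _ => Prod.swap_swap q)
  · rintro ⟨s, t⟩ -
    simp only [Prod.swap]
    rw [add_right_comm r (Pi.single t 1), ← mul_add]
    by_cases h2 : IsBox D a (r + Pi.single s 1 + Pi.single t 1)
    · by_cases hst : s = t
      · subst hst
        have h3 : C.x (move a (r + Pi.single s 1)) {s} * C.x (move a r) {s} = 0 := by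
          rw [move_add_single]
          exact C.mul_of_not_disjoint _ _ _ (by simp)
        simp [h3]
      · rw [C.kappa_mul_kappa a ha hst h2, mul_zero]
    · rw [eq_zero_of_mem h (fun h3 => h2 h3.1), zero_mul]
  · rintro ⟨s, t⟩ - h2 h3
    simp only [Prod.swap, Prod.mk.injEq] at h3
    obtain rfl := h3.1
    apply h2
    have h3 : C.x (move a (r + Pi.single t 1)) {t} * C.x (move a r) {t} = 0 := by
      rw [move_add_single]
      exact C.mul_of_not_disjoint _ _ _ (by simp)
    simp [h3]

/-- The differential in coordinates. -/
theorem coord_bd (r : Fin (n + 1) → ℕ) (U : Finset (Fin (n + 1))) (g : (Fin (n + 1) → ℕ) → A) :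
    C.coord (move a r) U (C.bd a g r) = ∑ s ∈ U, C.kappa a r s *
      (C.coeff (move a r) {s} (U.erase s) *
        C.coord (move a (r + Pi.single s 1)) (U.erase s) (g (r + Pi.single s 1))) := by
  classical
  rw [bd_apply, map_sum, ← Finset.sum_filter_add_sum_filter_not Finset.univ (· ∈ U),
    Finset.sum_eq_zero (s := Finset.univ.filter (· ∉ U)), add_zero]
  · rw [Finset.filter_mem_eq_inter, Finset.univ_inter]
    refine Finset.sum_congr rfl fun s hs => ?_
    rw [map_smul, coord_mul_x, if_pos (by simpa using hs), smul_eq_mul,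
      Finset.sdiff_singleton_eq_erase,
      move_add_single]
  · intro s hs
    have : s ∉ U := by simpa using hs
    rw [map_smul, coord_mul_x, if_neg (by simpa using this), smul_zero]

theorem kappa_mul_coeff_ne_zero (ha : IsConfig p a) {U : Finset (Fin (n + 1))} {s : Fin (n + 1)}
    (hs : s ∈ U) (h : IsCube p D (move a r) U) (h' : IsBox D a (r + Pi.single s 1)) :
    C.kappa a r s * C.coeff (move a r) {s} (U.erase s) ≠ 0 := by
  have h1 : IsCube p D (move a r) {s} := IsBox.isCube (by rwa [ind_singleton]) ha
  have hd : Disjoint {s} (U.erase s) := by simp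
  have h2 : {s} ∪ U.erase s = U := by rw [← Finset.insert_eq, Finset.insert_erase hs]
  exact mul_ne_zero (C.kappa_ne_zero a ha h')
    (C.coeff_ne_zero h1 (isCube_right hd (by rwa [h2]) h1) hd)

open Classical in
/-- A choice of a free move for each multiset of moves that has one. -/
noncomputable def freeMove (D : Finset (Fin (n + 1))) (a : Fin (n + 1) → ℤ)
    (w : Fin (n + 1) → ℕ) : Fin (n + 1) :=
  if h : ∃ t, IsFree D a w t then h.choose else 0

theorem isFree_freeMove {w : Fin (n + 1) → ℕ} (h : ∃ t, IsFree D a w t) :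
    IsFree D a w (freeMove D a w) := by
  rw [freeMove, dif_pos h]
  exact h.choose_spec

variable (C a) in
open Classical in
/-- The coordinates of a preimage under the differential: the free move is shifted from the cube
into the box. -/
noncomputable def preimageCoord (g : (Fin (n + 1) → ℕ) → A) (r : Fin (n + 1) → ℕ)
    (T : Finset (Fin (n + 1))) : k :=
  if (∃ t, IsFree D a (r + ind T) t) ∧ freeMove D a (r + ind T) ∉ T then
    C.coord (move a (r - Pi.single (freeMove D a (r + ind T)) 1))
        (insert (freeMove D a (r + ind T)) T) (g (r - Pi.single (freeMove D a (r + ind T)) 1)) /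
      (C.kappa a (r - Pi.single (freeMove D a (r + ind T)) 1) (freeMove D a (r + ind T)) *
        C.coeff (move a (r - Pi.single (freeMove D a (r + ind T)) 1))
          {freeMove D a (r + ind T)} T)
  else 0

variable (C a) in
open Classical in
/-- A preimage under the differential of a cycle without components at which no move is free. -/
noncomputable def preimage (N : ℕ) (g : (Fin (n + 1) → ℕ) → A) : (Fin (n + 1) → ℕ) → A := fun r =>
  if IsBox D a r ∧ ∑ j, r j = N then ∑ T, C.preimageCoord a g r T • C.x (move a r) T else 0

theorem preimage_mem : C.preimage a N g ∈ C.koszulTerm a N := by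
  refine mem_koszulTerm_iff.2 ⟨fun r h1 h2 => ?_, fun r h => ?_⟩
  · rw [preimage, if_pos ⟨h1, h2⟩, Finset.sum_mul]
    refine Finset.sum_congr rfl fun T _ => ?_
    rw [smul_mul_assoc, C.mul_idem]
  · rw [preimage, if_neg h]

theorem coord_preimage {T : Finset (Fin (n + 1))} (h : IsBox D a r) (h' : ∑ j, r j = N)
    (hT : IsCube p D (move a r) T) :
    C.coord (move a r) T (C.preimage a N g r) = C.preimageCoord a g r T := by
  rw [preimage, if_pos ⟨h, h'⟩, map_sum, Finset.sum_eq_single T]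
  · rw [map_smul, C.coord_x_self hT, smul_eq_mul, mul_one]
  · intro S _ hS
    simp [C.coord_x, hS]
  · simp

theorem coord_preimage_eq_zero {T : Finset (Fin (n + 1))}
    (h : ¬ ((∃ t, IsFree D a (r + ind T) t) ∧ freeMove D a (r + ind T) ∉ T)) :
    C.coord (move a r) T (C.preimage a N g r) = 0 := by
  by_cases h1 : IsBox D a r ∧ ∑ j, r j = N
  · by_cases hT : IsCube p D (move a r) T
    · rw [coord_preimage h1.1 h1.2 hT, preimageCoord, if_neg h]
    · rw [C.coord_of_not_isCube hT, LinearMap.zero_apply]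
  · rw [preimage, if_neg h1, map_zero]

theorem add_single_add_ind_erase {U : Finset (Fin (n + 1))} {s : Fin (n + 1)} (hs : s ∈ U) :
    r + Pi.single s 1 + ind (U.erase s) = r + ind U := by
  rw [add_assoc, single_add_ind_erase hs]

theorem coord_bd_preimage (ha : IsConfig p a) {U : Finset (Fin (n + 1))}
    (h : IsBox D a r) (h' : ∑ j, r j = N) (hU : IsCube p D (move a r) U)
    (hf : ∃ t, IsFree D a (r + ind U) t) (hfU : freeMove D a (r + ind U) ∈ U) :
    C.coord (move a r) U (C.bd a (C.preimage a (N + 1) g) r) = C.coord (move a r) U (g r) := by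
  have hspec := isFree_freeMove hf
  obtain ⟨t, ht⟩ : ∃ t, t = freeMove D a (r + ind U) := ⟨_, rfl⟩
  rw [← ht] at hfU hspec
  have hbox : IsBox D a (r + Pi.single t 1) := by
    intro s
    have h1 := h s
    by_cases hst : s = t
    · subst hst
      have h2 := hspec.2.2
      simp only [Pi.add_apply, ind, hfU, if_true] at h2
      simp only [Pi.add_apply, Pi.single_eq_same]
      exact ⟨fun _ => h2, fun h3 => absurd hspec.1 h3⟩
    · simpa [hst] using h1
  have hcube : IsCube p D (move a (r + Pi.single t 1)) (U.erase t) := by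
    rw [move_add_single]
    have h2 : {t} ∪ U.erase t = U := by rw [← Finset.insert_eq, Finset.insert_erase hfU]
    exact isCube_right (by simp) (by rwa [h2]) (IsBox.isCube (by rwa [ind_singleton]) ha)
  have hne := kappa_mul_coeff_ne_zero (C := C) ha hfU hU hbox
  rw [coord_bd, Finset.sum_eq_single t]
  · rw [coord_preimage hbox (by rw [sum_add_single, h']) hcube, preimageCoord,
      add_single_add_ind_erase hfU, ← ht, if_pos ⟨hf, Finset.notMem_erase _ _⟩,
      add_tsub_cancel_right, Finset.insert_erase hfU, ← mul_assoc, mul_div_cancel₀ _ hne]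
  · intro s hs hst
    rw [coord_preimage_eq_zero, mul_zero, mul_zero]
    rw [add_single_add_ind_erase hs, ← ht]
    rintro ⟨-, h3⟩
    exact h3 (Finset.mem_erase.2 ⟨hst.symm, hfU⟩)
  · intro h3
    exact absurd hfU h3

/-- The Koszul complex is exact at all components that have a free move: in the cube of components
with a given sum of box and cube, the free move splits the differential as the mapping cone of an
isomorphism. -/
theorem exists_bd_eq (ha : IsConfig p a) (hg : g ∈ C.koszulTerm a N) (hbd : C.bd a g = 0)
    (hfree : ∀ r T, IsBox D a r → ∑ j, r j = N → IsCube p D (move a r) T →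
      C.coord (move a r) T (g r) ≠ 0 → ∃ t, IsFree D a (r + ind T) t) :
    ∃ h ∈ C.koszulTerm a (N + 1), C.bd a h = g := by
  refine ⟨C.preimage a (N + 1) g, preimage_mem, ?_⟩
  set g' := g - C.bd a (C.preimage a (N + 1) g) with hg'
  have hmem : g' ∈ C.koszulTerm a N := Submodule.sub_mem _ hg (bd_mem preimage_mem)
  have hbd' : C.bd a g' = 0 := by
    rw [hg', map_sub, hbd, bd_bd ha preimage_mem, sub_zero]
  have hco : ∀ r T, C.coord (move a r) T (g' r) = C.coord (move a r) T (g r) -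
      C.coord (move a r) T (C.bd a (C.preimage a (N + 1) g) r) := fun r T => by
    rw [hg', Pi.sub_apply, map_sub]
  -- Components whose free move belongs to the cube.
  have h1 : ∀ r T, freeMove D a (r + ind T) ∈ T → (∃ t, IsFree D a (r + ind T) t) →
      C.coord (move a r) T (g' r) = 0 := by
    intro r T h2 h3
    by_cases h4 : IsBox D a r ∧ ∑ j, r j = N
    · by_cases hT : IsCube p D (move a r) T
      · rw [hco, coord_bd_preimage ha h4.1 h4.2 hT h3 h2, sub_self]
      · rw [C.coord_of_not_isCube hT, LinearMap.zero_apply]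
    · rw [eq_zero_of_mem hmem h4, map_zero]
  suffices g' = 0 from (sub_eq_zero.1 this).symm
  refine eq_zero_of_mem_of_coord hmem fun r T hr hrN hT => ?_
  by_cases hf : ∃ t, IsFree D a (r + ind T) t
  swap
  · have h2 : C.coord (move a r) T (g r) = 0 := by
      by_contra h3
      exact hf (hfree r T hr hrN hT h3)
    rw [hco, h2, coord_bd, Finset.sum_eq_zero, sub_zero]
    intro s hs
    rw [coord_preimage_eq_zero, mul_zero, mul_zero]
    rw [add_single_add_ind_erase hs]
    exact fun h3 => hf h3.1
  by_cases hfT : freeMove D a (r + ind T) ∈ T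
  · exact h1 r T hfT hf
  have hspec := isFree_freeMove hf
  obtain ⟨t, ht⟩ : ∃ t, t = freeMove D a (r + ind T) := ⟨_, rfl⟩
  rw [← ht] at hfT hspec
  have hrt : r t ≠ 0 := by
    have := hspec.2.1
    simp only [Pi.add_apply, ind, hfT, if_false] at this
    omega
  obtain ⟨r', rfl⟩ : ∃ r' : Fin (n + 1) → ℕ, r = r' + Pi.single t 1 :=
    ⟨_, (eq_add_single_lead hrt).symm⟩
  -- The component of `bd g' = 0` at `(r', insert t T)` is a multiple of that of `g'` at `(r, T)`.
  have h5 := coord_bd (C := C) (a := a) r' (insert t T) g'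
  rw [hbd', Pi.zero_apply, map_zero, Finset.sum_eq_single t] at h5
  · rw [Finset.erase_insert hfT, ← mul_assoc] at h5
    refine (mul_eq_zero.1 h5.symm).resolve_left ?_
    have h6 := kappa_mul_coeff_ne_zero (C := C) (U := insert t T) ha
      (Finset.mem_insert_self t T) ?_ hr
    · rwa [Finset.erase_insert hfT] at h6
    · rw [Finset.insert_eq]
      have h7 : IsCube p D (move a r') {t} := IsBox.isCube (by rwa [ind_singleton]) ha
      rw [move_add_single] at hT
      exact h7.union hT (by simpa using hfT)
  · intro s hs hst
    have h6 : r' + Pi.single s 1 + ind ((insert t T).erase s) = r' + Pi.single t 1 + ind T := by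
      rw [add_single_add_ind_erase hs, ind_insert hfT, add_assoc]
    rw [h1, mul_zero, mul_zero]
    · rw [h6, ← ht]
      exact Finset.mem_erase.2 ⟨hst.symm, Finset.mem_insert_self _ _⟩
    · rwa [h6]
  · simp

/-- Cycles of positive degree have no components at the idempotents. -/
theorem coord_empty_eq_zero_of_bd_eq_zero (ha : IsConfig p a) (hg : g ∈ C.koszulTerm a N)
    (hN : N ≠ 0) (hbd : C.bd a g = 0) (r : Fin (n + 1) → ℕ) : C.coord (move a r) ∅ (g r) = 0 := by
  by_cases h : IsBox D a r ∧ ∑ j, r j = N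
  swap
  · rw [eq_zero_of_mem hg h, map_zero]
  obtain ⟨t, ht⟩ : ∃ t, r t ≠ 0 := by
    by_contra h1
    push Not at h1
    rw [Finset.sum_eq_zero fun j _ => h1 j] at h
    exact hN h.2.symm
  obtain ⟨r', rfl⟩ : ∃ r' : Fin (n + 1) → ℕ, r = r' + Pi.single t 1 :=
    ⟨_, (eq_add_single_lead ht).symm⟩
  have h5 := coord_bd (C := C) (a := a) r' {t} g
  rw [hbd, Pi.zero_apply, map_zero, Finset.sum_singleton, ← mul_assoc] at h5
  have h6 : IsCube p D (move a r') {t} := IsBox.isCube (by rw [ind_singleton]; exact h.1) ha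
  have h7 := kappa_mul_coeff_ne_zero (C := C) ha (Finset.mem_singleton_self t) h6 h.1
  simpa using (mul_eq_zero.1 h5.symm).resolve_left h7

end CubicalBasis

/-! ### Paths in bound quivers -/

section Paths

variable {k : Type u} [Field k] {V : Type} [Quiver.{0} V] [Fintype V]

theorem PathAlg.mk_eq_of_rel {x y : FreeAlgebra k (Gen V)} (h : PathRel k V x y) :
    PathAlg.mk k V x = PathAlg.mk k V y :=
  Quotient.sound (RingConGen.Rel.of _ _ h)

theorem vertexElt_mul_self (i : V) : vertexElt k i * vertexElt k i = vertexElt k i := by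
  rw [vertexElt, ← map_mul]; exact PathAlg.mk_eq_of_rel (PathRel.idem i)

theorem vertexElt_mul_of_ne {i j : V} (h : i ≠ j) : vertexElt k i * vertexElt k j = 0 := by
  rw [vertexElt, vertexElt, ← map_mul, PathAlg.mk_eq_of_rel (PathRel.orth i j h), map_zero]

theorem sum_vertexElt : ∑ i : V, vertexElt k i = 1 := by
  simp only [vertexElt, ← map_sum]
  rw [PathAlg.mk_eq_of_rel PathRel.complete, map_one]

theorem vertexElt_mul_arrowElt {i j : V} (f : i ⟶ j) :
    vertexElt k j * arrowElt k f = arrowElt k f := by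
  rw [vertexElt, arrowElt, ← map_mul]; exact PathAlg.mk_eq_of_rel (PathRel.target f)

theorem arrowElt_mul_vertexElt {i j : V} (f : i ⟶ j) :
    arrowElt k f * vertexElt k i = arrowElt k f := by
  rw [vertexElt, arrowElt, ← map_mul]; exact PathAlg.mk_eq_of_rel (PathRel.source f)

theorem vertexElt_mul_pathElt {i j : V} (q : Quiver.Path i j) :
    vertexElt k j * pathElt k q = pathElt k q := by
  cases q with
  | nil => exact vertexElt_mul_self i
  | cons q f => rw [pathElt, ← mul_assoc, vertexElt_mul_arrowElt]

theorem pathElt_mul_vertexElt {i j : V} (q : Quiver.Path i j) :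
    pathElt k q * vertexElt k i = pathElt k q := by
  induction q with
  | nil => exact vertexElt_mul_self i
  | cons q f ih => rw [pathElt, mul_assoc, ih]

theorem pathElt_comp {i j l : V} (q : Quiver.Path i j) (q' : Quiver.Path j l) :
    pathElt k (q.comp q') = pathElt k q' * pathElt k q := by
  induction q' with
  | nil => rw [Quiver.Path.comp_nil, pathElt, vertexElt_mul_pathElt]
  | cons q' f ih => rw [Quiver.Path.comp_cons, pathElt, pathElt, ih, mul_assoc]

variable (ρ : Set (PathAlg k V))

theorem img_nil (i : V) : img ρ (Quiver.Path.nil : Quiver.Path i i) = idem ρ i := rfl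

theorem img_cons {i j l : V} (q : Quiver.Path i j) (f : j ⟶ l) :
    img ρ (q.cons f) = proj ρ (arrowElt k f) * img ρ q := map_mul _ _ _

theorem img_comp {i j l : V} (q : Quiver.Path i j) (q' : Quiver.Path j l) :
    img ρ (q.comp q') = img ρ q' * img ρ q := by
  rw [img, pathElt_comp, map_mul]; rfl

/-- The path algebra is spanned by the paths. -/
theorem span_pathElt_eq_top :
    Submodule.span k {x : PathAlg k V | ∃ (i j : V) (q : Quiver.Path i j), x = pathElt k q} =
      ⊤ := by
  classical
  set M := Submodule.span k {x : PathAlg k V | ∃ (i j : V) (q : Quiver.Path i j), x = pathElt k q}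
  have hmem : ∀ {i j : V} (q : Quiver.Path i j), pathElt k q ∈ M := fun q =>
    Submodule.subset_span ⟨_, _, q, rfl⟩
  have hmul : ∀ x y, x ∈ M → y ∈ M → x * y ∈ M := by
    intro x y hx hy
    induction hx using Submodule.span_induction with
    | mem x h =>
      obtain ⟨i', j', q', rfl⟩ := h
      induction hy using Submodule.span_induction with
      | mem y h =>
        obtain ⟨i, j, q, rfl⟩ := h
        by_cases hij : i' = j
        · subst hij
          rw [← pathElt_comp]
          exact hmem _
        · rw [← pathElt_mul_vertexElt q', mul_assoc, ← vertexElt_mul_pathElt q,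
            ← mul_assoc (vertexElt k i'),
            vertexElt_mul_of_ne hij, zero_mul, mul_zero]
          exact M.zero_mem
      | zero => rw [mul_zero]; exact M.zero_mem
      | add y z _ _ h1 h2 => rw [mul_add]; exact M.add_mem h1 h2
      | smul c y _ h => rw [mul_smul_comm]; exact M.smul_mem c h
    | zero => rw [zero_mul]; exact M.zero_mem
    | add y z _ _ h1 h2 => rw [add_mul]; exact M.add_mem h1 h2
    | smul c y _ h => rw [smul_mul_assoc]; exact M.smul_mem c h
  have hone : (1 : PathAlg k V) ∈ M := by
    rw [← sum_vertexElt]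
    exact Submodule.sum_mem _ fun i _ => hmem (Quiver.Path.nil : Quiver.Path i i)
  rw [eq_top_iff]
  rintro x -
  obtain ⟨y, rfl⟩ := (ringConGen (PathRel k V)).mkₐ_surjective (α := k) x
  show PathAlg.mk k V y ∈ M
  induction y using FreeAlgebra.induction with
  | grade0 c => rw [AlgHom.commutes, Algebra.algebraMap_eq_smul_one]; exact M.smul_mem c hone
  | grade1 g =>
    cases g with
    | vertex i => exact hmem (Quiver.Path.nil : Quiver.Path i i)
    | arrow f =>
      have h := hmem f.toPath
      rw [Quiver.Hom.toPath, pathElt, pathElt, arrowElt_mul_vertexElt] at h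
      exact h
  | mul x y hx hy => rw [map_mul]; exact hmul _ _ hx hy
  | add x y hx hy => rw [map_add]; exact M.add_mem hx hy

theorem proj_surjective : Function.Surjective (proj ρ) :=
  (TwoSidedIdeal.span ρ).ringCon.mkₐ_surjective (α := k)

theorem span_img_eq_top :
    Submodule.span k {x : BoundAlg ρ | ∃ (i j : V) (q : Quiver.Path i j), x = img ρ q} = ⊤ := by
  have h := congrArg (Submodule.map (proj ρ).toLinearMap) (span_pathElt_eq_top (k := k) (V := V))
  rw [Submodule.map_span, Submodule.map_top, LinearMap.range_eq_top.2 (proj_surjective ρ)] at h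
  rw [← h]
  congr 1
  ext y
  constructor
  · rintro ⟨i, j, q, rfl⟩
    exact ⟨_, ⟨i, j, q, rfl⟩, rfl⟩
  · rintro ⟨_, ⟨i, j, q, rfl⟩, rfl⟩
    exact ⟨i, j, q, rfl⟩

theorem proj_eq_zero_of_mem {r : PathAlg k V} (h : r ∈ ρ) : proj ρ r = 0 := by
  have h1 : r ∈ TwoSidedIdeal.span ρ := TwoSidedIdeal.subset_span h
  rw [← map_zero (proj ρ)]
  exact Quotient.sound ((TwoSidedIdeal.mem_iff _ _).1 h1)

/-- The universal property of the path algebra. -/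
noncomputable def PathAlg.lift {B : Type*} [Ring B] [Algebra k B] (F : Gen V → B)
    (h1 : ∀ i, F (Gen.vertex i) * F (Gen.vertex i) = F (Gen.vertex i))
    (h2 : ∀ i j, i ≠ j → F (Gen.vertex i) * F (Gen.vertex j) = 0)
    (h3 : ∑ i, F (Gen.vertex i) = 1)
    (h4 : ∀ {i j : V} (f : i ⟶ j), F (Gen.vertex j) * F (Gen.arrow f) = F (Gen.arrow f))
    (h5 : ∀ {i j : V} (f : i ⟶ j), F (Gen.arrow f) * F (Gen.vertex i) = F (Gen.arrow f)) :
    PathAlg k V →ₐ[k] B :=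
  (ringConGen (PathRel k V)).liftₐ (FreeAlgebra.lift k F) (RingCon.ringConGen_le.2 (by
    intro x y h
    show FreeAlgebra.lift k F x = FreeAlgebra.lift k F y
    cases h with
    | idem i => simp [h1]
    | orth i j h => simp [h2 i j h]
    | complete => simp [h3]
    | target f => simp [h4]
    | source f => simp [h5]))

theorem PathAlg.lift_mk {B : Type*} [Ring B] [Algebra k B] (F : Gen V → B) (h1 h2 h3 h4 h5)
    (g : Gen V) :
    PathAlg.lift (k := k) F h1 h2 h3 h4 h5 (PathAlg.mk k V (FreeAlgebra.ι k g)) = F g :=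
  FreeAlgebra.lift_ι_apply _ _

/-- The universal property of the algebra of a bound quiver. -/
noncomputable def BoundAlg.lift {B : Type*} [Ring B] [Algebra k B] (φ : PathAlg k V →ₐ[k] B)
    (h : ∀ r ∈ ρ, φ r = 0) : BoundAlg ρ →ₐ[k] B :=
  (TwoSidedIdeal.span ρ).ringCon.liftₐ φ (by
    intro x y hxy
    rw [TwoSidedIdeal.rel_iff] at hxy
    have h1 : TwoSidedIdeal.span ρ ≤ TwoSidedIdeal.ker φ.toRingHom :=
      TwoSidedIdeal.span_le.2 fun r hr => (TwoSidedIdeal.mem_ker _).2 (h r hr)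
    have h2 := (TwoSidedIdeal.mem_ker _).1 (h1 hxy)
    rw [map_sub, sub_eq_zero] at h2
    exact h2)

theorem BoundAlg.lift_proj {B : Type*} [Ring B] [Algebra k B] (φ : PathAlg k V →ₐ[k] B)
    (h : ∀ r ∈ ρ, φ r = 0) (x : PathAlg k V) : BoundAlg.lift ρ φ h (proj ρ x) = φ x := rfl

end Paths

/-! ### Bound quivers that realize a cubical basis -/

section Realizes

variable {k : Type u} [Field k] {V : Type} [Quiver.{0} V] [Fintype V] {ρ : Set (PathAlg k V)}
  {n p : ℕ} {D : Finset (Fin (n + 1))}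

/-- The algebra of the bound quiver has a cubical basis such that the vertices of the quiver are the
configurations and its arrows are the possible moves of one particle. -/
structure Realizes (C : CubicalBasis k (BoundAlg ρ) n p D) (occ : V → Fin (n + 1) → ℤ) : Prop where
  injective : Function.Injective occ
  isConfig : ∀ v, IsConfig p (occ v)
  surjective : ∀ a, IsConfig p a → ∃ v, occ v = a
  idem : ∀ v, idem ρ v = C.x (occ v) ∅
  arrow : ∀ {i j : V} (f : i ⟶ j), ∃ t ∈ D, occ j = occ i + disp {t} ∧
    ∃ c : k, c ≠ 0 ∧ proj ρ (arrowElt k f) = c • C.x (occ i) {t}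
  exists_arrow : ∀ (i j : V) (t), t ∈ D → occ j = occ i + disp {t} → Nonempty (i ⟶ j)

/-- The path `q` is, up to a nonzero scalar, the element of the cubical basis that belongs to the
set `T` of moves. -/
def HasMoves (C : CubicalBasis k (BoundAlg ρ) n p D) (occ : V → Fin (n + 1) → ℤ) {i j : V}
    (q : Quiver.Path i j) (T : Finset (Fin (n + 1))) : Prop :=
  IsCube p D (occ i) T ∧ T.card = q.length ∧ occ j = occ i + disp T ∧
    ∃ c : k, c ≠ 0 ∧ img ρ q = c • C.x (occ i) T

theorem CubicalBasis.x_mul_x_ne_zero {A : Type u} [Ring A] [Algebra k A]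
    (C : CubicalBasis k A n p D) {a b : Fin (n + 1) → ℤ} {S T : Finset (Fin (n + 1))}
    (hT : IsCube p D a T) (hS : IsCube p D b S) (hb : b = a + disp T) (hd : Disjoint T S) :
    C.x b S * C.x a T ≠ 0 := by
  subst hb
  rw [C.x_mul_x]
  exact smul_ne_zero (C.coeff_ne_zero hT hS hd) (C.x_ne_zero (hT.union hS hd))

variable {C : CubicalBasis k (BoundAlg ρ) n p D} {occ : V → Fin (n + 1) → ℤ}

namespace HasMoves

theorem isBound {i j : V} {q : Quiver.Path i j} {T : Finset (Fin (n + 1))}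
    (h : HasMoves C occ q T) : IsBound ρ q := by
  obtain ⟨h1, -, -, c, hc, h2⟩ := h
  rw [IsBound, h2]
  exact smul_ne_zero hc (C.x_ne_zero h1)

theorem comp {i j l : V} {q : Quiver.Path i j} {q' : Quiver.Path j l}
    {S T : Finset (Fin (n + 1))} (h : HasMoves C occ q T) (h' : HasMoves C occ q' S)
    (hd : Disjoint T S) : HasMoves C occ (q.comp q') (T ∪ S) := by
  obtain ⟨h1, h2, h3, c, hc, h4⟩ := h
  obtain ⟨h1', h2', h3', c', hc', h4'⟩ := h'
  rw [h3] at h1' h3' h4'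
  refine ⟨h1.union h1' hd, ?_, ?_, ?_⟩
  · rw [Finset.card_union_of_disjoint hd, Quiver.Path.length_comp, h2, h2']
  · rw [h3', disp_union hd, add_assoc]
  · refine ⟨c' * c * C.coeff (occ i) T S, mul_ne_zero (mul_ne_zero hc' hc)
      (C.coeff_ne_zero h1 h1' hd), ?_⟩
    rw [img_comp, h4, h4', smul_mul_smul_comm, C.x_mul_x, smul_smul]

theorem unique {i j : V} {q q' : Quiver.Path i j} {S T : Finset (Fin (n + 1))}
    (h : HasMoves C occ q T) (h' : HasMoves C occ q' S) (hl : q.length = q'.length) : T = S := by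
  obtain ⟨-, h2, h3, -⟩ := h
  obtain ⟨-, h2', h3', -⟩ := h'
  refine eq_of_disp_eq_of_card_eq ?_ (by rw [h2, h2', hl])
  exact add_left_cancel (h3.symm.trans h3')

theorem dependent {i j : V} {q q' : Quiver.Path i j} {S T : Finset (Fin (n + 1))}
    (h : HasMoves C occ q T) (h' : HasMoves C occ q' S) (hl : q.length = q'.length) :
    Dependent (k := k) (img ρ q) (img ρ q') := by
  obtain rfl := h.unique h' hl
  obtain ⟨-, -, -, c, hc, h4⟩ := h
  obtain ⟨-, -, -, c', hc', h4'⟩ := h'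
  intro hli
  rw [LinearIndependent.pair_iff] at hli
  have := (hli c' (-c) (by rw [h4, h4', smul_smul, smul_smul, ← add_smul]; ring_nf; simp)).1
  exact hc' this

end HasMoves

namespace Realizes

variable (h : Realizes C occ)
include h

theorem hasMoves_nil (i : V) : HasMoves C occ (Quiver.Path.nil : Quiver.Path i i) ∅ :=
  ⟨isCube_empty.2 (h.isConfig i), rfl, by simp, 1, one_ne_zero, by rw [img_nil, h.idem, one_smul]⟩

theorem isCube_of_eq {i j : V} {T : Finset (Fin (n + 1))} (hT : T ⊆ D)
    (hj : occ j = occ i + disp T) : IsCube p D (occ i) T :=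
  ⟨hT, h.isConfig i, hj ▸ h.isConfig j⟩

theorem exists_hasMoves_toPath {i j : V} (f : i ⟶ j) : ∃ t, HasMoves C occ f.toPath {t} := by
  obtain ⟨t, htD, ht, c, hc, h1⟩ := h.arrow f
  refine ⟨t, h.isCube_of_eq (by simpa using htD) ht, rfl, ht, c, hc, ?_⟩
  rw [Quiver.Hom.toPath, img_cons, img_nil, h.idem, h1, smul_mul_assoc, C.mul_idem]

theorem isBound_iff {i j : V} {q : Quiver.Path i j} : IsBound ρ q ↔ ∃ T, HasMoves C occ q T := by
  refine ⟨fun hq => ?_, fun ⟨T, hT⟩ => hT.isBound⟩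
  induction q with
  | nil => exact ⟨∅, h.hasMoves_nil i⟩
  | cons q f ih =>
    have h1 : img ρ (q.cons f) = img ρ f.toPath * img ρ q := img_comp ρ q f.toPath
    obtain ⟨T, hT⟩ := ih fun h0 => hq (by rw [h1, h0, mul_zero])
    obtain ⟨t, ht⟩ := h.exists_hasMoves_toPath f
    refine ⟨T ∪ {t}, hT.comp ht ?_⟩
    by_contra hd
    apply hq
    obtain ⟨-, -, h3, c, hc, h4⟩ := hT
    obtain ⟨-, -, -, c', hc', h4'⟩ := ht
    rw [h1, h4, h4', smul_mul_smul_comm, h3, C.mul_of_not_disjoint _ _ _ hd, smul_zero]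

theorem exists_hasMoves (hp : 1 ≤ p) {i j : V} {T : Finset (Fin (n + 1))} (hT : T ⊆ D)
    (hj : occ j = occ i + disp T) : ∃ q : Quiver.Path i j, HasMoves C occ q T := by
  induction hc : T.card generalizing j T with
  | zero =>
    obtain rfl := Finset.card_eq_zero.1 hc
    obtain rfl : j = i := h.injective (by simpa using hj)
    exact ⟨_, h.hasMoves_nil j⟩
  | succ N ih =>
    obtain ⟨t, htT, ht⟩ := (h.isCube_of_eq hT hj).exists_last hp
      (Finset.card_pos.1 (by omega))
    obtain ⟨l, hl⟩ := h.surjective _ ht.2.2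
    obtain ⟨q, hq⟩ := ih ht.1 hl (by rw [Finset.card_erase_of_mem htT, hc]; rfl)
    have h1 : T.erase t ∪ {t} = T := by
      rw [Finset.union_comm, ← Finset.insert_eq, Finset.insert_erase htT]
    have h2 : occ j = occ l + disp {t} := by
      rw [hj, hl, add_assoc, ← disp_union (by simp), h1]
    obtain ⟨f⟩ := h.exists_arrow l j t (hT htT) h2
    obtain ⟨t', ht'⟩ := h.exists_hasMoves_toPath f
    have h3 : ({t'} : Finset (Fin (n + 1))) = {t} :=
      eq_of_disp_eq_of_card_eq (add_left_cancel (ht'.2.2.1.symm.trans h2)) rfl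
    rw [h3] at ht'
    refine ⟨q.comp f.toPath, ?_⟩
    have := hq.comp ht' (by simp)
    rwa [h1] at this

theorem eq_smul_of_mem_homComp {t : ℕ} {i j : V} {y : BoundAlg ρ} (hy : y ∈ homComp ρ t i j)
    (hy0 : y ≠ 0) : ∃ (T : Finset (Fin (n + 1))) (c : k), c ≠ 0 ∧ IsCube p D (occ i) T ∧
      T.card = t ∧ occ j = occ i + disp T ∧ y = c • C.x (occ i) T := by
  suffices hs : y = 0 ∨ ∃ (T : Finset (Fin (n + 1))) (c : k), IsCube p D (occ i) T ∧
      T.card = t ∧ occ j = occ i + disp T ∧ y = c • C.x (occ i) T by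
    obtain ⟨T, c, h1, h2, h3, h4⟩ := hs.resolve_left hy0
    refine ⟨T, c, ?_, h1, h2, h3, h4⟩
    rintro rfl
    exact hy0 (by rw [h4, zero_smul])
  clear hy0
  induction hy using Submodule.span_induction with
  | mem y hy =>
    obtain ⟨q, hq, rfl⟩ := hy
    by_cases h0 : img ρ q = 0
    · exact Or.inl h0
    · obtain ⟨T, h1, h2, h3, c, hc, h4⟩ := h.isBound_iff.1 h0
      exact Or.inr ⟨T, c, h1, by rw [h2, hq], h3, h4⟩
  | zero => exact Or.inl rfl
  | add y z _ _ hy hz =>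
    rcases hy with rfl | ⟨T, c, h1, h2, h3, rfl⟩
    · rwa [zero_add]
    rcases hz with rfl | ⟨T', c', h1', h2', h3', rfl⟩
    · exact Or.inr ⟨T, c, h1, h2, h3, by rw [add_zero]⟩
    obtain rfl : T = T' := eq_of_disp_eq_of_card_eq (add_left_cancel (h3.symm.trans h3'))
      (by rw [h2, h2'])
    exact Or.inr ⟨T, c + c', h1, h2, h3, by rw [add_smul]⟩
  | smul c y _ hy =>
    rcases hy with rfl | ⟨T, c', h1, h2, h3, rfl⟩
    · exact Or.inl (smul_zero _)
    · exact Or.inr ⟨T, c * c', h1, h2, h3, by rw [smul_smul]⟩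

theorem comp_eq_span (hp : 1 ≤ p) (t : ℕ) :
    comp ρ t = Submodule.span k {y | ∃ a T, IsCube p D a T ∧ T.card = t ∧ y = C.x a T} := by
  apply le_antisymm
  · refine Submodule.span_le.2 ?_
    rintro _ ⟨i, j, q, hq, rfl⟩
    by_cases h0 : img ρ q = 0
    · rw [h0]; exact Submodule.zero_mem _
    · obtain ⟨T, h1, h2, h3, c, hc, h4⟩ := h.isBound_iff.1 h0
      rw [h4]
      exact Submodule.smul_mem _ _ (Submodule.subset_span ⟨_, _, h1, by rw [h2, hq], rfl⟩)
  · refine Submodule.span_le.2 ?_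
    rintro _ ⟨a, T, hT, hc, rfl⟩
    obtain ⟨i, rfl⟩ := h.surjective a hT.2.1
    obtain ⟨j, hj⟩ := h.surjective _ hT.2.2
    obtain ⟨q, -, h2, -, c, hc0, h4⟩ := h.exists_hasMoves hp hT.1 hj
    have h5 : C.x (occ i) T = c⁻¹ • img ρ q := by rw [h4, smul_smul, inv_mul_cancel₀ hc0, one_smul]
    rw [h5]
    exact Submodule.smul_mem _ _ (Submodule.subset_span ⟨i, j, q, by rw [← h2, hc], rfl⟩)

/-- Composition with an arrow on the right or on the left prolongs a path whose moves are not all of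
`D`. -/
theorem exists_prolongation (hD : ∀ s, s ≠ 0 → s ∈ D) (hp : 1 ≤ p) {i j : V}
    {q : Quiver.Path i j} {T : Finset (Fin (n + 1))} (hq : HasMoves C occ q T) (hT : T ≠ D) :
    ∃ t, t ∉ T ∧ ((∃ (l : V) (f : j ⟶ l), HasMoves C occ (q.cons f) (T ∪ {t})) ∨
      ∃ (l : V) (f : l ⟶ i), HasMoves C occ (f.toPath.comp q) ({t} ∪ T)) := by
  have huniq : ∀ {i j : V} {f : i ⟶ j} {t t'}, HasMoves C occ f.toPath {t'} →
      occ j = occ i + disp {t} → ({t'} : Finset (Fin (n + 1))) = {t} := fun h1 h2 =>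
    eq_of_disp_eq_of_card_eq (add_left_cancel (h1.2.2.1.symm.trans h2)) rfl
  obtain ⟨t, htD, htT, h1⟩ := hq.1.exists_extension hD hp hT
  refine ⟨t, htT, ?_⟩
  rcases h1 with h1 | h1
  · left
    rw [← hq.2.2.1] at h1
    obtain ⟨l, hl⟩ := h.surjective _ h1.2.2
    obtain ⟨f⟩ := h.exists_arrow j l t htD hl
    obtain ⟨t', ht'⟩ := h.exists_hasMoves_toPath f
    rw [huniq ht' hl] at ht'
    exact ⟨l, f, hq.comp ht' (by simpa using htT)⟩
  · right
    obtain ⟨l, hl⟩ := h.surjective _ h1.2.1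
    have h2 : occ i = occ l + disp {t} := by rw [hl, sub_add_cancel]
    obtain ⟨f⟩ := h.exists_arrow l i t htD h2
    obtain ⟨t', ht'⟩ := h.exists_hasMoves_toPath f
    rw [huniq ht' h2] at ht'
    exact ⟨l, f, ht'.comp hq (by simpa using htT)⟩

/-- A bound quiver that realizes a cubical basis is a translation quiver. -/
theorem isTranslationQuiver (hD : ∀ s, s ≠ 0 → s ∈ D) (hp : 1 ≤ p) {N : ℕ} (hN : D.card = N + 1)
    {P I : Set V} {τ : ↥(Pᶜ) ≃ ↥(Iᶜ)}
    (hτ : ∀ i : ↥(Pᶜ), occ i = occ (τ i) + disp D)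
    (hP : ∀ v w, occ w = occ v + disp D → w ∉ P) : IsTranslationQuiver N ρ P I τ where
  maximal a b q hq := by
    obtain ⟨hb, hl, hr⟩ := hq
    obtain ⟨T, hT⟩ := h.isBound_iff.1 hb
    have hTD : T = D := by
      by_contra hne
      obtain ⟨t, -, ⟨l, f, h1⟩ | ⟨l, f, h1⟩⟩ := h.exists_prolongation hD hp hT hne
      · exact hl l f h1.isBound
      · exact hr l f h1.isBound
    subst hTD
    have h1 := hP a b hT.2.2.1
    refine ⟨by rw [← hT.2.1, hN], ⟨b, h1⟩, rfl, ?_⟩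
    apply h.injective
    exact add_right_cancel ((hτ ⟨b, h1⟩).symm.trans hT.2.2.1)
  dependent i q q' hq hq' hb hb' := by
    obtain ⟨T, hT⟩ := h.isBound_iff.1 hb
    obtain ⟨T', hT'⟩ := h.isBound_iff.1 hb'
    exact hT.dependent hT' (by rw [hq, hq'])
  extend_left i j t ht y hy hy0 := by
    obtain ⟨T, c, hc, h1, h2, h3, rfl⟩ := h.eq_smul_of_mem_homComp hy hy0
    have h4 : occ j = occ (τ i) + disp (D \ T) := by
      have h5 := hτ i
      rw [← disp_sdiff h1.1, h3, add_comm (disp T), ← add_assoc] at h5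
      exact add_right_cancel h5
    obtain ⟨q, hq⟩ := h.exists_hasMoves hp Finset.sdiff_subset h4
    refine ⟨q, ?_, ?_⟩
    · rw [← hq.2.1, Finset.card_sdiff_of_subset h1.1, hN, h2]
      omega
    · obtain ⟨h5, -, -, c', hc', h6⟩ := hq
      rw [h6, smul_mul_smul_comm]
      exact smul_ne_zero (mul_ne_zero hc hc')
        (C.x_mul_x_ne_zero h5 h1 h4 Finset.sdiff_disjoint)
  extend_right i j t ht y hy hy0 := by
    obtain ⟨T, c, hc, h1, h2, h3, rfl⟩ := h.eq_smul_of_mem_homComp hy hy0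
    have h4 : occ (τ.symm i) = occ j + disp (D \ T) := by
      have h5 := hτ (τ.symm i)
      rw [← disp_sdiff h1.1, Equiv.apply_symm_apply, ← add_assoc, ← h3] at h5
      exact h5
    obtain ⟨q, hq⟩ := h.exists_hasMoves hp Finset.sdiff_subset h4
    refine ⟨q, ?_, ?_⟩
    · rw [← hq.2.1, Finset.card_sdiff_of_subset h1.1, hN, h2]
      omega
    · obtain ⟨h5, -, -, c', hc', h6⟩ := hq
      rw [h6, smul_mul_smul_comm]
      exact smul_ne_zero (mul_ne_zero hc' hc)
        (C.x_mul_x_ne_zero h1 h5 h3 Finset.disjoint_sdiff)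

/-- Every bound path is part of a bound path that uses each allowed move once. -/
theorem exists_full_prolongation (hD : ∀ s, s ≠ 0 → s ∈ D) (hp : 1 ≤ p) {i j : V}
    {q : Quiver.Path i j} {T : Finset (Fin (n + 1))} (hq : HasMoves C occ q T) :
    ∃ (i' j' : V) (q'' : Quiver.Path i' i) (q' : Quiver.Path j j'),
      HasMoves C occ ((q''.comp q).comp q') D := by
  induction hc : (D \ T).card generalizing i j q T with
  | zero =>
    have h1 : T = D := Finset.Subset.antisymm hq.1.1
      (Finset.sdiff_eq_empty_iff_subset.1 (Finset.card_eq_zero.1 hc))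
    subst h1
    exact ⟨i, j, Quiver.Path.nil, Quiver.Path.nil, by simpa using hq⟩
  | succ N ih =>
    have hne : T ≠ D := by
      rintro rfl
      simp at hc
    have hcard : ∀ {t : Fin (n + 1)}, t ∉ T → t ∈ D → (D \ insert t T).card = N := by
      intro t h1 h2
      rw [Finset.sdiff_insert, Finset.card_erase_of_mem (by simp [h1, h2]), hc]
      rfl
    obtain ⟨t, htT, ⟨l, f, h1⟩ | ⟨l, f, h1⟩⟩ := h.exists_prolongation hD hp hq hne
    · obtain ⟨i', j', q'', q', h2⟩ := ih h1 (by
        rw [Finset.union_comm, ← Finset.insert_eq]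
        exact hcard htT (h1.1.1 (by simp)))
      refine ⟨i', j', q'', f.toPath.comp q', ?_⟩
      rw [← Quiver.Path.comp_assoc]
      exact h2
    · obtain ⟨i', j', q'', q', h2⟩ := ih h1 (by
        rw [← Finset.insert_eq]
        exact hcard htT (h1.1.1 (by simp)))
      refine ⟨i', j', q''.comp f.toPath, q', ?_⟩
      rwa [← Quiver.Path.comp_assoc] at h2

end Realizes

end Realizes

/-! ### Gradings -/

section Grading

/-- A family of subgroups with a complete family of projections is a grading. -/
theorem isInternal_of_projections {M : Type*} [AddCommGroup M] (gr : ℕ → AddSubgroup M)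
    (π : ℕ → M →+ M) (B : ℕ) (hmem : ∀ s x, π s x ∈ gr s) (hself : ∀ s, ∀ x ∈ gr s, π s x = x)
    (hne : ∀ s s', s ≠ s' → ∀ x ∈ gr s, π s' x = 0)
    (hsum : ∀ x, ∑ s ∈ Finset.range B, π s x = x) : DirectSum.IsInternal gr := by
  classical
  constructor
  · have h : ∀ (x : ⨁ s, gr s) (s : ℕ), π s (DirectSum.coeAddMonoidHom gr x) = x s := by
      intro x s
      induction x using DirectSum.induction_on with
      | zero => simp
      | of i y =>
        rw [DirectSum.coeAddMonoidHom_of, DirectSum.coe_of_apply]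
        split_ifs with h
        · subst h
          exact hself _ _ y.2
        · exact hne _ _ h _ y.2
      | add x y h1 h2 => rw [map_add, map_add, h1, h2]; rfl
    rw [injective_iff_map_eq_zero]
    intro x hx
    ext s
    rw [← h x s, hx, map_zero]
    rfl
  · intro x
    refine ⟨∑ s ∈ Finset.range B, DirectSum.of (fun s => gr s) s ⟨π s x, hmem s x⟩, ?_⟩
    rw [map_sum]
    simp only [DirectSum.coeAddMonoidHom_of]
    exact hsum x

end Grading

namespace CubicalBasis

variable {k : Type u} [Field k] {A : Type u} [Ring A] [Algebra k A] {n p : ℕ}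
  {D : Finset (Fin (n + 1))} (C : CubicalBasis k A n p D) (a : Fin (n + 1) → ℤ) (N : ℕ)

theorem eq_of_coord_eq {g g' : (Fin (n + 1) → ℕ) → A} (h : g ∈ C.koszulTerm a N)
    (h' : g' ∈ C.koszulTerm a N)
    (h1 : ∀ r T, C.coord (move a r) T (g r) = C.coord (move a r) T (g' r)) : g = g' := by
  refine sub_eq_zero.1 (eq_zero_of_mem_of_coord (Submodule.sub_mem _ h h') fun r T _ _ _ => ?_)
  rw [Pi.sub_apply, map_sub, h1, sub_self]

/-- The projection of `A e_v` onto the component of degree `s`, where `e_v` has degree `N`. -/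
noncomputable def homogPart (s : ℕ) (v : Fin (n + 1) → ℤ) : A →ₗ[k] A :=
  ∑ T ∈ Finset.univ.filter (fun T : Finset (Fin (n + 1)) => T.card + N = s),
    (C.coord v T).smulRight (C.x v T)

theorem homogPart_apply (s : ℕ) (v : Fin (n + 1) → ℤ) (y : A) : C.homogPart N s v y =
    ∑ T ∈ Finset.univ.filter (fun T : Finset (Fin (n + 1)) => T.card + N = s),
      C.coord v T y • C.x v T := by
  simp [homogPart]

theorem coord_homogPart (s : ℕ) (v : Fin (n + 1) → ℤ) (T : Finset (Fin (n + 1))) (y : A) :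
    C.coord v T (C.homogPart N s v y) = if T.card + N = s then C.coord v T y else 0 := by
  by_cases hT : IsCube p D v T
  · rw [homogPart_apply, map_sum]
    split_ifs with h
    · rw [Finset.sum_eq_single T]
      · rw [map_smul, C.coord_x_self hT, smul_eq_mul, mul_one]
      · intro S _ hS
        simp [C.coord_x, hS]
      · simp [h]
    · refine Finset.sum_eq_zero fun S hS => ?_
      have hne : S ≠ T := by
        rintro rfl
        exact h (Finset.mem_filter.1 hS).2
      simp [C.coord_x, hne]
  · simp [C.coord_of_not_isCube hT]

/-- The component of degree `s` of the term of degree `N` of the Koszul complex, which is generated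
in degree `N`. -/
def koszulGr (s : ℕ) : AddSubgroup (C.koszulTerm a N) where
  carrier := {g | ∀ r T, T.card + N ≠ s → C.coord (move a r) T (g.1 r) = 0}
  add_mem' h1 h2 r T hT := by
    show C.coord (move a r) T (_ + _) = 0
    rw [map_add, h1 r T hT, h2 r T hT, add_zero]
  zero_mem' r T _ := map_zero _
  neg_mem' h r T hT := by
    show C.coord (move a r) T (-_) = 0
    rw [map_neg, h r T hT, neg_zero]

/-- The projection onto the component of degree `s`. -/
noncomputable def koszulPart (s : ℕ) : C.koszulTerm a N →+ C.koszulTerm a N where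
  toFun g := ⟨fun r => C.homogPart N s (move a r) (g.1 r), mem_koszulTerm_iff.2
    ⟨fun r _ _ => by
      rw [homogPart_apply, Finset.sum_mul]
      refine Finset.sum_congr rfl fun T _ => ?_
      rw [smul_mul_assoc, C.mul_idem],
    fun r h => by rw [eq_zero_of_mem g.2 h, map_zero]⟩⟩
  map_zero' := Subtype.ext (funext fun r => map_zero _)
  map_add' g g' := Subtype.ext (funext fun r => map_add _ _ _)

theorem koszulPart_apply (s : ℕ) (g : C.koszulTerm a N) (r : Fin (n + 1) → ℕ) :
    (C.koszulPart a N s g).1 r = C.homogPart N s (move a r) (g.1 r) := rfl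

theorem isInternal_koszulGr : DirectSum.IsInternal (C.koszulGr a N) := by
  refine isInternal_of_projections _ (C.koszulPart a N) (n + 1 + N + 1) ?_ ?_ ?_ ?_
  · intro s g r T hT
    rw [koszulPart_apply, coord_homogPart, if_neg hT]
  · intro s g hg
    refine Subtype.ext (C.eq_of_coord_eq a N (C.koszulPart a N s g).2 g.2 fun r T => ?_)
    rw [koszulPart_apply, coord_homogPart]
    split_ifs with h
    · rfl
    · rw [hg r T h]
  · intro s s' hs g hg
    refine Subtype.ext (C.eq_of_coord_eq a N (C.koszulPart a N s' g).2 (Submodule.zero_mem _)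
      fun r T => ?_)
    rw [koszulPart_apply, coord_homogPart]
    show _ = C.coord (move a r) T 0
    rw [map_zero]
    split_ifs with h
    · exact hg r T (by omega)
    · rfl
  · intro g
    refine Subtype.ext (funext fun r => ?_)
    rw [Submodule.coe_sum, Finset.sum_apply]
    simp only [koszulPart_apply, homogPart_apply]
    rw [Finset.sum_fiberwise_of_maps_to, ← C.eq_sum_of_mul_idem (mul_idem_of_mem g.2 r)]
    intro T _
    have := T.card_le_univ
    rw [Fintype.card_fin] at this
    exact Finset.mem_range.2 (by omega)

open Classical in
/-- The generators of the term of degree `N` of the Koszul complex. -/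
noncomputable def koszulGen (r : Fin (n + 1) → ℕ) : C.koszulTerm a N :=
  ⟨Pi.single r (if IsBox D a r ∧ ∑ j, r j = N then C.x (move a r) ∅ else 0), by
    refine mem_koszulTerm_iff.2 ⟨fun r' h1 h2 => ?_, fun r' h => ?_⟩
    · by_cases hr : r' = r
      · subst hr
        rw [Pi.single_eq_same, if_pos ⟨h1, h2⟩, C.mul_idem]
      · rw [Pi.single_eq_of_ne hr, zero_mul]
    · by_cases hr : r' = r
      · subst hr
        rw [Pi.single_eq_same, if_neg h]
      · rw [Pi.single_eq_of_ne hr]⟩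

theorem koszulGen_mem (r : Fin (n + 1) → ℕ) : C.koszulGen a N r ∈ C.koszulGr a N N := by
  intro r' T hT
  have hT' : T ≠ ∅ := by
    rintro rfl
    simp at hT
  by_cases hr : r' = r
  · subst hr
    simp only [koszulGen, Pi.single_eq_same]
    split_ifs
    · simp [C.coord_x, hT'.symm]
    · exact map_zero _
  · simp [koszulGen, Pi.single_eq_of_ne hr]

theorem smul_koszulGen_apply (g : C.koszulTerm a N) (r r' : Fin (n + 1) → ℕ) :
    (g.1 r • C.koszulGen a N r).1 r' = if r' = r then g.1 r else 0 := by
  show g.1 r * (C.koszulGen a N r).1 r' = _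
  split_ifs with hr
  · subst hr
    simp only [koszulGen, Pi.single_eq_same]
    exact g.2 r'
  · simp [koszulGen, Pi.single_eq_of_ne hr]

theorem eq_sum_smul_koszulGen (g : C.koszulTerm a N) :
    g = ∑ r ∈ Finset.Iic (fun _ : Fin (n + 1) => N), g.1 r • C.koszulGen a N r := by
  refine Subtype.ext (funext fun r' => ?_)
  rw [Submodule.coe_sum, Finset.sum_apply]
  simp only [smul_koszulGen_apply]
  rw [Finset.sum_ite_eq]
  split_ifs with h
  · rfl
  · refine eq_zero_of_mem g.2 fun h1 => h (Finset.mem_Iic.2 fun j => ?_)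
    exact (Finset.single_le_sum (fun i _ => Nat.zero_le (r' i)) (Finset.mem_univ j)).trans_eq h1.2

theorem projective_koszulTerm : Module.Projective A (C.koszulTerm a N) := by
  refine Module.Projective.of_split
    (M := (Finset.Iic (fun _ : Fin (n + 1) => N)) → A)
    (LinearMap.pi fun r => (LinearMap.proj r.1) ∘ₗ (C.koszulTerm a N).subtype)
    (Fintype.linearCombination A fun r => C.koszulGen a N r.1) ?_
  ext1 g
  conv_rhs => rw [LinearMap.id_apply, C.eq_sum_smul_koszulGen a N g]
  rw [LinearMap.comp_apply, Fintype.linearCombination_apply,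
    ← Finset.sum_coe_sort (Finset.Iic (fun _ : Fin (n + 1) => N))]
  rfl

theorem span_koszulGr_eq_top :
    Submodule.span A (C.koszulGr a N N : Set (C.koszulTerm a N)) = ⊤ := by
  rw [eq_top_iff]
  rintro g -
  rw [C.eq_sum_smul_koszulGen a N g]
  exact Submodule.sum_mem _ fun r _ => Submodule.smul_mem _ _
    (Submodule.subset_span (C.koszulGen_mem a N r))

theorem coord_mul_eq_zero {s s' : ℕ} {b y : A} {v : Fin (n + 1) → ℤ} {U : Finset (Fin (n + 1))}
    (hb : b ∈ Submodule.span k {z | ∃ c T, IsCube p D c T ∧ T.card = s ∧ z = C.x c T})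
    (hy : ∀ T, T.card + N ≠ s' → C.coord v T y = 0) (hU : U.card + N ≠ s + s') :
    C.coord v U (b * y) = 0 := by
  classical
  induction hb using Submodule.span_induction with
  | mem z hz =>
    obtain ⟨c, T, -, hT, rfl⟩ := hz
    rw [coord_x_mul]
    split_ifs with h
    · rw [hy, mul_zero]
      have := Finset.card_le_card h.1
      rw [Finset.card_sdiff_of_subset h.1]
      omega
    · rfl
  | zero => simp
  | add z z' _ _ h h' => rw [add_mul, map_add, h, h', add_zero]
  | smul c z _ h => rw [smul_mul_assoc, map_smul, h, smul_zero]

end CubicalBasis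

/-! ### The minimal resolution of a simple module -/

noncomputable section

namespace Realizes

variable {k : Type u} [Field k] {V : Type} [Quiver.{0} V] [Fintype V] {ρ : Set (PathAlg k V)}
  {n p : ℕ} {D : Finset (Fin (n + 1))} {C : CubicalBasis k (BoundAlg ρ) n p D}
  {occ : V → Fin (n + 1) → ℤ}

theorem mem_simpleIdeal_iff (h : Realizes C occ) (hp : 1 ≤ p) {i : V} {y : BoundAlg ρ} :
    y ∈ simpleIdeal ρ i ↔ C.coord (occ i) ∅ y = 0 := by
  classical
  constructor
  · intro hy
    induction hy using Submodule.span_induction with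
    | mem y hy =>
      rcases hy with ⟨j, hj, rfl⟩ | hy
      · rw [h.idem, C.coord_x, if_neg]
        exact fun h1 => hj (h.injective h1.1)
      · rw [SetLike.mem_coe, h.comp_eq_span hp] at hy
        induction hy using Submodule.span_induction with
        | mem y hy =>
          obtain ⟨a, T, -, hT, rfl⟩ := hy
          rw [C.coord_x, if_neg]
          rintro ⟨-, rfl, -⟩
          simp at hT
        | zero => simp
        | add z z' _ _ h h' => rw [map_add, h, h', add_zero]
        | smul c z _ h => rw [map_smul, h, smul_zero]
    | zero => simp
    | add z z' _ _ h h' => rw [map_add, h, h', add_zero]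
    | smul b y _ hy =>
      rw [smul_eq_mul]
      induction b using C.induction with
      | hx a T _ =>
        rw [C.coord_x_mul, Finset.empty_sdiff, hy, mul_zero, ite_self]
      | h0 => simp
      | hadd z z' h h' => rw [add_mul, map_add, h, h', add_zero]
      | hsmul c z h => rw [smul_mul_assoc, map_smul, h, smul_zero]
  · intro hy
    have hsm : ∀ (c : k) (z : BoundAlg ρ), z ∈ simpleIdeal ρ i → c • z ∈ simpleIdeal ρ i := by
      intro c z hz
      rw [← one_mul z, ← smul_mul_assoc]
      exact Submodule.smul_mem _ (c • (1 : BoundAlg ρ)) hz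
    have hpos : ∀ (N : ℕ) (a) (T : Finset (Fin (n + 1))), T.card = N + 1 → IsCube p D a T →
        C.x a T ∈ simpleIdeal ρ i := by
      intro N
      induction N with
      | zero =>
        intro a T hT hc
        refine Submodule.subset_span (Or.inr ?_)
        rw [h.comp_eq_span hp]
        exact Submodule.subset_span ⟨a, T, hc, hT, rfl⟩
      | succ N ih =>
        intro a T hT hc
        obtain ⟨t, htT, ht⟩ := hc.exists_last hp (Finset.card_pos.1 (by omega))
        have h1 := ih a (T.erase t) (by rw [Finset.card_erase_of_mem htT, hT]; rfl) ht
        have hd : Disjoint (T.erase t) {t} := by simp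
        have hu : T.erase t ∪ {t} = T := by
          rw [Finset.union_comm, ← Finset.insert_eq, Finset.insert_erase htT]
        have h2 := C.x_mul_x a {t} (T.erase t)
        rw [hu] at h2
        have h3 := C.coeff_ne_zero ht
          (CubicalBasis.isCube_right hd (by rwa [hu]) ht) hd
        have h4 : C.x a T = (C.coeff a (T.erase t) {t})⁻¹ •
            (C.x (a + disp (T.erase t)) {t} * C.x a (T.erase t)) := by
          rw [h2, smul_smul, inv_mul_cancel₀ h3, one_smul]
        rw [h4]
        exact hsm _ _ (Submodule.smul_mem _ _ h1)
    suffices hs : ∀ z : BoundAlg ρ, z - C.coord (occ i) ∅ z • C.x (occ i) ∅ ∈ simpleIdeal ρ i by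
      have := hs y
      rwa [hy, zero_smul, sub_zero] at this
    clear hy
    intro z
    induction z using C.induction with
    | hx a T hT =>
      rw [C.coord_x]
      by_cases hT0 : T = ∅
      · subst hT0
        by_cases ha : a = occ i
        · subst ha
          simp [hT]
        · obtain ⟨j, rfl⟩ := h.surjective a hT.2.1
          rw [if_neg (by tauto), zero_smul, sub_zero, ← h.idem]
          exact Submodule.subset_span (Or.inl ⟨j, fun h1 => ha (by rw [h1]), rfl⟩)
      · rw [if_neg (by tauto), zero_smul, sub_zero]
        have := Finset.card_pos.2 (Finset.nonempty_iff_ne_empty.2 hT0)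
        exact hpos (T.card - 1) a T (by omega) hT
    | h0 => simp
    | hadd z z' h1 h2 =>
      have := Submodule.add_mem _ h1 h2
      rwa [sub_add_sub_comm, ← add_smul, ← map_add] at this
    | hsmul c z h1 =>
      have := hsm c _ h1
      rwa [smul_sub, smul_smul, ← smul_eq_mul, ← map_smul] at this

variable (C occ) (i : V)

/-- The simple module at `i` and the terms of the Koszul complex. -/
def resX : ℕ → Type u
  | 0 => Simple ρ i
  | t + 1 => C.koszulTerm (occ i) t

instance : ∀ t, AddCommGroup (resX C occ i t)
  | 0 => inferInstanceAs (AddCommGroup (Simple ρ i))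
  | t + 1 => inferInstanceAs (AddCommGroup (C.koszulTerm (occ i) t))

instance : ∀ t, Module (BoundAlg ρ) (resX C occ i t)
  | 0 => inferInstanceAs (Module (BoundAlg ρ) (Simple ρ i))
  | t + 1 => inferInstanceAs (Module (BoundAlg ρ) (C.koszulTerm (occ i) t))

/-- The grading of the terms of the Koszul complex and of the simple module. -/
def resGr : ∀ t, ℕ → AddSubgroup (resX C occ i t)
  | 0 => fun s => if s = 0 then ⊤ else ⊥
  | t + 1 => C.koszulGr (occ i) t

/-- The projection of the term of degree `0` onto the simple module. -/
def augmentation : C.koszulTerm (occ i) 0 →ₗ[BoundAlg ρ] Simple ρ i :=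
  (simpleIdeal ρ i).mkQ ∘ₗ (LinearMap.proj 0) ∘ₗ (C.koszulTerm (occ i) 0).subtype

/-- The differential of the Koszul complex, as a map between its terms. -/
def koszulMap (a : Fin (n + 1) → ℤ) (t : ℕ) :
    C.koszulTerm a (t + 1) →ₗ[BoundAlg ρ] C.koszulTerm a t :=
  (C.bd a).restrict fun _ hg => CubicalBasis.bd_mem hg

/-- The maps of the augmented Koszul complex. -/
def resMap : ∀ t, resX C occ i (t + 1) →ₗ[BoundAlg ρ] resX C occ i t
  | 0 => augmentation C occ i
  | t + 1 => koszulMap C (occ i) t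

variable {C occ}

theorem isGradedModule_simple (h : Realizes C occ) (hp : 1 ≤ p) :
    IsGradedModule ρ (resX C occ i 0) (resGr C occ i 0) where
  internal := by
    refine isInternal_of_projections _ (fun s => if s = 0 then AddMonoidHom.id _ else 0) 1
      ?_ ?_ ?_ ?_
    · intro s x
      by_cases hs : s = 0 <;> simp [resGr, hs]
    · intro s x hx
      by_cases hs : s = 0
      · simp [hs]
      · simp [resGr, hs] at hx
        simp [hx]
    · intro s s' hs x hx
      by_cases hs' : s' = 0
      · have : s ≠ 0 := by omega
        simp [resGr, this] at hx
        simp [hx]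
      · simp [hs']
    · intro x
      simp
  smul_mem s t b x hb hx := by
    by_cases hst : s + t = 0
    · simp [resGr, hst]
    · suffices b • x = 0 by rw [this]; exact AddSubgroup.zero_mem _
      by_cases ht : t = 0
      swap
      · simp [resGr, ht] at hx
        rw [hx, smul_zero]
      obtain ⟨y, rfl⟩ := Submodule.Quotient.mk_surjective _ x
      refine (Submodule.Quotient.mk_eq_zero _ (x := b • y)).2 ?_
      rw [h.mem_simpleIdeal_iff hp, smul_eq_mul]
      rw [h.comp_eq_span hp] at hb
      classical
      induction hb using Submodule.span_induction with
      | mem z hz =>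
        obtain ⟨c, T, -, hT, rfl⟩ := hz
        rw [C.coord_x_mul, if_neg]
        rintro ⟨h1, -⟩
        obtain rfl := Finset.subset_empty.1 h1
        rw [Finset.card_empty] at hT
        omega
      | zero => simp
      | add z z' _ _ h h' => rw [add_mul, map_add, h, h', add_zero]
      | smul c z _ h => rw [smul_mul_assoc, map_smul, h, smul_zero]

theorem isGradedModule_koszulTerm (h : Realizes C occ) (hp : 1 ≤ p) (a : Fin (n + 1) → ℤ) (N : ℕ) :
    IsGradedModule ρ (C.koszulTerm a N) (C.koszulGr a N) where
  internal := C.isInternal_koszulGr a N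
  smul_mem s t b x hb hx := by
    intro r T hT
    rw [h.comp_eq_span hp] at hb
    exact C.coord_mul_eq_zero N hb (hx r) hT

/-- Elements without components at the idempotents belong to the radical. -/
theorem mem_radModule (h : Realizes C occ) (hp : 1 ≤ p) {a : Fin (n + 1) → ℤ} {N : ℕ}
    (g : C.koszulTerm a N) (hg : ∀ r, C.coord (move a r) ∅ (g.1 r) = 0) :
    g ∈ radModule ρ (C.koszulTerm a N) := by
  rw [C.eq_sum_smul_koszulGen a N g]
  refine Submodule.sum_mem _ fun r _ => ?_
  rw [C.eq_sum_of_mul_idem (CubicalBasis.mul_idem_of_mem g.2 r), Finset.sum_smul]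
  refine Submodule.sum_mem _ fun T _ => ?_
  by_cases hT : T = ∅
  · rw [hT, hg, zero_smul, zero_smul]
    exact Submodule.zero_mem _
  · by_cases hc : IsCube p D (move a r) T
    · refine Submodule.subset_span ⟨T.card, _, _,
        Finset.card_pos.2 (Finset.nonempty_iff_ne_empty.2 hT), ?_, rfl⟩
      rw [h.comp_eq_span hp]
      exact Submodule.smul_mem _ _ (Submodule.subset_span ⟨_, T, hc, rfl, rfl⟩)
    · rw [C.eq_zero _ _ hc, smul_zero, zero_smul]
      exact Submodule.zero_mem _

theorem mem_ker_augmentation_iff (h : Realizes C occ) (hp : 1 ≤ p) (g : C.koszulTerm (occ i) 0) :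
    g ∈ LinearMap.ker (augmentation C occ i) ↔ C.coord (occ i) ∅ (g.1 0) = 0 := by
  rw [← h.mem_simpleIdeal_iff hp, LinearMap.mem_ker]
  exact Submodule.Quotient.mk_eq_zero _

theorem apply_eq_zero_of_ne_zero {a : Fin (n + 1) → ℤ} (g : C.koszulTerm a 0)
    {r : Fin (n + 1) → ℕ} (hr : r ≠ 0) : g.1 r = 0 := by
  refine CubicalBasis.eq_zero_of_mem g.2 fun h => hr (funext fun j => ?_)
  exact Finset.sum_eq_zero_iff.1 h.2 j (Finset.mem_univ j)

theorem isBox_zero {a : Fin (n + 1) → ℤ} (ha : IsConfig p a) : IsBox D a 0 := fun t =>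
  ⟨fun _ => by simpa using ha.1 _, fun _ => rfl⟩

theorem surjective_augmentation (h : Realizes C occ) (hp : 1 ≤ p) :
    Function.Surjective (augmentation C occ i) := by
  intro x
  obtain ⟨y, rfl⟩ := Submodule.Quotient.mk_surjective _ x
  refine ⟨y • C.koszulGen (occ i) 0 0, ?_⟩
  refine (Submodule.Quotient.eq _).2 ?_
  have h1 : (C.koszulGen (occ i) 0 0).1 0 = C.x (occ i) ∅ := by
    simp [CubicalBasis.koszulGen, isBox_zero (D := D) (h.isConfig i)]
  have h2 : (y • C.koszulGen (occ i) 0 0).1 0 = y * C.x (occ i) ∅ := by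
    rw [← h1]; rfl
  show (y • C.koszulGen (occ i) 0 0).1 0 - y ∈ _
  classical
  rw [h2, h.mem_simpleIdeal_iff hp, map_sub, C.coord_mul_x, if_pos (Finset.Subset.refl _)]
  have h3 : C.coeff (occ i) ∅ ∅ = 1 := by
    rw [CubicalBasis.coeff, C.idem_mul, Finset.union_empty,
      C.coord_x_self (isCube_empty.2 (h.isConfig i))]
  simp [h3]

theorem sum_eq_of_forall_eq {a : Fin (n + 1) → ℤ} (ha : IsConfig p a) {r : Fin (n + 1) → ℕ}
    (hr : ∀ t, (r t : ℤ) = a (t - 1)) : ∑ j, r j = p := by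
  have h := Equiv.sum_comp (Equiv.subRight (1 : Fin (n + 1))) a
  simp only [Equiv.subRight_apply, ← hr, ha.2] at h
  exact_mod_cast h

theorem exact_augmentation (h : Realizes C occ) (hp : 1 ≤ p) :
    LinearMap.range (koszulMap C (occ i) 0) = LinearMap.ker (augmentation C occ i) := by
  ext g
  rw [mem_ker_augmentation_iff i h hp]
  constructor
  · rintro ⟨g', rfl⟩
    have := CubicalBasis.coord_bd (C := C) (a := occ i) 0 ∅ g'.1
    rw [Finset.sum_empty, move_zero] at this
    exact this
  · intro hg
    obtain ⟨g', h1, h2⟩ := CubicalBasis.exists_bd_eq (h.isConfig i) g.2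
      (CubicalBasis.bd_eq_zero_of_mem_zero g.2) (by
        intro r T hr hrN hT hne
        by_contra hf
        push Not at hf
        rcases eq_of_forall_not_isFree hr hT hf with ⟨rfl, rfl⟩ | ⟨-, h2⟩
        · rw [move_zero] at hne
          exact hne hg
        · have := sum_eq_of_forall_eq (h.isConfig i) h2
          omega)
    exact ⟨⟨g', h1⟩, Subtype.ext h2⟩

theorem exact_koszulMap {a : Fin (n + 1) → ℤ} (ha : IsConfig p a) (t : ℕ)
    (ht : t + 1 = p → D ≠ Finset.univ) :
    LinearMap.range (koszulMap C a (t + 1)) = LinearMap.ker (koszulMap C a t) := by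
  ext g
  constructor
  · rintro ⟨g', rfl⟩
    exact Subtype.ext (CubicalBasis.bd_bd ha g'.2)
  · intro hg
    obtain ⟨g', h1, h2⟩ := CubicalBasis.exists_bd_eq ha g.2 (congrArg Subtype.val hg) (by
        intro r T hr hrN hT hne
        by_contra hf
        push Not at hf
        rcases eq_of_forall_not_isFree hr hT hf with ⟨rfl, rfl⟩ | ⟨h1, h2⟩
        · simp at hrN
        · refine ht (hrN.symm.trans (sum_eq_of_forall_eq ha h2)) ?_
          exact Finset.univ_subset_iff.1 (h1 ▸ hT.1))
    exact ⟨⟨g', h1⟩, Subtype.ext h2⟩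

/-- The kernel of the last differential is concentrated in one degree: the components at which a
move is free are exact, and only the components at the full rotations remain. -/
theorem mem_koszulGr_of_mem_ker {a : Fin (n + 1) → ℤ} (ha : IsConfig p a) {t : ℕ} (ht : t + 1 = p)
    (g : C.koszulTerm a (t + 1)) (hg : g ∈ LinearMap.ker (koszulMap C a t)) :
    g ∈ C.koszulGr a (t + 1) (n + 1 + (t + 1)) := by
  set g₁ := C.koszulPart a (t + 1) (n + 1 + (t + 1)) g with hg₁
  have h1 : C.bd a g₁.1 = 0 := by
    refine CubicalBasis.eq_zero_of_mem_of_coord (CubicalBasis.bd_mem g₁.2) fun r T _ _ _ => ?_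
    rw [CubicalBasis.coord_bd]
    refine Finset.sum_eq_zero fun s hs => ?_
    have h2 := Finset.card_lt_card (Finset.erase_ssubset hs)
    have h3 := T.card_le_univ
    rw [Fintype.card_fin] at h3
    rw [hg₁, CubicalBasis.koszulPart_apply, CubicalBasis.coord_homogPart, if_neg (by omega),
      mul_zero, mul_zero]
  have h2 : C.bd a (g - g₁).1 = 0 := by
    have h3 : C.bd a g.1 = 0 := congrArg Subtype.val hg
    show C.bd a (g.1 - g₁.1) = 0
    rw [map_sub, h1, h3, sub_zero]
  obtain ⟨g', h3, h4⟩ := CubicalBasis.exists_bd_eq ha (g - g₁).2 h2 (by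
    intro r T hr hrN hT hne
    by_contra hf
    push Not at hf
    rcases eq_of_forall_not_isFree hr hT hf with ⟨rfl, rfl⟩ | ⟨rfl, -⟩
    · simp at hrN
    · apply hne
      show C.coord _ _ (g.1 r - g₁.1 r) = 0
      rw [map_sub, hg₁, CubicalBasis.koszulPart_apply, CubicalBasis.coord_homogPart,
        if_pos (by simp),
        sub_self])
  have h5 : g' = 0 := by
    ext r
    refine CubicalBasis.eq_zero_of_mem h3 ?_
    rintro ⟨h5, h6⟩
    have h7 : ((∑ j, r j : ℕ) : ℤ) ≤ ∑ j, a (j - 1) := by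
      push_cast
      refine Finset.sum_le_sum fun j _ => ?_
      by_cases hj : j ∈ D
      · exact (h5 j).1 hj
      · rw [(h5 j).2 hj]
        exact ha.1 _
    have h8 := Equiv.sum_comp (Equiv.subRight (1 : Fin (n + 1))) a
    simp only [Equiv.subRight_apply, ha.2] at h8
    rw [h8, h6] at h7
    omega
  have h6 : g = g₁ := by
    rw [h5, map_zero] at h4
    exact sub_eq_zero.1 (Subtype.ext h4.symm)
  intro r T hT
  rw [h6, hg₁, CubicalBasis.koszulPart_apply, CubicalBasis.coord_homogPart, if_neg hT]

/-- The augmented Koszul complex is a minimal projective resolution as far as no full rotation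
occurs. -/
def resolution (h : Realizes C occ) (hp : 1 ≤ p) (q : ℕ∞)
    (hq : ∀ t : ℕ, t = p → ((t + 1 : ℕ) : ℕ∞) ≤ q → D ≠ Finset.univ) : MinimalResolution ρ i q where
  X := resX C occ i
  gr := resGr C occ i
  graded t := by
    cases t with
    | zero => exact isGradedModule_simple i h hp
    | succ t => exact h.isGradedModule_koszulTerm hp (occ i) t
  simple := ⟨LinearEquiv.refl _ _⟩
  simple_degree := rfl
  projective t := C.projective_koszulTerm (occ i) t
  map := resMap C occ i
  map_mem t s x hx := by
    cases t with
    | zero =>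
      by_cases hs : s = 0
      · subst hs
        exact AddSubgroup.mem_top _
      · have h1 : x ∈ LinearMap.ker (augmentation C occ i) := by
          refine (mem_ker_augmentation_iff i h hp x).2 ?_
          have := hx 0 ∅ (by simpa using Ne.symm hs)
          rwa [move_zero] at this
        have h2 : resMap C occ i 0 x = 0 := h1
        rw [h2]
        exact AddSubgroup.zero_mem _
    | succ t =>
      intro r T hT
      show C.coord _ _ (C.bd (occ i) x.1 r) = 0
      rw [CubicalBasis.coord_bd]
      refine Finset.sum_eq_zero fun j hj => ?_
      rw [hx, mul_zero, mul_zero]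
      rw [Finset.card_erase_of_mem hj]
      have := Finset.card_pos.2 ⟨j, hj⟩
      omega
  surjective := surjective_augmentation i h hp
  exact t ht := by
    cases t with
    | zero => exact exact_augmentation i h hp
    | succ t => exact exact_koszulMap (h.isConfig i) t fun h1 => hq _ h1 ht
  minimal t ht x hx := by
    refine h.mem_radModule hp (a := occ i) (N := t) x fun r => ?_
    cases t with
    | zero =>
      by_cases hr : r = 0
      · subst hr
        rw [move_zero]
        exact (mem_ker_augmentation_iff i h hp x).1 hx
      · rw [apply_eq_zero_of_ne_zero x hr, map_zero]
    | succ t =>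
      exact CubicalBasis.coord_empty_eq_zero_of_bd_eq_zero (h.isConfig i) x.2 (by simp)
        (congrArg Subtype.val hx) r

theorem comp_eq_bot (h : Realizes C occ) (hp : 1 ≤ p) {t : ℕ} (ht : D.card < t) :
    comp ρ t = ⊥ := by
  rw [h.comp_eq_span hp, Submodule.span_eq_bot]
  rintro _ ⟨a, T, hT, hc, rfl⟩
  have := Finset.card_le_card hT.1
  omega

/-- If not all moves are allowed, then the Koszul complex is exact. -/
theorem isKoszulOfType_top (h : Realizes C occ) (hp : 1 ≤ p) (hD : D ≠ Finset.univ) :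
    IsKoszulOfType ρ D.card ⊤ := by
  refine ⟨fun t ht => h.comp_eq_bot hp ht, fun i =>
    ⟨resolution i h hp ⊤ fun _ _ _ => hD, fun t _ => C.span_koszulGr_eq_top (occ i) t, ?_⟩⟩
  intro t ht
  exact absurd ht (ENat.natCast_ne_top t)

/-- If all moves are allowed, then the Koszul complex is exact up to the degree that is the number
of particles. -/
theorem isKoszulOfType_univ (h : Realizes C occ) (hp : 1 ≤ p) (hD : D = Finset.univ) :
    IsKoszulOfType ρ D.card p := by
  refine ⟨fun t ht => h.comp_eq_bot hp ht, fun i =>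
    ⟨resolution i h hp p fun t ht1 ht2 => ?_, fun t _ => C.span_koszulGr_eq_top (occ i) t, ?_⟩⟩
  · have : t + 1 ≤ p := by exact_mod_cast ht2
    omega
  · intro t ht x hx
    obtain rfl : t = p := by exact_mod_cast ht
    obtain ⟨s, rfl⟩ : ∃ s, t = s + 1 := ⟨t - 1, by omega⟩
    have hc : D.card = n + 1 := by rw [hD, Finset.card_univ, Fintype.card_fin]
    rw [hc]
    exact mem_koszulGr_of_mem_ker (h.isConfig i) rfl x hx

end Realizes

end

/-! ### Admissibility -/

namespace Realizes

variable {k : Type u} [Field k] {V : Type} [Quiver.{0} V] [Fintype V] {ρ : Set (PathAlg k V)}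
  {n p : ℕ} {D : Finset (Fin (n + 1))} {C : CubicalBasis k (BoundAlg ρ) n p D}
  {occ : V → Fin (n + 1) → ℤ}

/-- If no particle moves from the last site to the first one, then along each path the number of
particles on the first site decreases and the one on the last site increases. -/
theorem le_of_mem_vertices (h : Realizes C occ) (hD : (0 : Fin (n + 1)) ∉ D) {i j : V}
    (q : Quiver.Path i j) {v : V} (hv : v ∈ q.vertices) :
    occ j 0 ≤ occ v 0 ∧ occ i (Fin.last n) ≤ occ v (Fin.last n) := by
  have harrow : ∀ {i j : V} (_ : i ⟶ j),
      occ j 0 ≤ occ i 0 ∧ occ i (Fin.last n) ≤ occ j (Fin.last n) := by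
    intro i j f
    obtain ⟨t, ht, h1, -⟩ := h.arrow f
    have h2 : (0 : Fin (n + 1)) ≠ t := by rintro rfl; exact hD ht
    rw [h1]
    simp only [Pi.add_apply, disp, Finset.mem_singleton, h2, if_false, Fin.last_add_one]
    constructor <;> split_ifs <;> omega
  have hpath : ∀ {i j : V} (q : Quiver.Path i j), occ i (Fin.last n) ≤ occ j (Fin.last n) := by
    intro i j q
    induction q with
    | nil => exact le_rfl
    | cons q f ih => exact ih.trans (harrow f).2
  induction q with
  | nil =>
    obtain rfl : v = i := by simpa using hv
    exact ⟨le_rfl, le_rfl⟩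
  | cons q f ih =>
    rw [Quiver.Path.mem_vertices_cons] at hv
    rcases hv with hv | rfl
    · exact ⟨(harrow f).1.trans (ih hv).1, (ih hv).2⟩
    · exact ⟨le_rfl, hpath (q.cons f)⟩

/-- If `a` has a particle on the first site, `a + disp T` has one on the last site, and there are at
least two particles, then the moves can be ordered such that both happens at some moment. -/
theorem exists_intermediate (hp : 2 ≤ p) (hD : (0 : Fin (n + 1)) ∉ D) {a : Fin (n + 1) → ℤ}
    {T : Finset (Fin (n + 1))} (hT : IsCube p D a T) (h0 : 1 ≤ a 0)
    (hn : 1 ≤ (a + disp T) (Fin.last n)) :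
    ∃ S ⊆ T, IsConfig p (a + disp S) ∧ 1 ≤ (a + disp S) 0 ∧ 1 ≤ (a + disp S) (Fin.last n) := by
  have h0T : (0 : Fin (n + 1)) ∉ T := fun h1 => hD (hT.1 h1)
  by_cases h1 : 1 ≤ a (Fin.last n)
  · exact ⟨∅, Finset.empty_subset T, by simpa using hT.2.1, by simpa using h0, by simpa using h1⟩
  by_cases h2 : 1 ≤ (a + disp T) 0
  · exact ⟨T, Finset.Subset.refl T, hT.2.2, h2, hn⟩
  have hlast : Fin.last n ∈ T := by
    by_contra h3
    simp [disp, h0T, h3] at hn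
    omega
  have ha0 : a 0 = 1 := by
    simp only [Pi.add_apply, disp, h0T, if_false] at h2
    split_ifs at h2 <;> omega
  obtain ⟨j, hj0, hj⟩ : ∃ j, j ≠ 0 ∧ 1 ≤ a j := by
    by_contra h3
    push Not at h3
    have h4 : ∑ j, a j = a 0 := Finset.sum_eq_single 0
      (fun j _ hj => le_antisymm (by have := h3 j hj; omega) (hT.2.1.1 j)) (by simp)
    rw [hT.2.1.2, ha0] at h4
    omega
  have hjn : j ≠ Fin.last n := by
    rintro rfl
    exact h1 hj
  -- The sites after `j` are served first; the particle on `j` keeps this possible.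
  refine ⟨T.filter (j < ·), Finset.filter_subset _ _, ?_, ?_, ?_⟩
  · rw [isConfig_add_disp_iff hT.2.1]
    intro s hs hs'
    rw [Finset.mem_filter] at hs hs'
    by_cases hsT : s ∈ T
    · have h3 : s ≤ j := not_lt.1 fun h3 => hs' ⟨hsT, h3⟩
      have hsn : s ≠ Fin.last n := by
        rintro rfl
        rw [Fin.last_add_one] at hs
        exact h0T hs.1
      have h4 : j ≤ s := by
        have h5 := hs.2
        rw [Fin.lt_def, Fin.val_add_one_of_lt (Fin.lt_last_iff_ne_last.2 hsn)] at h5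
        rw [Fin.le_def]
        omega
      rwa [le_antisymm h3 h4]
    · exact (isConfig_add_disp_iff hT.2.1 T).1 hT.2.2 s hs.1 hsT
  · have h3 : ¬ j < 1 := by
      rw [not_lt]
      rcases n with _ | n
      · exact absurd (Fin.eq_zero j) hj0
      · exact Fin.one_le_of_ne_zero hj0
    simp [disp, h3, ha0]
  · have h3 : j < Fin.last n := Fin.lt_last_iff_ne_last.2 hjn
    have := hT.2.1.1 (Fin.last n)
    simp [disp, hlast, h3]
    omega

/-- If the total displacement of three sets of moves is that of all moves, then the sets are
disjoint. -/
theorem disjoint_of_disp_add {R S T : Finset (Fin (n + 1))}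
    (hR : R ⊆ {0}ᶜ) (hS : S ⊆ {0}ᶜ) (hT : T ⊆ {0}ᶜ)
    (h : disp R + disp S + disp T = disp {0}ᶜ) : Disjoint S T := by
  have h0 : ∀ {U : Finset (Fin (n + 1))}, U ⊆ {0}ᶜ → (0 : Fin (n + 1)) ∉ U := fun hU h1 => by
    simpa using hU h1
  have hc : ∀ j, (((if j ∈ R then 1 else 0) + (if j ∈ S then 1 else 0) +
      (if j ∈ T then 1 else 0) : ℤ) - if j ∈ ({0}ᶜ : Finset (Fin (n + 1))) then 1 else 0) = 0 := by
    intro j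
    refine (eq_zero_apply_of_rotate (f := fun j => ((if j ∈ R then 1 else 0) +
      (if j ∈ S then 1 else 0) + (if j ∈ T then 1 else 0) : ℤ) -
        if j ∈ ({0}ᶜ : Finset (Fin (n + 1))) then 1 else 0) (fun i => ?_) j).trans ?_
    · have := congrFun h i
      simp only [Pi.add_apply, disp] at this
      linarith
    · simp [h0 hR, h0 hS, h0 hT]
  rw [Finset.disjoint_left]
  intro j hjS hjT
  have := hc j
  simp only [hjS, hjT, if_true] at this
  split_ifs at this <;> omega

/-- If no particle moves from the last site to the first one and there are at least two particles,
then the bound quiver is an admissible translation quiver. -/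
theorem isAdmissible (h : Realizes C occ) (hD : D = {0}ᶜ) (hp : 2 ≤ p) {N : ℕ}
    (hN : D.card = N + 1) {P I : Set V} {τ : ↥(Pᶜ) ≃ ↥(Iᶜ)}
    (hτ : ∀ i : ↥(Pᶜ), occ i = occ (τ i) + disp D)
    (hP : ∀ v, v ∈ P ↔ occ v (Fin.last n) = 0) (hI : ∀ v, v ∈ I ↔ occ v 0 = 0) :
    IsAdmissible N ρ P I τ where
  prolong a b q hq := by
    obtain ⟨T, hT⟩ := h.isBound_iff.1 hq
    obtain ⟨a', b', q'', q', h1⟩ := h.exists_full_prolongation (by simp [hD]) (by omega) hT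
    exact ⟨a', b', q'', q', by rw [← h1.2.1, hN], h1.isBound⟩
  shift a b q hq ha hb := by
    have h0 : (0 : Fin (n + 1)) ∉ D := by simp [hD]
    refine Submodule.subset_span ⟨q, ⟨hq, ?_⟩, rfl⟩
    obtain ⟨T, hT⟩ := h.isBound_iff.1 hq
    have ha' : 1 ≤ occ a 0 := by
      have h1 := (h.isConfig a).1 0
      have h2 : occ a 0 ≠ 0 := fun h3 => ha ((hI a).2 h3)
      omega
    have hb' : 1 ≤ occ b (Fin.last n) := by
      have h1 := (h.isConfig b).1 (Fin.last n)
      have h2 : occ b (Fin.last n) ≠ 0 := fun h3 => hb ((hP b).2 h3)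
      omega
    rw [hT.2.2.1] at hb'
    obtain ⟨S, hST, hS, hS0, hSn⟩ := exists_intermediate hp h0 hT.1 ha' hb'
    obtain ⟨v, hv⟩ := h.surjective _ hS
    obtain ⟨q'', hq''⟩ := h.exists_hasMoves (by omega) (hST.trans hT.1.1) hv
    have h1 : occ b = occ v + disp (T \ S) := by
      rw [hv, hT.2.2.1, add_assoc, disp_sdiff hST]
    obtain ⟨q', hq'⟩ := h.exists_hasMoves (by omega) (Finset.sdiff_subset.trans hT.1.1) h1
    have h2 := hq''.comp hq' Finset.disjoint_sdiff
    rw [Finset.union_sdiff_of_subset hST] at h2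
    obtain ⟨-, -, -, c, hc, h3⟩ := h2
    obtain ⟨-, -, -, c', hc', h4⟩ := hT
    have h5 : img ρ q = (c' * c⁻¹) • (img ρ q' * img ρ q'') := by
      rw [← img_comp, h3, smul_smul, mul_assoc, inv_mul_cancel₀ hc, mul_one, h4]
    rw [h5]
    refine Submodule.smul_mem _ _ (Submodule.subset_span ⟨v, q'', q', rfl, Or.inr ?_, Or.inr ?_⟩)
    · refine Submodule.subset_span ⟨q'', ?_, rfl⟩
      rintro ⟨w, hw, hw'⟩
      have h6 := (h.le_of_mem_vertices h0 q'' hw').1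
      rw [(hI w).1 hw, hv] at h6
      omega
    · refine Submodule.subset_span ⟨q', ?_, rfl⟩
      rintro ⟨w, hw, hw'⟩
      have h6 := (h.le_of_mem_vertices h0 q' hw').2
      rw [(hP w).1 hw, hv] at h6
      omega
  stark i a b q q' hq hq' hl hqP hqI := by
    left
    obtain ⟨T, hT⟩ := h.isBound_iff.1 hq
    obtain ⟨S, hS⟩ := h.isBound_iff.1 hq'
    refine ⟨hq, fun q₁ hq₁ hb => ?_, ?_, fun w hw hw0 => ?_⟩
    · obtain ⟨T', hT'⟩ := h.isBound_iff.1 hb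
      exact hT.dependent hT' hq₁.symm
    · have h1 : q'.length ≠ 0 := by
        intro h1
        obtain ⟨v, hv, hv'⟩ := hqI
        cases q' with
        | nil =>
          obtain rfl : v = τ i := by simpa using hv'
          exact (τ i).2 hv
        | cons q' f => simp at h1
      omega
    · obtain ⟨W, c, hc, h1, -, h3, rfl⟩ := h.eq_smul_of_mem_homComp hw hw0
      obtain ⟨hT1, -, hT3, c', hc', hT4⟩ := hT
      rw [hT4, smul_mul_smul_comm]
      refine smul_ne_zero (mul_ne_zero hc' hc) (C.x_mul_x_ne_zero h1 hT1 h3 ?_)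
      have h4 := hτ i
      rw [hT3, h3, hS.2.2.1, add_assoc, add_assoc, add_right_inj, ← add_assoc, hD] at h4
      exact disjoint_of_disp_add (hD ▸ hS.1.1) (hD ▸ h1.1) (hD ▸ hT1.1) h4

end Realizes

/-! ### Vertices of the pyramid quiver as configurations -/

section Occupation

variable {n m : ℕ}

/-- The vertex `i` of the pyramid quiver as a configuration of `m - 1` particles on `n + 1` sites:
there are `i t - 1` particles on the site `t + 1`, and the remaining ones are on the site `0`. -/
def occ (v : Vertex n m) : Fin (n + 1) → ℤ :=
  Fin.cons ((m : ℤ) - 1 - ∑ t, (v.1 t - 1)) fun t => v.1 t - 1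

@[simp] theorem occ_zero (v : Vertex n m) : occ v 0 = (m : ℤ) - 1 - ∑ t, (v.1 t - 1) := rfl

@[simp] theorem occ_succ (v : Vertex n m) (t : Fin n) : occ v t.succ = v.1 t - 1 := rfl

theorem occ_injective : Function.Injective (occ (n := n) (m := m)) := by
  intro v w h
  apply Subtype.ext
  funext t
  have := congrFun h t.succ
  simp only [occ_succ] at this
  linarith

theorem sum_occ (v : Vertex n m) : ∑ j, occ v j = (m : ℤ) - 1 := by
  rw [Fin.sum_univ_succ]
  simp only [occ_zero, occ_succ]
  ring

theorem isConfig_occ (hn : 1 ≤ n) {p : ℕ} (hm : m = p + 1) (v : Vertex n m) :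
    IsConfig p (occ v) := by
  refine ⟨fun j => ?_, by rw [sum_occ, hm]; push_cast; ring⟩
  induction j using Fin.cases with
  | zero =>
    have h := v.2.2 ⟨n - 1, by omega⟩
    have h1 : Finset.Iic (⟨n - 1, by omega⟩ : Fin n) = Finset.univ := by
      ext t
      simp only [Finset.mem_Iic, Finset.mem_univ, iff_true, Fin.le_def]
      omega
    have h2 : ((n - 1 : ℕ) : ℤ) = n - 1 := by push_cast [hn]; ring
    simp only [h1, h2] at h
    rw [occ_zero, Finset.sum_sub_distrib]
    simp
    linarith
  | succ t =>
    have := v.2.1 t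
    rw [occ_succ]
    linarith

theorem exists_occ_eq {p : ℕ} (hm : m = p + 1) {a : Fin (n + 1) → ℤ} (ha : IsConfig p a) :
    ∃ v : Vertex n m, occ v = a := by
  have h2 := ha.2
  rw [Fin.sum_univ_succ] at h2
  refine ⟨⟨fun t => a t.succ + 1, fun t => by have := ha.1 t.succ; linarith, fun s => ?_⟩, ?_⟩
  · rw [Finset.sum_add_distrib, Finset.sum_const, Fin.card_Iic]
    have h3 : ∑ t ∈ Finset.Iic s, a t.succ ≤ ∑ t : Fin n, a t.succ :=
      Finset.sum_le_sum_of_subset_of_nonneg (Finset.subset_univ _) fun t _ _ => ha.1 t.succ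
    have h4 := ha.1 0
    rw [hm]
    push_cast
    simp
    linarith
  · funext j
    induction j using Fin.cases with
    | zero =>
      simp [occ, hm]
      linarith
    | succ t => simp [occ]

theorem succ_add_one_eq_succ_iff (s t : Fin n) :
    s.succ + 1 = t.succ ↔ (s : ℕ) + 1 = (t : ℕ) := by
  rw [Fin.ext_iff]
  by_cases h : s.succ = Fin.last n
  · have h1 : (s : ℕ) + 1 = n := by simpa using congrArg Fin.val h
    rw [h, Fin.last_add_one]
    have := t.isLt
    simp
    omega
  · rw [Fin.val_add_one_of_lt (Fin.lt_last_iff_ne_last.2 h)]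
    simp

theorem eq_step_iff (v w : Vertex n m) (t : Fin n) :
    w.1 = step t v.1 ↔ occ w = occ v + disp {t.succ} := by
  have h0 : ∀ s : Fin n, occ w s.succ = (occ v + disp {t.succ}) s.succ ↔ w.1 s = step t v.1 s := by
    intro s
    simp only [Pi.add_apply, occ_succ, disp, Finset.mem_singleton, succ_add_one_eq_succ_iff,
      Fin.succ_inj, step]
    constructor <;> intro h <;> linarith
  constructor
  · intro h
    have h1 : ∀ s : Fin n, occ w s.succ = (occ v + disp {t.succ}) s.succ := fun s =>
      (h0 s).2 (congrFun h s)
    have h2 : ∑ j, occ w j = ∑ j, (occ v + disp {t.succ}) j := by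
      simp only [Pi.add_apply, Finset.sum_add_distrib, sum_disp, sum_occ, add_zero]
    rw [Fin.sum_univ_succ, Fin.sum_univ_succ (fun j => (occ v + disp {t.succ}) j),
      Finset.sum_congr rfl fun s _ => h1 s] at h2
    funext j
    induction j using Fin.cases with
    | zero => exact add_right_cancel h2
    | succ s => exact h1 s
  · intro h
    funext s
    exact (h0 s).1 (congrFun h s.succ)

end Occupation

/-! ### Sorting the moves -/

section Sorting

variable {n p : ℕ} {a : Fin (n + 1) → ℤ}

theorem isConfig_add_disp_singleton_iff {t : Fin (n + 1)} (ha : IsConfig p a) (ht : t ≠ 0) :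
    IsConfig p (a + disp {t}) ↔ 1 ≤ a (t - 1) := by
  rw [isConfig_add_disp_iff ha]
  constructor
  · intro h
    refine h (t - 1) (by simp) ?_
    rw [Finset.mem_singleton]
    intro h1
    have h2 : (1 : Fin (n + 1)) = 0 := by simpa using h1
    exact ht (eq_zero_apply_of_rotate (f := fun i => i) (fun i => by simp [h2]) t)
  · rintro h j hj -
    have : j = t - 1 := by rw [eq_sub_iff_add_eq]; simpa using hj
    rwa [this]

theorem sub_one_lt {t : Fin (n + 1)} (ht : t ≠ 0) : t - 1 < t := by
  rw [Fin.lt_def, Fin.val_sub_one_of_ne_zero ht]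
  have : (t : ℕ) ≠ 0 := fun h => ht (Fin.ext h)
  omega

/-- If a move can be made after a move of larger type, then it can be made before it. -/
theorem isConfig_of_lt {t s : Fin (n + 1)} (ht : t ≠ 0) (hts : t < s) (ha : IsConfig p a)
    (h1 : IsConfig p (a + disp {s})) (h2 : IsConfig p (a + disp {s} + disp {t})) :
    IsConfig p (a + disp {t}) := by
  rw [isConfig_add_disp_singleton_iff ha ht]
  have h3 := (isConfig_add_disp_singleton_iff h1 ht).1 h2
  have h4 : t - 1 ≠ s := ((sub_one_lt ht).trans hts).ne
  simpa [disp, h4, hts.ne] using h3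

/-- The last move of a cube can be taken to be the one of largest type. -/
theorem IsCube.of_insert_max {u : Fin (n + 1)} {T : Finset (Fin (n + 1))}
    (hu : ∀ s ∈ T, s < u) (h : IsCube p {0}ᶜ a (insert u T)) : IsCube p {0}ᶜ a T := by
  refine ⟨(Finset.subset_insert _ _).trans h.1, h.2.1, ?_⟩
  rw [isConfig_add_disp_iff h.2.1]
  intro j hj hj'
  refine (isConfig_add_disp_iff h.2.1 _).1 h.2.2 j (Finset.mem_insert_of_mem hj) fun h1 => ?_
  obtain rfl := (Finset.mem_insert.1 h1).resolve_right hj'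
  have h2 : j + 1 ≠ 0 := by simpa using h.1 (Finset.mem_insert_of_mem hj)
  have h3 := sub_one_lt h2
  rw [add_sub_cancel_right] at h3
  exact lt_asymm h3 (hu _ hj)

end Sorting

/-! ### Reordering factors -/

section Twist

variable {k : Type u} [Field k] {n m : ℕ} (d : Fin n → Fin n → Vertex n m → k)

open Classical in
/-- The twisting scalars `d`, with the arrows of the pyramid quiver considered as moves `s`, `t` of
particles and with its vertices considered as configurations; the value is `1` elsewhere. -/
noncomputable def twist (s t : Fin (n + 1)) (a : Fin (n + 1) → ℤ) : k :=
  if h : ∃ q : Fin n × Fin n × Vertex n m, q.1.succ = s ∧ q.2.1.succ = t ∧ occ q.2.2 = a then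
    d h.choose.1 h.choose.2.1 h.choose.2.2 else 1

theorem twist_occ (s t : Fin n) (v : Vertex n m) : twist d s.succ t.succ (occ v) = d s t v := by
  have h : ∃ q : Fin n × Fin n × Vertex n m,
      q.1.succ = s.succ ∧ q.2.1.succ = t.succ ∧ occ q.2.2 = occ v := ⟨(s, t, v), rfl, rfl, rfl⟩
  obtain ⟨h1, h2, h3⟩ := h.choose_spec
  rw [twist, dif_pos h, Fin.succ_injective _ h1, Fin.succ_injective _ h2, occ_injective h3]

variable {d}

theorem twist_ne_zero (hd : IsTwistFamily d) {s t : Fin (n + 1)} (hts : t < s)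
    (a : Fin (n + 1) → ℤ) : twist d s t a ≠ 0 := by
  by_cases h : ∃ q : Fin n × Fin n × Vertex n m, q.1.succ = s ∧ q.2.1.succ = t ∧ occ q.2.2 = a
  · obtain ⟨⟨s, t, v⟩, rfl, rfl, rfl⟩ := h
    rw [twist_occ]
    exact hd.ne_zero s t v (Fin.succ_lt_succ_iff.1 hts)
  · rw [twist, dif_neg h]
    exact one_ne_zero

theorem twist_compatible (hd : IsTwistFamily d) {p : ℕ} (hm : m = p + 1) {t s u : Fin (n + 1)}
    (ht : t ≠ 0) (hts : t < s) (hsu : s < u) {b : Fin (n + 1) → ℤ} (h0 : IsConfig p b)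
    (hu : IsConfig p (b + disp {u})) (hus : IsConfig p (b + disp {u} + disp {s}))
    (hust : IsConfig p (b + disp {u} + disp {s} + disp {t})) :
    twist d u s (b + disp {t}) * twist d u t b * twist d s t (b + disp {u}) =
      twist d s t b * twist d u t (b + disp {s}) * twist d u s b := by
  have hs0 : s ≠ 0 := ((Fin.zero_le t).trans_lt hts).ne'
  have hs := isConfig_of_lt hs0 hsu h0 hu hus
  have hut := isConfig_of_lt ht hts hu hus hust
  have htu := hts.trans hsu
  have ht' := isConfig_of_lt ht htu h0 hu hut
  rw [add_right_comm b] at hus hust hut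
  have hst := isConfig_of_lt ht htu hs hus hust
  obtain ⟨t, rfl⟩ := Fin.exists_succ_eq.2 ht
  obtain ⟨s, rfl⟩ := Fin.exists_succ_eq.2 hs0
  obtain ⟨u, rfl⟩ := Fin.exists_succ_eq.2 ((Fin.zero_le _).trans_lt hsu).ne'
  obtain ⟨v, rfl⟩ := exists_occ_eq hm h0
  obtain ⟨vs, hvs⟩ := exists_occ_eq hm hs
  obtain ⟨vt, hvt⟩ := exists_occ_eq hm ht'
  obtain ⟨vu, hvu⟩ := exists_occ_eq hm hu
  obtain ⟨vsu, hvsu⟩ := exists_occ_eq hm hus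
  obtain ⟨vtu, hvtu⟩ := exists_occ_eq hm hut
  obtain ⟨vst, hvst⟩ := exists_occ_eq hm hst
  obtain ⟨vstu, hvstu⟩ := exists_occ_eq hm hust
  rw [← hvs, ← hvt, ← hvu]
  simp only [twist_occ]
  refine hd.compatible t s u (Fin.succ_lt_succ_iff.1 hts) (Fin.succ_lt_succ_iff.1 hsu)
    v vt vs vu vst vtu vsu vstu ?_ ?_ ?_ ?_ ?_ ?_ ?_ <;> rw [eq_step_iff]
  · exact hvt
  · exact hvs
  · exact hvu
  · rw [hvst, hvt, add_right_comm]
  · rw [hvtu, hvt]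
  · rw [hvsu, hvs]
  · rw [hvstu, hvst, add_right_comm]

variable (d) in
/-- The scalar by which the product of the ascending path from `a` with moves `T` and the move `t`
differs from the ascending path with moves `T ∪ {t}`. -/
noncomputable def sortFactor (a : Fin (n + 1) → ℤ) (T : Finset (Fin (n + 1)))
    (t : Fin (n + 1)) : k :=
  ∏ s ∈ T.filter (t < ·), (twist d s t (a + disp (T.filter (· < s))))⁻¹

theorem sortFactor_of_max {a : Fin (n + 1) → ℤ} {T : Finset (Fin (n + 1))} {t : Fin (n + 1)}
    (h : ∀ s ∈ T, s < t) : sortFactor d a T t = 1 := by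
  rw [sortFactor, Finset.filter_false_of_mem fun s hs => (h s hs).not_gt, Finset.prod_empty]

theorem sortFactor_insert_max {a : Fin (n + 1) → ℤ} {T : Finset (Fin (n + 1))} {t u : Fin (n + 1)}
    (h : ∀ s ∈ T, s < u) (htu : t < u) :
    sortFactor d a (insert u T) t = sortFactor d a T t * (twist d u t (a + disp T))⁻¹ := by
  have hu : u ∉ T := fun hu => lt_irrefl _ (h u hu)
  rw [sortFactor, Finset.filter_insert, if_pos htu, Finset.prod_insert (by simp [hu]), mul_comm]
  congr 1
  · refine Finset.prod_congr rfl fun s hs => ?_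
    rw [Finset.filter_insert, if_neg (h s (Finset.mem_filter.1 hs).1).not_gt]
  · rw [Finset.filter_insert, if_neg (lt_irrefl u), Finset.filter_true_of_mem h]

/-- The reordering factors are compatible with the commutation relations. -/
theorem sortFactor_comm (hd : IsTwistFamily d) {p : ℕ} (hm : m = p + 1) {t s : Fin (n + 1)}
    (ht : t ≠ 0) (hts : t < s) {a : Fin (n + 1) → ℤ} {T : Finset (Fin (n + 1))}
    (hsT : s ∉ T) (htT : t ∉ T)
    (hT : IsCube p {0}ᶜ a T) (hs : IsConfig p (a + disp T + disp {s}))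
    (hst : IsConfig p (a + disp T + disp {s} + disp {t})) :
    twist d s t (a + disp T) * (sortFactor d a T s * sortFactor d a (insert s T) t) =
      sortFactor d a T t * sortFactor d a (insert t T) s := by
  induction T using Finset.induction_on_max with
  | empty =>
    rw [sortFactor_of_max (t := s) (by simp), sortFactor_of_max (t := s) (by simpa using hts),
      sortFactor_insert_max (by simp) hts, one_mul, mul_one, mul_left_comm,
      mul_inv_cancel₀ (twist_ne_zero hd hts _), mul_one]
  | insert u T hu ih =>
    have hmem : ∀ {r}, r ∈ insert u T → r ≤ u := fun hr =>
      (Finset.mem_insert.1 hr).elim (fun h => h.le) fun h => (hu _ h).le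
    rcases lt_or_gt_of_ne (show u ≠ s by rintro rfl; simp at hsT) with hus | hsu
    · have h1 : ∀ r ∈ insert u T, r < s := fun r hr => (hmem hr).trans_lt hus
      rw [sortFactor_of_max (t := s) h1, sortFactor_insert_max h1 hts, sortFactor_of_max (t := s)]
      · rw [one_mul, mul_one, mul_left_comm, mul_inv_cancel₀ (twist_ne_zero hd hts _), mul_one]
      · intro r hr
        rcases Finset.mem_insert.1 hr with rfl | hr
        · exact hts
        · exact h1 r hr
    · have huT : u ∉ T := fun h => lt_irrefl _ (hu u h)
      have htu := hts.trans hsu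
      have hT' := hT.of_insert_max hu
      have hdisp : a + disp (insert u T) = a + disp T + disp {u} := by
        rw [Finset.insert_eq, Finset.union_comm, disp_union (by simpa using huT), add_assoc]
      have hcu := hT.2.2
      rw [hdisp] at hs hst hcu ⊢
      have hs0 : s ≠ 0 := ((Fin.zero_le t).trans_lt hts).ne'
      have hcs := isConfig_of_lt hs0 hsu hT'.2.2 hcu hs
      have hcst : IsConfig p (a + disp T + disp {s} + disp {t}) := by
        have h1 := hs
        have h2 := hst
        rw [add_right_comm (a + disp T)] at h1 h2
        exact isConfig_of_lt ht htu hcs h1 h2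
      have hins : ∀ r : Fin (n + 1), r < u → r ∉ T → ∀ q, q < u →
          sortFactor d a (insert r (insert u T)) q =
            sortFactor d a (insert r T) q * (twist d u q (a + disp T + disp {r}))⁻¹ := by
        intro r hr hrT q hq
        rw [Finset.insert_comm, sortFactor_insert_max _ hq]
        · rw [Finset.insert_eq r, Finset.union_comm, disp_union (by simpa using hrT), add_assoc]
        · intro j hj
          rcases Finset.mem_insert.1 hj with rfl | hj
          · exact hr
          · exact hu j hj
      have hs' : s ∉ T := fun h => hsT (Finset.mem_insert_of_mem h)
      have ht' : t ∉ T := fun h => htT (Finset.mem_insert_of_mem h)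
      have hih := ih hs' ht' hT' hcs hcst
      have hco := twist_compatible hd hm ht hts hsu hT'.2.2 hcu hs hst
      rw [sortFactor_insert_max hu hsu, sortFactor_insert_max hu htu, hins s hsu hs' t htu,
        hins t htu ht' s hsu]
      have n1 := twist_ne_zero hd hsu (a + disp T)
      have n2 := twist_ne_zero hd htu (a + disp T)
      have n3 := twist_ne_zero hd htu (a + disp T + disp {s})
      have n4 := twist_ne_zero hd hsu (a + disp T + disp {t})
      field_simp
      linear_combination (sortFactor d a T s * sortFactor d a (insert s T) t) * hco +
        (twist d u t (a + disp T + disp {s}) * twist d u s (a + disp T)) * hih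

end Twist

/-! ### The regular representation of the pyramid algebra -/

noncomputable section

section Regular

variable {k : Type u} [Field k] {n m : ℕ} (d : Fin n → Fin n → Vertex n m → k) (p : ℕ)

/-- The cubes of configurations that do not move particles from the last site to the first one. -/
abbrev LinearCube (n p : ℕ) : Type :=
  {c : (Fin (n + 1) → ℤ) × Finset (Fin (n + 1)) // IsCube p {0}ᶜ c.1 c.2}

open Classical in
/-- The value of a function on cubes, extended by zero. -/
def extendZero (G : LinearCube n p → k) (a : Fin (n + 1) → ℤ) (T : Finset (Fin (n + 1))) : k :=
  if h : IsCube p {0}ᶜ a T then G ⟨(a, T), h⟩ else 0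

open Classical in
/-- The action of the trivial paths and of the arrows on functions on cubes; a function `G` stands
for the sum of the ascending paths `c` with the coefficients `G c`. -/
def regularAction : Gen (Vertex n m) → Module.End k (LinearCube n p → k)
  | .vertex v =>
    { toFun := fun G c => if c.1.1 + disp c.1.2 = occ v then G c else 0
      map_add' := fun G H => by ext c; simp only [Pi.add_apply]; split_ifs <;> simp
      map_smul' := fun r G => by ext c; simp }
  | .arrow (i := v) f =>
    { toFun := fun G c => if f.1.succ ∈ c.1.2 ∧ c.1.1 + disp (c.1.2.erase f.1.succ) = occ v then
        sortFactor d c.1.1 (c.1.2.erase f.1.succ) f.1.succ *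
          extendZero p G c.1.1 (c.1.2.erase f.1.succ) else 0
      map_add' := fun G H => by
        ext c; simp only [Pi.add_apply, extendZero]; split_ifs <;> simp [mul_add]
      map_smul' := fun r G => by
        ext c
        simp only [Pi.smul_apply, extendZero, smul_eq_mul, RingHom.id_apply]
        split_ifs <;> simp [mul_left_comm] }

open Classical in
theorem regularAction_vertex (v : Vertex n m) (G : LinearCube n p → k) (c : LinearCube n p) :
    regularAction d p (.vertex v) G c = if c.1.1 + disp c.1.2 = occ v then G c else 0 := rfl

open Classical in
theorem regularAction_arrow {v w : Vertex n m} (f : v ⟶ w) (G : LinearCube n p → k)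
    (c : LinearCube n p) : regularAction d p (.arrow f) G c =
      if f.1.succ ∈ c.1.2 ∧ c.1.1 + disp (c.1.2.erase f.1.succ) = occ v then
        sortFactor d c.1.1 (c.1.2.erase f.1.succ) f.1.succ *
          extendZero p G c.1.1 (c.1.2.erase f.1.succ) else 0 := rfl

theorem add_disp_erase_add {a : Fin (n + 1) → ℤ} {T : Finset (Fin (n + 1))} {t : Fin (n + 1)}
    (ht : t ∈ T) : a + disp (T.erase t) + disp {t} = a + disp T := by
  rw [add_assoc, ← disp_union (by simp), Finset.union_comm, ← Finset.insert_eq,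
    Finset.insert_erase ht]

variable {p} (hn : 1 ≤ n) (hm : m = p + 1)

section

include hn hm

open Classical in
theorem extendZero_regularAction_arrow {v w : Vertex n m} (f : v ⟶ w) (G : LinearCube n p → k)
    {a : Fin (n + 1) → ℤ} (ha : IsConfig p a) {T : Finset (Fin (n + 1))} (hT : T ⊆ {0}ᶜ) :
    extendZero p (regularAction d p (.arrow f) G) a T =
      if f.1.succ ∈ T ∧ a + disp (T.erase f.1.succ) = occ v then
        sortFactor d a (T.erase f.1.succ) f.1.succ * extendZero p G a (T.erase f.1.succ)
      else 0 := by
  rw [extendZero]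
  split_ifs with h1 h2 h2
  · rw [regularAction_arrow, if_pos h2]
  · rw [regularAction_arrow, if_neg h2]
  · refine absurd ⟨hT, ha, ?_⟩ h1
    rw [← add_disp_erase_add h2.1, h2.2, ← (eq_step_iff v w f.1).1 f.2]
    exact isConfig_occ hn hm w
  · rfl

end

/-- The regular representation of the path algebra. -/
def regularPathRep : PathAlg k (Vertex n m) →ₐ[k] Module.End k (LinearCube n p → k) :=
  PathAlg.lift (regularAction d p)
    (fun v => by
      ext G c
      simp only [Module.End.mul_apply, regularAction_vertex]
      split_ifs <;> rfl)
    (fun v w hvw => by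
      ext G c
      simp only [Module.End.mul_apply, regularAction_vertex]
      split_ifs with h1 h2
      · exact absurd (occ_injective (h1.symm.trans h2)) hvw
      · rfl
      · rfl)
    (by
      classical
      ext G c
      rw [LinearMap.sum_apply, Finset.sum_apply]
      simp only [regularAction_vertex]
      obtain ⟨v, hv⟩ := exists_occ_eq hm c.2.2.2
      rw [Finset.sum_eq_single v]
      · rw [if_pos hv.symm]; rfl
      · intro w _ hw
        rw [if_neg]
        rw [← hv]
        exact fun h => hw (occ_injective h.symm)
      · simp)
    (fun {v w} f => by
      ext G c
      simp only [Module.End.mul_apply, regularAction_vertex, regularAction_arrow]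
      by_cases h : f.1.succ ∈ c.1.2 ∧ c.1.1 + disp (c.1.2.erase f.1.succ) = occ v
      · rw [if_pos h, if_pos]
        rw [(eq_step_iff v w f.1).1 f.2, ← h.2, add_disp_erase_add h.1]
      · rw [if_neg h, ite_self])
    (fun {v w} f => by
      ext G c
      simp only [Module.End.mul_apply, regularAction_arrow]
      by_cases h : f.1.succ ∈ c.1.2 ∧ c.1.1 + disp (c.1.2.erase f.1.succ) = occ v
      · rw [if_pos h, if_pos h, extendZero, extendZero]
        by_cases h1 : IsCube p {0}ᶜ c.1.1 (c.1.2.erase f.1.succ)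
        · rw [dif_pos h1, dif_pos h1, regularAction_vertex, if_pos h.2]
        · rw [dif_neg h1, dif_neg h1]
      · rw [if_neg h, if_neg h])

theorem regularPathRep_arrowElt {v w : Vertex n m} (f : v ⟶ w) :
    regularPathRep d hm (arrowElt k f) = regularAction d p (.arrow f) :=
  PathAlg.lift_mk _ _ _ _ _ _ _

theorem regularPathRep_vertexElt (v : Vertex n m) :
    regularPathRep d hm (vertexElt k v) = regularAction d p (.vertex v) :=
  PathAlg.lift_mk _ _ _ _ _ _ _

include hn in
theorem regularPathRep_eq_zero (hd : IsTwistFamily d) {r : PathAlg k (Vertex n m)}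
    (hr : r ∈ pyramidRel d) : regularPathRep d hm r = 0 := by
  rcases hr with ⟨t, s, i, x, y, z, hx, hy, hxz, hyz, hts, rfl⟩ | ⟨t, i, x, y, hx, hy, rfl⟩
  · suffices key : ∀ (f : i ⟶ x) (g : x ⟶ z) (f' : i ⟶ y) (g' : y ⟶ z),
        f.1 = s → g.1 = t → f'.1 = t → g'.1 = s →
        regularPathRep d hm (d s t i • (arrowElt k g * arrowElt k f) -
          arrowElt k g' * arrowElt k f') = 0 from
      key ⟨s, hx⟩ ⟨t, hxz⟩ ⟨t, hy⟩ ⟨s, hyz⟩ rfl rfl rfl rfl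
    intro f g f' g' hf hg hf' hg'
    rw [map_sub, map_smul, map_mul, map_mul, sub_eq_zero]
    simp only [regularPathRep_arrowElt]
    ext G c
    obtain ⟨⟨a, T⟩, hc⟩ := c
    have hx' := (eq_step_iff _ _ _).1 hx
    have hy' := (eq_step_iff _ _ _).1 hy
    have hxz' := (eq_step_iff _ _ _).1 hxz
    have hne : t.succ ≠ s.succ := fun h => hts.ne (Fin.succ_injective _ h)
    have herase : ∀ q, T.erase q ⊆ {0}ᶜ := fun q => (Finset.erase_subset _ _).trans hc.1
    simp only [LinearMap.smul_apply, Pi.smul_apply, Module.End.mul_apply, regularAction_arrow,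
      extendZero_regularAction_arrow d hn hm _ _ hc.2.1 (herase _), smul_eq_mul, hf, hg, hf',
      hg']
    by_cases hT : t.succ ∈ T ∧ s.succ ∈ T ∧
        a + disp ((T.erase t.succ).erase s.succ) = occ i
    · obtain ⟨htT, hsT, hi⟩ := hT
      have hs' : s.succ ∈ T.erase t.succ := Finset.mem_erase.2 ⟨hne.symm, hsT⟩
      have ht' : t.succ ∈ T.erase s.succ := Finset.mem_erase.2 ⟨hne, htT⟩
      have h1 : a + disp (T.erase t.succ) = occ x := by
        rw [hx', ← hi, add_disp_erase_add hs']
      have h2 : a + disp (T.erase s.succ) = occ y := by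
        rw [hy', ← hi, Finset.erase_right_comm, add_disp_erase_add ht']
      rw [if_pos ⟨htT, h1⟩, if_pos ⟨hs', hi⟩, if_pos ⟨hsT, h2⟩,
        if_pos ⟨ht', by rw [Finset.erase_right_comm, hi]⟩, Finset.erase_right_comm (a := s.succ)]
      set R := (T.erase t.succ).erase s.succ with hR
      have h3 : T.erase t.succ = insert s.succ R := (Finset.insert_erase hs').symm
      have h4 : T.erase s.succ = insert t.succ R := by
        rw [hR, Finset.erase_right_comm, Finset.insert_erase ht']
      have h5 : IsCube p {0}ᶜ a R := ⟨(Finset.erase_subset _ _).trans (herase _), hc.2.1, by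
        rw [hi]; exact isConfig_occ hn hm i⟩
      have h6 := sortFactor_comm hd hm (Fin.succ_ne_zero t) (Fin.succ_lt_succ_iff.2 hts)
        (Finset.notMem_erase _ _) (by simp) h5
        (by rw [hi, ← hx']; exact isConfig_occ hn hm x)
        (by rw [hi, ← hx', ← hxz']; exact isConfig_occ hn hm z)
      rw [hi, twist_occ] at h6
      rw [h3, h4]
      linear_combination (extendZero p G a R) * h6
    · have hl : ¬ ((t.succ ∈ T ∧ a + disp (T.erase t.succ) = occ x) ∧ s.succ ∈ T.erase t.succ ∧
          a + disp ((T.erase t.succ).erase s.succ) = occ i) := fun h =>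
        hT ⟨h.1.1, Finset.mem_of_mem_erase h.2.1, h.2.2⟩
      have hr : ¬ ((s.succ ∈ T ∧ a + disp (T.erase s.succ) = occ y) ∧ t.succ ∈ T.erase s.succ ∧
          a + disp ((T.erase s.succ).erase t.succ) = occ i) := fun h =>
        hT ⟨Finset.mem_of_mem_erase h.2.1, h.1.1, by rw [Finset.erase_right_comm]; exact h.2.2⟩
      have hite : ∀ {P Q : Prop} [Decidable P] [Decidable Q] (a b : k), ¬ (P ∧ Q) →
          (if P then a * (if Q then b else 0) else 0) = 0 := by
        intro P Q _ _ a b h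
        by_cases hP : P
        · rw [if_pos hP, if_neg fun hQ => h ⟨hP, hQ⟩, mul_zero]
        · rw [if_neg hP]
      rw [hite _ _ hl, hite _ _ hr, mul_zero]
  · suffices key : ∀ (f : i ⟶ x) (g : x ⟶ y), f.1 = t → g.1 = t →
        regularPathRep d hm (arrowElt k g * arrowElt k f) = 0 from key ⟨t, hx⟩ ⟨t, hy⟩ rfl rfl
    intro f g hf hg
    rw [map_mul]
    simp only [regularPathRep_arrowElt]
    ext G c
    obtain ⟨⟨a, T⟩, hc⟩ := c
    simp only [Module.End.mul_apply, regularAction_arrow,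
      extendZero_regularAction_arrow d hn hm _ _ hc.2.1 ((Finset.erase_subset _ _).trans hc.1),
      hf, hg]
    simp

/-- The regular representation of the pyramid algebra. -/
def regularRep (hd : IsTwistFamily d) :
    BoundAlg (pyramidRel d) →ₐ[k] Module.End k (LinearCube n p → k) :=
  BoundAlg.lift _ (regularPathRep d hm) fun _ hr => regularPathRep_eq_zero d hn hm hd hr

end Regular

end

/-! ### The cubical basis of the pyramid algebra -/

noncomputable section

section Pyramid

variable {k : Type u} [Field k] {n m : ℕ} (d : Fin n → Fin n → Vertex n m → k)

open Classical in
/-- The idempotent of the pyramid algebra at a configuration; zero if `a` is not a configuration. -/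
def idemAt (a : Fin (n + 1) → ℤ) : BoundAlg (pyramidRel d) :=
  if h : ∃ v : Vertex n m, occ v = a then idem _ h.choose else 0

open Classical in
/-- The image in the pyramid algebra of the arrow that makes the move `t` at a configuration; zero
if there is no such arrow. -/
def moveAt (a : Fin (n + 1) → ℤ) (t : Fin (n + 1)) : BoundAlg (pyramidRel d) :=
  if h : ∃ q : (v : Vertex n m) × (w : Vertex n m) × (v ⟶ w), occ q.1 = a ∧ q.2.2.1.succ = t then
    proj _ (arrowElt k h.choose.2.2) else 0

theorem idemAt_occ (v : Vertex n m) : idemAt d (occ v) = idem _ v := by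
  have h : ∃ w : Vertex n m, occ w = occ v := ⟨v, rfl⟩
  rw [idemAt, dif_pos h, occ_injective h.choose_spec]

theorem moveAt_occ {v w : Vertex n m} (f : v ⟶ w) :
    moveAt d (occ v) f.1.succ = proj _ (arrowElt k f) := by
  have h : ∃ q : (v : Vertex n m) × (w : Vertex n m) × (v ⟶ w),
      occ q.1 = occ v ∧ q.2.2.1.succ = f.1.succ := ⟨⟨v, w, f⟩, rfl, rfl⟩
  rw [moveAt, dif_pos h]
  obtain ⟨h1, h2⟩ := h.choose_spec
  generalize h.choose = q at h1 h2
  obtain ⟨v', w', f'⟩ := q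
  obtain rfl := occ_injective h1
  have h3 := Fin.succ_injective _ h2
  obtain rfl : w' = w := by
    apply Subtype.ext
    rw [f'.2, f.2, h3]
  obtain rfl : f' = f := Subtype.ext h3
  rfl

/-- A nonzero move is the image of an arrow. -/
theorem exists_of_moveAt_ne_zero {a : Fin (n + 1) → ℤ} {t : Fin (n + 1)} (h : moveAt d a t ≠ 0) :
    ∃ (v w : Vertex n m) (f : v ⟶ w), occ v = a ∧ occ w = a + disp {t} ∧ f.1.succ = t := by
  rw [moveAt] at h
  split_ifs at h with h1
  · obtain ⟨⟨v, w, f⟩, rfl, rfl⟩ := h1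
    exact ⟨v, w, f, rfl, (eq_step_iff v w f.1).1 f.2, rfl⟩
  · exact absurd rfl h

theorem idemAt_mul_moveAt (a : Fin (n + 1) → ℤ) (t : Fin (n + 1)) :
    idemAt d (a + disp {t}) * moveAt d a t = moveAt d a t := by
  by_cases h : moveAt d a t = 0
  · rw [h, mul_zero]
  · obtain ⟨v, w, f, rfl, hw, rfl⟩ := exists_of_moveAt_ne_zero d h
    rw [← hw, idemAt_occ, moveAt_occ, idem, ← map_mul, vertexElt_mul_arrowElt]

theorem moveAt_mul_idemAt (a : Fin (n + 1) → ℤ) (t : Fin (n + 1)) :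
    moveAt d a t * idemAt d a = moveAt d a t := by
  by_cases h : moveAt d a t = 0
  · rw [h, zero_mul]
  · obtain ⟨v, w, f, rfl, hw, rfl⟩ := exists_of_moveAt_ne_zero d h
    rw [idemAt_occ, moveAt_occ, idem, ← map_mul, arrowElt_mul_vertexElt]

theorem idemAt_mul_self (a : Fin (n + 1) → ℤ) : idemAt d a * idemAt d a = idemAt d a := by
  by_cases h : ∃ v : Vertex n m, occ v = a
  · obtain ⟨v, rfl⟩ := h
    rw [idemAt_occ, idem, ← map_mul, vertexElt_mul_self]
  · rw [idemAt, dif_neg h, mul_zero]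

theorem idemAt_mul_of_ne {a b : Fin (n + 1) → ℤ} (hab : b ≠ a) :
    idemAt d b * idemAt d a = 0 := by
  by_cases h : ∃ v : Vertex n m, occ v = a
  · obtain ⟨v, rfl⟩ := h
    by_cases h' : ∃ w : Vertex n m, occ w = b
    · obtain ⟨w, rfl⟩ := h'
      rw [idemAt_occ, idemAt_occ, idem, idem, ← map_mul,
        vertexElt_mul_of_ne fun h => hab (by rw [h]), map_zero]
    · rw [idemAt, dif_neg h', zero_mul]
  · rw [show idemAt d a = 0 from dif_neg h, mul_zero]

theorem moveAt_mul_moveAt_self (a : Fin (n + 1) → ℤ) (t : Fin (n + 1)) :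
    moveAt d (a + disp {t}) t * moveAt d a t = 0 := by
  by_cases h : moveAt d a t = 0
  · rw [h, mul_zero]
  by_cases h' : moveAt d (a + disp {t}) t = 0
  · rw [h', zero_mul]
  obtain ⟨v, w, f, rfl, hw, rfl⟩ := exists_of_moveAt_ne_zero d h
  obtain ⟨w', z, g, hw', -, hg⟩ := exists_of_moveAt_ne_zero d h'
  obtain rfl : w' = w := occ_injective (hw'.trans hw.symm)
  have h1 := moveAt_occ d g
  rw [hg, hw'] at h1
  rw [h1, moveAt_occ, ← map_mul]
  refine proj_eq_zero_of_mem _ (Or.inr ⟨f.1, v, w', z, f.2, ?_, ?_⟩)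
  · rw [g.2, Fin.succ_injective _ hg]
  · congr 2
    exact Subtype.ext (Fin.succ_injective _ hg)

variable {p : ℕ} {a : Fin (n + 1) → ℤ}

theorem twist_smul_moveAt (hm : m = p + 1) {t s : Fin (n + 1)} (ht : t ≠ 0) (hts : t < s)
    (ha : IsConfig p a) (hs : IsConfig p (a + disp {s}))
    (hst : IsConfig p (a + disp {s} + disp {t})) :
    twist d s t a • (moveAt d (a + disp {s}) t * moveAt d a s) =
      moveAt d (a + disp {t}) s * moveAt d a t := by
  have hat := isConfig_of_lt ht hts ha hs hst
  have hs0 : s ≠ 0 := ((Fin.zero_le t).trans_lt hts).ne'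
  obtain ⟨t, rfl⟩ := Fin.exists_succ_eq.2 ht
  obtain ⟨s, rfl⟩ := Fin.exists_succ_eq.2 hs0
  obtain ⟨v, rfl⟩ := exists_occ_eq hm ha
  obtain ⟨vs, hvs⟩ := exists_occ_eq hm hs
  obtain ⟨vt, hvt⟩ := exists_occ_eq hm hat
  obtain ⟨vst, hvst⟩ := exists_occ_eq hm hst
  rw [← hvs, ← hvt, twist_occ]
  have h1 : vs.1 = step s v.1 := (eq_step_iff _ _ _).2 hvs
  have h2 : vt.1 = step t v.1 := (eq_step_iff _ _ _).2 hvt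
  have h3 : vst.1 = step t vs.1 := (eq_step_iff _ _ _).2 (by rw [hvst, hvs])
  have h4 : vst.1 = step s vt.1 := (eq_step_iff _ _ _).2 (by rw [hvst, hvt, add_right_comm])
  have e1 := moveAt_occ d (show v ⟶ vs from ⟨s, h1⟩)
  have e2 := moveAt_occ d (show v ⟶ vt from ⟨t, h2⟩)
  have e3 := moveAt_occ d (show vs ⟶ vst from ⟨t, h3⟩)
  have e4 := moveAt_occ d (show vt ⟶ vst from ⟨s, h4⟩)
  have key := proj_eq_zero_of_mem (pyramidRel d)
    (Or.inl ⟨t, s, v, vs, vt, vst, h1, h2, h3, h4, Fin.succ_lt_succ_iff.1 hts, rfl⟩)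
  rw [map_sub, map_smul, map_mul, map_mul, ← e1, ← e2, ← e3, ← e4, sub_eq_zero] at key
  exact key

/-- The product of the moves in a list, the last one in the list being made first. -/
def moveList (a : Fin (n + 1) → ℤ) : List (Fin (n + 1)) → BoundAlg (pyramidRel d)
  | [] => idemAt d a
  | t :: l => moveAt d (a + disp l.toFinset) t * moveList a l

variable (p) in
open Classical in
/-- The ascending path that starts at the configuration `a` and makes the moves in `T`. -/
def ascending (a : Fin (n + 1) → ℤ) (T : Finset (Fin (n + 1))) : BoundAlg (pyramidRel d) :=
  if IsCube p {0}ᶜ a T then moveList d a (T.sort (· ≥ ·)) else 0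

theorem ascending_empty (ha : IsConfig p a) : ascending d p a ∅ = idemAt d a := by
  rw [ascending, if_pos (isCube_empty.2 ha)]
  simp [moveList]

theorem ascending_insert_max {u : Fin (n + 1)} {T : Finset (Fin (n + 1))} (hu : ∀ s ∈ T, s < u)
    (h : IsCube p {0}ᶜ a (insert u T)) :
    ascending d p a (insert u T) = moveAt d (a + disp T) u * ascending d p a T := by
  rw [ascending, if_pos h, ascending, if_pos (h.of_insert_max hu),
    Finset.sort_insert _ (fun s hs => (hu s hs).le) fun h => lt_irrefl _ (hu u h), moveList,
    Finset.sort_toFinset]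

theorem add_disp_insert {u : Fin (n + 1)} {T : Finset (Fin (n + 1))} (h : u ∉ T) :
    a + disp (insert u T) = a + disp T + disp {u} := by
  rw [Finset.insert_eq, Finset.union_comm, disp_union (by simpa using h), add_assoc]

theorem idemAt_mul_ascending (T : Finset (Fin (n + 1))) :
    idemAt d (a + disp T) * ascending d p a T = ascending d p a T := by
  by_cases h : IsCube p {0}ᶜ a T
  · induction T using Finset.induction_on_max with
    | empty => rw [ascending_empty d h.2.1, disp_empty, add_zero, idemAt_mul_self]
    | insert u T hu _ =>
      rw [ascending_insert_max d hu h, add_disp_insert fun h => lt_irrefl _ (hu u h), ← mul_assoc,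
        idemAt_mul_moveAt]
  · rw [ascending, if_neg h, mul_zero]

theorem ascending_mul_idemAt (T : Finset (Fin (n + 1))) :
    ascending d p a T * idemAt d a = ascending d p a T := by
  by_cases h : IsCube p {0}ᶜ a T
  · induction T using Finset.induction_on_max with
    | empty => rw [ascending_empty d h.2.1, idemAt_mul_self]
    | insert u T hu ih =>
      rw [ascending_insert_max d hu h, mul_assoc, ih (h.of_insert_max hu)]
  · rw [ascending, if_neg h, zero_mul]

variable {d}

/-- A further move after an ascending path is sorted in by means of the commutation relations. -/
theorem exists_moveAt_mul_ascending (hd : IsTwistFamily d) (hm : m = p + 1) {t : Fin (n + 1)}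
    (ht : t ≠ 0) {T : Finset (Fin (n + 1))} (hT : IsCube p {0}ᶜ a T)
    (h : IsConfig p (a + disp T + disp {t})) :
    ∃ c : k, (c ≠ 0 ↔ t ∉ T) ∧
      moveAt d (a + disp T) t * ascending d p a T = c • ascending d p a (insert t T) := by
  have hlast : ∀ {T : Finset (Fin (n + 1))}, IsCube p {0}ᶜ a T →
      IsConfig p (a + disp T + disp {t}) → (∀ s ∈ T, s < t) → ∃ c : k, (c ≠ 0 ↔ t ∉ T) ∧
      moveAt d (a + disp T) t * ascending d p a T = c • ascending d p a (insert t T) := by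
    intro T hT h htT
    have h1 : t ∉ T := fun h => lt_irrefl _ (htT t h)
    refine ⟨1, by simpa using h1, ?_⟩
    rw [one_smul, ascending_insert_max d htT]
    refine ⟨Finset.insert_subset (by simpa using ht) hT.1, hT.2.1, ?_⟩
    rwa [add_disp_insert h1]
  induction T using Finset.induction_on_max with
  | empty => exact hlast hT h (by simp)
  | insert u T hu ih =>
    have huT : u ∉ T := fun h => lt_irrefl _ (hu u h)
    rcases lt_trichotomy t u with htu | rfl | hut
    · have hT' := hT.of_insert_max hu
      have hcu := hT.2.2
      rw [add_disp_insert huT] at h hcu ⊢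
      have hct := isConfig_of_lt ht htu hT'.2.2 hcu h
      obtain ⟨c, hc, h1⟩ := ih hT' hct
      have hrel := twist_smul_moveAt d hm ht htu hT'.2.2 hcu h
      have h0 := twist_ne_zero hd htu (a + disp T)
      have h2 : moveAt d (a + disp T + disp {u}) t * moveAt d (a + disp T) u =
          (twist d u t (a + disp T))⁻¹ •
            (moveAt d (a + disp T + disp {t}) u * moveAt d (a + disp T) t) := by
        rw [← hrel, smul_smul, inv_mul_cancel₀ h0, one_smul]
      by_cases htT : t ∈ T
      · refine ⟨0, by simp [htT], ?_⟩
        have hc0 : c = 0 := by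
          by_contra h3
          exact hc.1 h3 htT
        rw [ascending_insert_max d hu hT, ← mul_assoc, h2, smul_mul_assoc, mul_assoc, h1, hc0]
        simp
      · refine ⟨(twist d u t (a + disp T))⁻¹ * c, ?_, ?_⟩
        · simp [h0, hc, htT, htu.ne]
        · have h3 : ∀ s ∈ insert t T, s < u := fun s hs =>
            (Finset.mem_insert.1 hs).elim (fun h => h ▸ htu) (hu s)
          have h4 : IsCube p {0}ᶜ a (insert u (insert t T)) := by
            refine ⟨?_, hT.2.1, ?_⟩
            · rw [Finset.insert_comm]
              exact Finset.insert_subset (by simpa using ht) hT.1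
            · rwa [add_disp_insert fun h => lt_irrefl _ (h3 u h), add_disp_insert htT,
                add_right_comm]
          rw [ascending_insert_max d hu hT, ← mul_assoc, h2, smul_mul_assoc, mul_assoc, h1,
            Finset.insert_comm, ascending_insert_max d h3 h4, add_disp_insert htT, mul_smul_comm,
            smul_smul]
    · refine ⟨0, by simp, ?_⟩
      rw [ascending_insert_max d hu hT, add_disp_insert huT, ← mul_assoc, moveAt_mul_moveAt_self,
        zero_mul, zero_smul]
    · refine hlast hT h fun s hs => ?_
      exact (Finset.mem_insert.1 hs).elim (fun h => h ▸ hut) fun h => (hu s h).trans hut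

/-- The product of two composable ascending paths. -/
theorem exists_ascending_mul_ascending (hd : IsTwistFamily d) (hm : m = p + 1)
    {S T : Finset (Fin (n + 1))} (hT : IsCube p {0}ᶜ a T) (hS : IsCube p {0}ᶜ (a + disp T) S) :
    ∃ c : k, (c ≠ 0 ↔ Disjoint T S) ∧
      ascending d p (a + disp T) S * ascending d p a T = c • ascending d p a (T ∪ S) := by
  induction S using Finset.induction_on_max with
  | empty =>
    refine ⟨1, by simp, ?_⟩
    rw [ascending_empty d hT.2.2, idemAt_mul_ascending, Finset.union_empty, one_smul]
  | insert u S hu ih =>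
    have huS : u ∉ S := fun h => lt_irrefl _ (hu u h)
    have hu0 : u ≠ 0 := by simpa using hS.1 (Finset.mem_insert_self _ _)
    have hS' := hS.of_insert_max hu
    obtain ⟨c, hc, h1⟩ := ih hS'
    rw [ascending_insert_max d hu hS, mul_assoc, h1]
    by_cases hTS : Disjoint T S
    · have hcu := hS.2.2
      rw [add_disp_insert huS, add_assoc a, ← disp_union hTS] at hcu
      obtain ⟨c', hc', h2⟩ := exists_moveAt_mul_ascending hd hm hu0 (hT.union hS' hTS) hcu
      refine ⟨c * c', ?_, ?_⟩
      · rw [mul_ne_zero_iff, hc, hc', Finset.disjoint_insert_right]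
        simp [hTS, huS]
      · rw [mul_smul_comm, add_assoc, ← disp_union hTS, h2, smul_smul, Finset.union_insert]
    · refine ⟨0, ?_, ?_⟩
      · simp [Finset.disjoint_insert_right, hTS]
      · have hc0 : c = 0 := by
          by_contra h3
          exact hTS (hc.1 h3)
        rw [hc0]
        simp

variable (k) in
open Classical in
/-- The function on cubes that is `1` at the vertices and zero elsewhere. -/
def vertexFunction (n p : ℕ) : LinearCube n p → k := fun c => if c.1.2 = ∅ then 1 else 0

open Classical in
/-- In the regular representation, the ascending path with moves `T` sends the sum of the vertices
to the cube `(a, T)`. -/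
theorem regularRep_ascending (hn : 1 ≤ n) (hm : m = p + 1) (hd : IsTwistFamily d)
    {T : Finset (Fin (n + 1))} (hT : IsCube p {0}ᶜ a T) (c : LinearCube n p) :
    regularRep d hn hm hd (ascending d p a T) (vertexFunction k n p) c =
      if c.1 = (a, T) then 1 else 0 := by
  induction T using Finset.induction_on_max generalizing c with
  | empty =>
    obtain ⟨v, hv⟩ := exists_occ_eq hm hT.2.1
    rw [ascending_empty d hT.2.1, ← hv, idemAt_occ, idem, regularRep, BoundAlg.lift_proj,
      regularPathRep_vertexElt, regularAction_vertex, vertexFunction]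
    obtain ⟨⟨b, S⟩, hc⟩ := c
    by_cases hS : S = ∅
    · subst hS
      simp
    · simp [hS]
  | insert u T hu ih =>
    have huT : u ∉ T := fun h => lt_irrefl _ (hu u h)
    have hT' := hT.of_insert_max hu
    have hu0 : u ≠ 0 := by simpa using hT.1 (Finset.mem_insert_self _ _)
    obtain ⟨v, hv⟩ := exists_occ_eq hm hT'.2.2
    obtain ⟨w, hw⟩ := exists_occ_eq hm hT.2.2
    rw [add_disp_insert huT, ← hv] at hw
    obtain ⟨u, rfl⟩ := Fin.exists_succ_eq.2 hu0
    obtain ⟨f, hf⟩ : ∃ f : v ⟶ w, f.1 = u := ⟨⟨u, (eq_step_iff _ _ _).2 hw⟩, rfl⟩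
    have h1 : regularRep d hn hm hd (moveAt d (a + disp T) u.succ) =
        regularAction d p (.arrow f) := by
      rw [← hv, ← hf, moveAt_occ, regularRep, BoundAlg.lift_proj, regularPathRep_arrowElt]
    rw [ascending_insert_max d hu hT, map_mul, Module.End.mul_apply, h1, regularAction_arrow, hf,
      hv]
    obtain ⟨⟨b, S⟩, hc⟩ := c
    simp only [Prod.mk.injEq]
    by_cases hS : b = a ∧ S = insert u.succ T
    · obtain ⟨rfl, rfl⟩ := hS
      rw [Finset.erase_insert huT, extendZero, dif_pos hT', ih hT', sortFactor_of_max hu]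
      simp
    · rw [if_neg hS]
      split_ifs with h2
      · rw [extendZero]
        split_ifs with h3
        · rw [ih hT', if_neg, mul_zero]
          intro h4
          simp only [Prod.mk.injEq] at h4
          exact hS ⟨h4.1, by rw [← h4.2, Finset.insert_erase h2.1]⟩
        · rw [mul_zero]
      · rfl

/-- The ascending paths are linearly independent. -/
theorem linearIndependent_ascending (hn : 1 ≤ n) (hm : m = p + 1) (hd : IsTwistFamily d) :
    LinearIndependent k fun c : LinearCube n p => ascending d p c.1.1 c.1.2 := by
  classical
  refine LinearIndependent.of_comp ((LinearMap.applyₗ (vertexFunction k n p)).comp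
    (regularRep d hn hm hd).toLinearMap) ?_
  have h : (⇑((LinearMap.applyₗ (vertexFunction k n p)).comp (regularRep d hn hm hd).toLinearMap) ∘
      fun c : LinearCube n p => ascending d p c.1.1 c.1.2) = fun c => Pi.single c 1 := by
    funext c c'
    have h1 := regularRep_ascending hn hm hd c.2 c'
    refine h1.trans ?_
    rw [Pi.single_apply]
    congr 1
    exact propext Subtype.ext_iff.symm
  rw [h]
  exact Pi.linearIndependent_single_one _ _

/-- A path is a multiple of an ascending path. -/
theorem img_eq_zero_or_eq_smul_ascending (hn : 1 ≤ n) (hm : m = p + 1) (hd : IsTwistFamily d)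
    {i j : Vertex n m} (q : Quiver.Path i j) : img (pyramidRel d) q = 0 ∨
      ∃ (c : k) (T : Finset (Fin (n + 1))), IsCube p {0}ᶜ (occ i) T ∧ occ j = occ i + disp T ∧
        img (pyramidRel d) q = c • ascending d p (occ i) T := by
  induction q with
  | nil =>
    refine Or.inr ⟨1, ∅, isCube_empty.2 (isConfig_occ hn hm i), by simp, ?_⟩
    rw [img_nil, ascending_empty d (isConfig_occ hn hm i), idemAt_occ, one_smul]
  | cons q f ih =>
    rename_i j l
    rcases ih with h | ⟨c, T, hT, hj, h⟩
    · exact Or.inl (by rw [img_cons, h, mul_zero])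
    · have hl := (eq_step_iff _ _ _).1 f.2
      rw [hj] at hl
      obtain ⟨c', hc', h1⟩ := exists_moveAt_mul_ascending hd hm (Fin.succ_ne_zero f.1) hT
        (by rw [← hl]; exact isConfig_occ hn hm l)
      have h2 : img (pyramidRel d) (q.cons f) =
          (c * c') • ascending d p (occ i) (insert f.1.succ T) := by
        rw [img_cons, h, ← moveAt_occ, hj, mul_smul_comm, h1, smul_smul]
      by_cases hf : f.1.succ ∈ T
      · left
        have hc0 : c' = 0 := by
          by_contra h3
          exact hc'.1 h3 hf
        rw [h2, hc0, mul_zero, zero_smul]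
      · rw [← add_disp_insert hf] at hl
        refine Or.inr ⟨c * c', _, ⟨?_, hT.2.1, ?_⟩, hl, h2⟩
        · exact Finset.insert_subset (by simp) hT.1
        · rw [← hl]
          exact isConfig_occ hn hm l

/-- The ascending paths form a cubical basis of the pyramid algebra. -/
def pyramidBasis (hn : 1 ≤ n) (hm : m = p + 1) (hd : IsTwistFamily d) :
    CubicalBasis k (BoundAlg (pyramidRel d)) n p {0}ᶜ where
  x := ascending d p
  eq_zero a T h := if_neg h
  indep := linearIndependent_ascending hn hm hd
  span_eq_top := by
    rw [eq_top_iff, ← span_img_eq_top]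
    refine Submodule.span_le.2 ?_
    rintro _ ⟨i, j, q, rfl⟩
    rcases img_eq_zero_or_eq_smul_ascending hn hm hd q with h | ⟨c, T, -, -, h⟩
    · rw [h]
      exact Submodule.zero_mem _
    · rw [h]
      exact Submodule.smul_mem _ _ (Submodule.subset_span ⟨_, _, rfl⟩)
  mul_of_ne a b S T h := by
    rw [← ascending_mul_idemAt d S, ← idemAt_mul_ascending d T, mul_assoc, ← mul_assoc (idemAt d b),
      idemAt_mul_of_ne d h, zero_mul, mul_zero]
  mul_of_not_disjoint a S T h := by
    by_cases hT : IsCube p {0}ᶜ a T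
    · by_cases hS : IsCube p {0}ᶜ (a + disp T) S
      · obtain ⟨c, hc, h1⟩ := exists_ascending_mul_ascending hd hm hT hS
        have hc0 : c = 0 := by
          by_contra h3
          exact h (hc.1 h3)
        rw [h1, hc0, zero_smul]
      · rw [ascending, if_neg hS, zero_mul]
    · rw [show ascending d p a T = 0 from if_neg hT, mul_zero]
  mul_of_disjoint a S T hT hS h := by
    obtain ⟨c, hc, h1⟩ := exists_ascending_mul_ascending hd hm hT hS
    exact ⟨c, hc.2 h, h1⟩
  idem_mul a T := by
    by_cases hT : IsCube p {0}ᶜ a T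
    · rw [ascending_empty d hT.2.2, idemAt_mul_ascending]
    · rw [show ascending d p a T = 0 from if_neg hT, mul_zero]
  mul_idem a T := by
    by_cases hT : IsCube p {0}ᶜ a T
    · rw [ascending_empty d hT.2.1, ascending_mul_idemAt]
    · rw [show ascending d p a T = 0 from if_neg hT, zero_mul]

theorem realizes_pyramidBasis (hn : 1 ≤ n) (hm : m = p + 1) (hd : IsTwistFamily d) :
    Realizes (pyramidBasis hn hm hd) occ where
  injective := occ_injective
  isConfig := isConfig_occ hn hm
  surjective a ha := exists_occ_eq hm ha
  idem v := ((ascending_empty d (isConfig_occ hn hm v)).trans (idemAt_occ d v)).symm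
  arrow := by
    intro i j f
    have h1 := (eq_step_iff _ _ _).1 f.2
    refine ⟨f.1.succ, by simp, h1, 1, one_ne_zero, ?_⟩
    have h2 : IsCube p {0}ᶜ (occ i) (insert f.1.succ ∅) := by
      refine ⟨by simp [(Fin.succ_ne_zero f.1).symm], isConfig_occ hn hm i, ?_⟩
      rw [LawfulSingleton.insert_empty_eq, ← h1]
      exact isConfig_occ hn hm j
    have h3 := ascending_insert_max d (by simp) h2
    rw [ascending_empty d (isConfig_occ hn hm i), disp_empty, add_zero, moveAt_mul_idemAt,
      moveAt_occ] at h3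
    rw [one_smul, ← h3]
    rfl
  exists_arrow := by
    intro i j t ht h
    obtain ⟨t, rfl⟩ := Fin.exists_succ_eq.2 (show t ≠ 0 by simpa using ht)
    exact ⟨⟨t, (eq_step_iff _ _ _).2 h⟩⟩

end Pyramid

end

/-! ### Presenting an algebra with a cubical basis by a bound quiver -/

noncomputable section

section Presentation

/-- The configurations of `p` particles on `n + 1` cyclically ordered sites, as the vertices of a
quiver. -/
@[ext]
structure Config (n p : ℕ) : Type where
  val : Fin (n + 1) → ℤ
  isConfig : IsConfig p val

theorem finite_config (n p : ℕ) : Finite (Config n p) := by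
  have h : {a : Fin (n + 1) → ℤ | IsConfig p a}.Finite := by
    apply Set.Finite.subset (Set.finite_Icc (fun _ : Fin (n + 1) => (0 : ℤ)) (fun _ => (p : ℤ)))
    rintro a ha
    refine ⟨fun j => ha.1 j, fun j => ?_⟩
    rw [← ha.2]
    exact Finset.single_le_sum (fun i _ => ha.1 i) (Finset.mem_univ j)
  have := h.to_subtype
  exact Finite.of_injective (β := {a : Fin (n + 1) → ℤ | IsConfig p a})
    (fun a => ⟨a.val, a.isConfig⟩) fun a b hab => Config.ext (congrArg Subtype.val hab)

instance (n p : ℕ) : Fintype (Config n p) :=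
  haveI := finite_config n p
  Fintype.ofFinite _

/-- There is one arrow for each move of a particle to the next site. -/
instance (n p : ℕ) : Quiver.{0} (Config n p) where
  Hom a b := {t : Fin (n + 1) // b.1 = a.1 + disp {t}}

variable {n p : ℕ}

/-- The site that is entered by the particle that moves. -/
def moveType {a b : Config n p} (f : a ⟶ b) : Fin (n + 1) := f.1

theorem eq_add_disp {a b : Config n p} (f : a ⟶ b) : b.val = a.val + disp {moveType f} := f.2

theorem subsingleton_hom (a b : Config n p) : Subsingleton (a ⟶ b) :=
  ⟨fun f g => Subtype.ext (Finset.singleton_injective (eq_of_disp_eq_of_card_eq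
    (add_left_cancel ((eq_add_disp f).symm.trans (eq_add_disp g))) rfl))⟩

/-- Paths of length at most one in the quiver of configurations are determined by their end points
and their length. -/
theorem path_eq_of_length_le_one {a b : Config n p} {q q' : Quiver.Path a b}
    (h : q.length = q'.length) (h1 : q.length ≤ 1) : q = q' := by
  cases q with
  | nil => exact (Quiver.Path.eq_nil_of_length_zero q' h.symm).symm
  | cons q f =>
    cases q' with
    | nil => simp at h
    | cons q' f' =>
      rename_i c c'
      rw [Quiver.Path.length_cons] at h1 h
      have h2 : q.length = 0 := by omega
      have h3 : q'.length = 0 := by rw [Quiver.Path.length_cons] at h; omega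
      obtain rfl := Quiver.Path.eq_of_length_zero q h2
      obtain rfl := Quiver.Path.eq_of_length_zero q' h3
      rw [Quiver.Path.eq_nil_of_length_zero q h2, Quiver.Path.eq_nil_of_length_zero q' h3,
        (subsingleton_hom _ _).elim f f']

variable {k : Type u} [Field k] {A : Type u} [Ring A] [Algebra k A]
  (C : CubicalBasis k A n p Finset.univ)

/-- The generators of the path algebra of configurations in an algebra with a cubical basis. -/
def configGen : Gen (Config n p) → A
  | .vertex a => C.x a.val ∅
  | .arrow (i := a) f => C.x a.val {moveType f}

theorem sum_x_empty : ∑ a : Config n p, C.x a.val ∅ = 1 := by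
  classical
  rw [← mul_one (∑ a : Config n p, C.x a.val ∅)]
  generalize (1 : A) = y
  induction y using C.induction with
  | hx b T h =>
    rw [Finset.sum_mul, Finset.sum_eq_single (⟨b + disp T, h.2.2⟩ : Config n p)]
    · exact C.idem_mul b T
    · intro a _ ha
      exact C.mul_of_ne _ _ _ _ fun h => ha (Config.ext h)
    · simp
  | h0 => rw [mul_zero]
  | hadd y z h1 h2 => rw [mul_add, h1, h2]
  | hsmul c y h => rw [mul_smul_comm, h]

/-- The path algebra of configurations maps to an algebra with a cubical basis. -/
def configMap : PathAlg k (Config n p) →ₐ[k] A :=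
  PathAlg.lift (configGen C)
    (fun a => C.mul_idem a.val ∅)
    (fun a b hab => C.mul_of_ne _ _ _ _ fun h => hab (Config.ext (by simpa using h)))
    (sum_x_empty C)
    (fun {a b} f => by
      have h := C.idem_mul a.val {moveType f}
      rw [← eq_add_disp f] at h
      exact h)
    (fun {a b} f => C.mul_idem a.val {moveType f})

theorem configMap_vertexElt (a : Config n p) : configMap C (vertexElt k a) = C.x a.val ∅ :=
  PathAlg.lift_mk _ _ _ _ _ _ _

theorem configMap_arrowElt {a b : Config n p} (f : a ⟶ b) :
    configMap C (arrowElt k f) = C.x a.val {moveType f} :=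
  PathAlg.lift_mk _ _ _ _ _ _ _

theorem isCube_of_hom {a b : Config n p} (f : a ⟶ b) : IsCube p Finset.univ a.val {moveType f} :=
  ⟨Finset.subset_univ _, a.isConfig, (eq_add_disp f) ▸ b.isConfig⟩

/-- A path is sent to zero or to a nonzero multiple of the basis element with the same moves. -/
theorem configMap_pathElt {a b : Config n p} (q : Quiver.Path a b) :
    configMap C (pathElt k q) = 0 ∨ ∃ (c : k) (T : Finset (Fin (n + 1))), c ≠ 0 ∧
      IsCube p Finset.univ a.val T ∧ T.card = q.length ∧ b.val = a.val + disp T ∧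
      configMap C (pathElt k q) = c • C.x a.val T := by
  induction q with
  | nil =>
    exact Or.inr ⟨1, ∅, one_ne_zero, isCube_empty.2 a.isConfig, rfl, by simp, by
      rw [pathElt, configMap_vertexElt, one_smul]⟩
  | cons q f ih =>
    rename_i b b'
    rw [pathElt, map_mul, configMap_arrowElt]
    rcases ih with h | ⟨c, T, hc, hT, hl, hb, h⟩
    · exact Or.inl (by rw [h, mul_zero])
    · have hf := isCube_of_hom f
      have hb' := eq_add_disp f
      rw [hb] at hf hb'
      rw [h, mul_smul_comm, hb, C.x_mul_x, smul_smul]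
      by_cases hd : Disjoint T {moveType f}
      · refine Or.inr ⟨_, _, mul_ne_zero hc (C.coeff_ne_zero hT hf hd), hT.union hf hd, ?_, ?_, rfl⟩
        · rw [Finset.card_union_of_disjoint hd, hl]
          rfl
        · rw [hb', disp_union hd, add_assoc]
      · exact Or.inl (by rw [C.coeff_of_not_disjoint hd, mul_zero, zero_smul])

/-- Every basis element is a multiple of the image of a path. -/
theorem exists_configMap_pathElt (hp : 1 ≤ p) {a : Config n p} {T : Finset (Fin (n + 1))}
    (hT : IsCube p Finset.univ a.val T) :
    ∃ (b : Config n p) (q : Quiver.Path a b) (c : k), b.val = a.val + disp T ∧ T.card = q.length ∧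
      configMap C (pathElt k q) = c • C.x a.val T ∧ c ≠ 0 := by
  induction hc : T.card generalizing T with
  | zero =>
    obtain rfl := Finset.card_eq_zero.1 hc
    exact ⟨a, Quiver.Path.nil, 1, by simp, rfl, by rw [pathElt, configMap_vertexElt, one_smul],
      one_ne_zero⟩
  | succ N ih =>
    obtain ⟨t, htT, ht⟩ := hT.exists_last hp (Finset.card_pos.1 (by omega))
    obtain ⟨b, q, c, hb, hl, hq, hc0⟩ := ih ht (by rw [Finset.card_erase_of_mem htT, hc]; rfl)
    have h1 : T.erase t ∪ {t} = T := by
      rw [Finset.union_comm, ← Finset.insert_eq, Finset.insert_erase htT]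
    have hd : Disjoint (T.erase t) {t} := by simp
    have h2 : a.val + disp T = b.val + disp {t} := by
      rw [hb, add_assoc, ← disp_union hd, h1]
    have hf : IsCube p Finset.univ (a.val + disp (T.erase t)) {t} :=
      ⟨Finset.subset_univ _, ht.2.2, by rw [← hb, ← h2]; exact hT.2.2⟩
    refine ⟨⟨a.val + disp T, hT.2.2⟩, q.cons (show b ⟶ ⟨a.val + disp T, hT.2.2⟩ from ⟨t, h2⟩),
      c * C.coeff a.val (T.erase t) {t}, rfl, ?_, ?_, mul_ne_zero hc0 (C.coeff_ne_zero ht hf hd)⟩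
    · exact congrArg (· + 1) hl
    · have h3 : moveType (show b ⟶ ⟨a.val + disp T, hT.2.2⟩ from ⟨t, h2⟩) = t := rfl
      rw [pathElt, map_mul, configMap_arrowElt, hq, mul_smul_comm, h3, hb, C.x_mul_x, h1, smul_smul]

/-- The linear combinations of parallel paths of one length `t ≥ 2` that vanish in `A`. No relations
among shorter paths are needed, because these are linearly independent in `A`. -/
def configRel : Set (PathAlg k (Config n p)) :=
  {r | configMap C r = 0 ∧ ∃ (i j : Config n p) (t : ℕ), 2 ≤ t ∧
    r ∈ Submodule.span k {x | ∃ q : Quiver.Path i j, q.length = t ∧ x = pathElt k q}}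

/-- Two parallel paths of one length with nonzero images in `A` are proportional modulo the
relations, and a path that vanishes in `A` vanishes modulo the relations. -/
theorem img_eq_smul_img {a b : Config n p} {q q' : Quiver.Path a b} (hl : q.length = q'.length)
    (c : k) (hc : configMap C (pathElt k q) = c • configMap C (pathElt k q'))
    (hq' : configMap C (pathElt k q') ≠ 0) :
    img (configRel C) q = c • img (configRel C) q' := by
  rcases Nat.lt_or_ge 1 q.length with h | h
  · have h1 : pathElt k q - c • pathElt k q' ∈ configRel C := by
      refine ⟨by rw [map_sub, map_smul, hc, sub_self], a, b, q.length, h, ?_⟩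
      exact Submodule.sub_mem _ (Submodule.subset_span ⟨q, rfl, rfl⟩)
        (Submodule.smul_mem _ _ (Submodule.subset_span ⟨q', hl.symm, rfl⟩))
    have h2 := proj_eq_zero_of_mem _ h1
    rw [map_sub, map_smul, sub_eq_zero] at h2
    exact h2
  · obtain rfl := path_eq_of_length_le_one hl h
    have h1 : (1 - c) • configMap C (pathElt k q) = 0 := by
      rw [sub_smul, one_smul, ← hc, sub_self]
    have h2 := (smul_eq_zero.1 h1).resolve_right hq'
    rw [← sub_eq_zero.1 h2, one_smul]

theorem img_eq_zero {a b : Config n p} {q : Quiver.Path a b}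
    (hq : configMap C (pathElt k q) = 0) : img (configRel C) q = 0 := by
  rcases Nat.lt_or_ge 1 q.length with h | h
  · exact proj_eq_zero_of_mem _ ⟨hq, a, b, q.length, h, Submodule.subset_span ⟨q, rfl, rfl⟩⟩
  · exfalso
    cases q with
    | nil =>
      rw [pathElt, configMap_vertexElt] at hq
      exact C.x_ne_zero (isCube_empty.2 a.isConfig) hq
    | cons q f =>
      rw [Quiver.Path.length_cons] at h
      have h2 : q.length = 0 := by omega
      obtain rfl := Quiver.Path.eq_of_length_zero q h2
      rw [Quiver.Path.eq_nil_of_length_zero q h2, pathElt, pathElt, arrowElt_mul_vertexElt,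
        configMap_arrowElt] at hq
      exact C.x_ne_zero (isCube_of_hom f) hq

/-- The algebra of the bound quiver of configurations maps to `A`. -/
def configHom : BoundAlg (configRel C) →ₐ[k] A := BoundAlg.lift _ (configMap C) fun _ h => h.1

theorem configHom_proj (r : PathAlg k (Config n p)) :
    configHom C (proj _ r) = configMap C r := rfl

theorem configHom_bijective (hp : 1 ≤ p) : Function.Bijective (configHom C) := by
  have hex : ∀ e : {c : (Fin (n + 1) → ℤ) × Finset (Fin (n + 1)) // IsCube p Finset.univ c.1 c.2},
      ∃ (b : Config n p) (q : Quiver.Path (⟨e.1.1, e.2.2.1⟩ : Config n p) b) (c : k),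
        b.val = e.1.1 + disp e.1.2 ∧ e.1.2.card = q.length ∧
        configMap C (pathElt k q) = c • C.x e.1.1 e.1.2 ∧ c ≠ 0 := fun e =>
    exists_configMap_pathElt C hp (a := ⟨e.1.1, e.2.2.1⟩) e.2
  choose b q c hb hl hq hc using hex
  -- the inverse sends a basis element to a multiple of a path with the same moves
  set s : A →ₗ[k] BoundAlg (configRel C) :=
    C.basis.constr k fun e => (c e)⁻¹ • img (configRel C) (q e) with hs
  have hsx : ∀ e, s (C.x e.1.1 e.1.2) = (c e)⁻¹ • img (configRel C) (q e) := by
    intro e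
    have h1 : C.x e.1.1 e.1.2 = C.basis e := by simp [CubicalBasis.basis]
    rw [h1, hs, Module.Basis.constr_basis]
  have hright : ∀ y, configHom C (s y) = y := by
    intro y
    induction y using C.induction with
    | hx a T h =>
      rw [hsx ⟨(a, T), h⟩, map_smul, img, configHom_proj, hq, smul_smul, inv_mul_cancel₀ (hc _),
        one_smul]
    | h0 => rw [map_zero, map_zero]
    | hadd y z h1 h2 => rw [map_add, map_add, h1, h2]
    | hsmul c y h => rw [map_smul, map_smul, h]
  have hleft : ∀ y, s (configHom C y) = y := by
    intro y
    have hy : y ∈ Submodule.span k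
        {x | ∃ (i j : Config n p) (q : Quiver.Path i j), x = img (configRel C) q} := by
      rw [span_img_eq_top]
      trivial
    induction hy using Submodule.span_induction with
    | mem y h =>
      obtain ⟨i, j, q', rfl⟩ := h
      rcases configMap_pathElt C q' with h | ⟨c', T, hc', hT, hl', hj, h⟩
      · rw [img_eq_zero C h, map_zero, map_zero]
      · set e : {c : (Fin (n + 1) → ℤ) × Finset (Fin (n + 1)) // IsCube p Finset.univ c.1 c.2} :=
          ⟨(i.val, T), hT⟩ with he
        obtain rfl : b e = j := Config.ext ((hb e).trans hj.symm)
        have h1 := img_eq_smul_img C (q := q') (q' := q e) (hl'.symm.trans (hl e)) (c' * (c e)⁻¹)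
          (by rw [hq, h, smul_smul, mul_assoc, inv_mul_cancel₀ (hc e), mul_one])
          (by rw [hq]; exact smul_ne_zero (hc e) (C.x_ne_zero hT))
        rw [img, configHom_proj, h, map_smul, hsx e, smul_smul, ← h1]
        rfl
    | zero => rw [map_zero, map_zero]
    | add y z _ _ h1 h2 => rw [map_add, map_add, h1, h2]
    | smul c y _ h => rw [map_smul, map_smul, h]
  exact ⟨Function.LeftInverse.injective hleft, Function.RightInverse.surjective hright⟩

/-- An algebra with a cubical basis for which all moves are allowed is the algebra of the bound
quiver of configurations. -/
def configEquiv (hp : 1 ≤ p) : A ≃ₐ[k] BoundAlg (configRel C) :=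
  (AlgEquiv.ofBijective (configHom C) (configHom_bijective C hp)).symm

theorem configEquiv_configMap (hp : 1 ≤ p) (r : PathAlg k (Config n p)) :
    configEquiv C hp (configMap C r) = proj _ r :=
  (AlgEquiv.ofBijective (configHom C) (configHom_bijective C hp)).symm_apply_apply (proj _ r)

theorem realizes_config (hp : 1 ≤ p) :
    Realizes (C.map (configEquiv C hp)) (fun a : Config n p => a.val) where
  injective := fun _ _ => Config.ext
  isConfig a := a.isConfig
  surjective a ha := ⟨⟨a, ha⟩, rfl⟩
  idem a := by
    rw [idem, ← configEquiv_configMap C hp, configMap_vertexElt]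
    rfl
  arrow {i j} f := ⟨moveType f, Finset.mem_univ _, eq_add_disp f, 1, one_ne_zero, by
    rw [one_smul, ← configEquiv_configMap C hp, configMap_arrowElt]
    rfl⟩
  exists_arrow i j t _ h := ⟨⟨t, h⟩⟩

include C in
/-- An algebra with a cubical basis for which all moves are allowed is a translation algebra; the
translation is the identity. -/
theorem CubicalBasis.isTranslationAlgebra (hp : 1 ≤ p) : IsTranslationAlgebra k n A := by
  have h := realizes_config C hp
  have hcard : (Finset.univ : Finset (Fin (n + 1))).card = n + 1 := by simp
  refine ⟨Config n p, inferInstance, inferInstance, configRel C, fun r hr => hr.2,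
    ⟨configEquiv C hp⟩, ⟨∅, ∅, Equiv.refl _, ?_⟩, p, by exact_mod_cast hp, ?_⟩
  · exact h.isTranslationQuiver (fun _ _ => Finset.mem_univ _) hp hcard
      (fun i => by rw [disp_univ, add_zero]; rfl) fun _ _ _ h => h
  · have := h.isKoszulOfType_univ hp rfl
    rwa [hcard] at this

end Presentation

end

/-! ### The cubical basis of a trivial extension -/

noncomputable section

section TrivialExtension

variable {k : Type u} [Field k] {A : Type u} [Ring A] [Algebra k A] {n p : ℕ}

theorem isCube_univ_iff {a : Fin (n + 1) → ℤ} {T : Finset (Fin (n + 1))} (h : 0 ∉ T) :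
    IsCube p Finset.univ a T ↔ IsCube p {0}ᶜ a T := by
  have h1 : T ⊆ {0}ᶜ := by rw [Finset.subset_compl_comm]; simpa using h
  simp [IsCube, h1]

theorem isCube_univ_iff_compl {a : Fin (n + 1) → ℤ} {T : Finset (Fin (n + 1))} (h : 0 ∈ T) :
    IsCube p Finset.univ a T ↔ IsCube p {0}ᶜ (a + disp T) Tᶜ := by
  simp [IsCube, h, add_assoc, disp_compl, and_comm]

namespace CubicalBasis

section Coord

variable {D : Finset (Fin (n + 1))} (C : CubicalBasis k A n p D)

theorem coord_mul_x_of_ne {v b : Fin (n + 1) → ℤ} (h : b ≠ v) (S U : Finset (Fin (n + 1)))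
    (y : A) : C.coord v U (y * C.x b S) = 0 := by
  rw [← C.mul_idem b S, ← mul_assoc, C.mul_idem_eq_sum, map_sum]
  refine Finset.sum_eq_zero fun T _ => ?_
  rw [map_smul, C.coord_x, if_neg fun h1 => h h1.1, smul_zero]

theorem coord_mul_x_empty (v : Fin (n + 1) → ℤ) (U : Finset (Fin (n + 1))) (y : A) :
    C.coord v U (y * C.x v ∅) = C.coord v U y := by
  by_cases h : IsCube p D v U
  · rw [C.coord_mul_x, if_pos (Finset.empty_subset _), Finset.sdiff_empty, disp_empty, add_zero,
      coeff, Finset.empty_union, disp_empty, add_zero, C.mul_idem, C.coord_x_self h, one_mul]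
  · rw [C.coord_of_not_isCube h]
    rfl

theorem coord_x_empty_mul (v : Fin (n + 1) → ℤ) (U : Finset (Fin (n + 1))) (y : A) :
    C.coord v U (C.x (v + disp U) ∅ * y) = C.coord v U y := by
  by_cases h : IsCube p D v U
  · rw [C.coord_x_mul, if_pos ⟨Finset.empty_subset _, by simp⟩, Finset.sdiff_empty,
      coeff, Finset.union_empty, C.idem_mul, C.coord_x_self h, one_mul]
  · rw [C.coord_of_not_isCube h]
    rfl

theorem finite_cubes :
    Finite {c : (Fin (n + 1) → ℤ) × Finset (Fin (n + 1)) // IsCube p D c.1 c.2} :=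
  Finite.of_injective (β := Config n p × Finset (Fin (n + 1))) (fun c => (⟨c.1.1, c.2.2.1⟩, c.1.2))
    fun c c' h => by
      simp only [Prod.mk.injEq, Config.mk.injEq] at h
      exact Subtype.ext (Prod.ext h.1 h.2)

end Coord

variable (C : CubicalBasis k A n p {0}ᶜ) (σ : A ≃ₐ[k] A)

open Classical in
/-- The elements of the trivial extension that belong to the cubes: a cube that does not use the
move from the last site to the first one is an element of `A`, and any other one is the linear form
that is dual to the complementary cube. -/
def trivExtElt (a : Fin (n + 1) → ℤ) (T : Finset (Fin (n + 1))) : TwistedTrivialExtension σ :=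
  if (0 : Fin (n + 1)) ∈ T then TrivSqZeroExt.inr (TwistedDual.form.symm (C.coord (a + disp T) Tᶜ))
  else TrivSqZeroExt.inl (C.x a T)

theorem trivExtElt_of_mem {a : Fin (n + 1) → ℤ} {T : Finset (Fin (n + 1))} (h : 0 ∈ T) :
    C.trivExtElt σ a T =
      TrivSqZeroExt.inr (TwistedDual.form.symm (C.coord (a + disp T) Tᶜ)) := if_pos h

theorem trivExtElt_of_notMem {a : Fin (n + 1) → ℤ} {T : Finset (Fin (n + 1))} (h : 0 ∉ T) :
    C.trivExtElt σ a T = TrivSqZeroExt.inl (C.x a T) := if_neg h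

theorem trivExtElt_eq_zero {a : Fin (n + 1) → ℤ} {T : Finset (Fin (n + 1))}
    (h : ¬ IsCube p Finset.univ a T) : C.trivExtElt σ a T = 0 := by
  by_cases h0 : 0 ∈ T
  · rw [isCube_univ_iff_compl h0] at h
    rw [C.trivExtElt_of_mem σ h0, C.coord_of_not_isCube h, map_zero, TrivSqZeroExt.inr_zero]
  · rw [isCube_univ_iff h0] at h
    rw [C.trivExtElt_of_notMem σ h0, C.eq_zero a T h, TrivSqZeroExt.inl_zero]

open Classical in
/-- The coordinates of an element of the trivial extension. -/
def trivExtCoord : TwistedTrivialExtension σ →ₗ[k]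
    ({c : (Fin (n + 1) → ℤ) × Finset (Fin (n + 1)) // IsCube p Finset.univ c.1 c.2} → k) where
  toFun y c := if 0 ∈ c.1.2 then TwistedDual.form y.snd (C.x (c.1.1 + disp c.1.2) c.1.2ᶜ)
    else C.coord c.1.1 c.1.2 y.fst
  map_add' y z := by
    ext c
    simp only [Pi.add_apply]
    split_ifs <;> simp
  map_smul' r y := by
    ext c
    simp only [Pi.smul_apply, RingHom.id_apply]
    split_ifs <;> simp

open Classical in
theorem trivExtCoord_trivExtElt
    (c : {c : (Fin (n + 1) → ℤ) × Finset (Fin (n + 1)) // IsCube p Finset.univ c.1 c.2}) :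
    C.trivExtCoord σ (C.trivExtElt σ c.1.1 c.1.2) = Pi.single c 1 := by
  ext c'
  obtain ⟨⟨a, T⟩, hT⟩ := c
  obtain ⟨⟨b, S⟩, hS⟩ := c'
  rw [Pi.single_apply]
  simp only [Subtype.mk.injEq, Prod.mk.injEq, trivExtCoord, LinearMap.coe_mk, AddHom.coe_mk]
  by_cases hT0 : 0 ∈ T <;> by_cases hS0 : 0 ∈ S
  · rw [C.trivExtElt_of_mem σ hT0, if_pos hS0, TrivSqZeroExt.snd_inr, LinearEquiv.apply_symm_apply,
      C.coord_x]
    have h1 : IsCube p {0}ᶜ (a + disp T) Tᶜ := (isCube_univ_iff_compl hT0).1 hT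
    congr 1
    simp only [compl_inj_iff, h1, and_true, eq_iff_iff]
    constructor
    · rintro ⟨h2, rfl⟩
      exact ⟨add_right_cancel h2, rfl⟩
    · rintro ⟨rfl, rfl⟩
      exact ⟨rfl, rfl⟩
  · rw [C.trivExtElt_of_mem σ hT0, if_neg hS0, TrivSqZeroExt.fst_inr, map_zero, if_neg]
    rintro ⟨rfl, rfl⟩
    exact hS0 hT0
  · rw [C.trivExtElt_of_notMem σ hT0, if_pos hS0, TrivSqZeroExt.snd_inl, map_zero,
      LinearMap.zero_apply, if_neg]
    rintro ⟨rfl, rfl⟩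
    exact hT0 hS0
  · rw [C.trivExtElt_of_notMem σ hT0, if_neg hS0, TrivSqZeroExt.fst_inl, C.coord_x]
    have h1 : IsCube p {0}ᶜ b S := (isCube_univ_iff hS0).1 hS
    congr 1
    simp only [h1, and_true, eq_iff_iff]
    exact ⟨fun h => ⟨h.1.symm, h.2.symm⟩, fun h => ⟨h.1.symm, h.2.symm⟩⟩

theorem linearIndependent_trivExtElt : LinearIndependent k
    fun c : {c : (Fin (n + 1) → ℤ) × Finset (Fin (n + 1)) // IsCube p Finset.univ c.1 c.2} =>
      C.trivExtElt σ c.1.1 c.1.2 := by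
  classical
  refine LinearIndependent.of_comp (C.trivExtCoord σ) ?_
  have h : (⇑(C.trivExtCoord σ) ∘ fun c : {c : (Fin (n + 1) → ℤ) × Finset (Fin (n + 1)) //
      IsCube p Finset.univ c.1 c.2} => C.trivExtElt σ c.1.1 c.1.2) = fun c => Pi.single c 1 :=
    funext fun c => C.trivExtCoord_trivExtElt σ c
  rw [h]
  exact Pi.linearIndependent_single_one _ _

theorem span_trivExtElt_eq_top :
    Submodule.span k {y | ∃ a T, y = C.trivExtElt σ a T} = ⊤ := by
  classical
  have hinl : ∀ y : A, (TrivSqZeroExt.inl y : TwistedTrivialExtension σ) ∈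
      Submodule.span k {y | ∃ a T, y = C.trivExtElt σ a T} := by
    intro y
    induction y using C.induction with
    | hx a T h =>
      refine Submodule.subset_span ⟨a, T, ?_⟩
      rw [C.trivExtElt_of_notMem σ (by simpa using Finset.subset_compl_comm.1 h.1)]
    | h0 => rw [TrivSqZeroExt.inl_zero]; exact Submodule.zero_mem _
    | hadd y z h1 h2 => rw [TrivSqZeroExt.inl_add]; exact Submodule.add_mem _ h1 h2
    | hsmul c y h => rw [TrivSqZeroExt.inl_smul]; exact Submodule.smul_mem _ c h
  have hinr : ∀ φ : TwistedDual σ, (TrivSqZeroExt.inr φ : TwistedTrivialExtension σ) ∈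
      Submodule.span k {y | ∃ a T, y = C.trivExtElt σ a T} := by
    intro φ
    have := finite_cubes (n := n) (p := p) (D := {0}ᶜ)
    have := Fintype.ofFinite
      {c : (Fin (n + 1) → ℤ) × Finset (Fin (n + 1)) // IsCube p {0}ᶜ c.1 c.2}
    have h1 : φ =
        ∑ c, TwistedDual.form φ (C.basis c) • TwistedDual.form.symm (C.basis.coord c) := by
      apply TwistedDual.form.injective
      rw [map_sum]
      simp only [map_smul, LinearEquiv.apply_symm_apply]
      exact (C.basis.sum_dual_apply_smul_coord _).symm
    rw [h1, ← TrivSqZeroExt.inrHom_apply A, map_sum]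
    refine Submodule.sum_mem _ fun c _ => ?_
    rw [TrivSqZeroExt.inrHom_apply, TrivSqZeroExt.inr_smul]
    refine Submodule.smul_mem _ _ (Submodule.subset_span ⟨c.1.1 + disp c.1.2, c.1.2ᶜ, ?_⟩)
    obtain ⟨⟨a, T⟩, hT⟩ := c
    have h2 : (0 : Fin (n + 1)) ∈ Tᶜ := by simpa using Finset.subset_compl_comm.1 hT.1
    rw [C.trivExtElt_of_mem σ h2, add_assoc, disp_compl, add_zero, compl_compl, coord, dif_pos hT]
  rw [eq_top_iff]
  rintro y -
  rw [← TrivSqZeroExt.inl_fst_add_inr_snd_eq y]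
  exact Submodule.add_mem _ (hinl _) (hinr _)

variable {σ}

theorem trivExtElt_mul_of_notMem_of_mem (b a : Fin (n + 1) → ℤ) {S T : Finset (Fin (n + 1))}
    (hS : 0 ∉ S) (hT : 0 ∈ T) : C.trivExtElt σ b S * C.trivExtElt σ a T =
      TrivSqZeroExt.inr (TwistedDual.form.symm
        ((C.coord (a + disp T) Tᶜ).comp (LinearMap.mulRight k (C.x b S)))) := by
  rw [C.trivExtElt_of_notMem σ hS, C.trivExtElt_of_mem σ hT, TrivSqZeroExt.inl_mul_inr]
  rfl

theorem trivExtElt_mul_of_mem_of_notMem (b a : Fin (n + 1) → ℤ) {S T : Finset (Fin (n + 1))}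
    (hS : 0 ∈ S) (hT : 0 ∉ T) : C.trivExtElt σ b S * C.trivExtElt σ a T =
      TrivSqZeroExt.inr (TwistedDual.form.symm
        ((C.coord (b + disp S) Sᶜ).comp (LinearMap.mulLeft k (σ (C.x a T))))) := by
  rw [C.trivExtElt_of_mem σ hS, C.trivExtElt_of_notMem σ hT, TrivSqZeroExt.inr_mul_inl]
  rfl

theorem inr_form_symm_eq_zero {φ : Module.Dual k A} (h : ∀ y, φ y = 0) :
    (TrivSqZeroExt.inr (TwistedDual.form.symm φ) : TwistedTrivialExtension σ) = 0 := by
  rw [show φ = 0 from LinearMap.ext h, map_zero, TrivSqZeroExt.inr_zero]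

theorem trivExtElt_mul_of_mem_of_mem (b a : Fin (n + 1) → ℤ) {S T : Finset (Fin (n + 1))}
    (hS : 0 ∈ S) (hT : 0 ∈ T) : C.trivExtElt σ b S * C.trivExtElt σ a T = 0 := by
  rw [C.trivExtElt_of_mem σ hS, C.trivExtElt_of_mem σ hT, TrivSqZeroExt.inr_mul_inr]

theorem trivExtElt_mul_of_ne (hσ : ∀ a T, ∃ c : k, c ≠ 0 ∧ σ (C.x a T) = c • C.x a T)
    {a b : Fin (n + 1) → ℤ} (S T : Finset (Fin (n + 1))) (h : b ≠ a + disp T) :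
    C.trivExtElt σ b S * C.trivExtElt σ a T = 0 := by
  classical
  by_cases hS : 0 ∈ S <;> by_cases hT : 0 ∈ T
  · exact C.trivExtElt_mul_of_mem_of_mem b a hS hT
  · rw [C.trivExtElt_mul_of_mem_of_notMem b a hS hT]
    refine inr_form_symm_eq_zero fun y => ?_
    obtain ⟨c, -, hc⟩ := hσ a T
    rw [LinearMap.comp_apply, LinearMap.mulLeft_apply, hc, smul_mul_assoc, map_smul, C.coord_x_mul,
      if_neg, smul_zero]
    rintro ⟨-, h1⟩
    rw [add_assoc b, disp_compl, add_zero] at h1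
    exact h h1.symm
  · rw [C.trivExtElt_mul_of_notMem_of_mem b a hS hT]
    exact inr_form_symm_eq_zero fun y => C.coord_mul_x_of_ne h _ _ _
  · rw [C.trivExtElt_of_notMem σ hS, C.trivExtElt_of_notMem σ hT, TrivSqZeroExt.inl_mul_inl,
      C.mul_of_ne _ _ _ _ h, TrivSqZeroExt.inl_zero]

theorem trivExtElt_mul_of_not_disjoint (hσ : ∀ a T, ∃ c : k, c ≠ 0 ∧ σ (C.x a T) = c • C.x a T)
    (a : Fin (n + 1) → ℤ) {S T : Finset (Fin (n + 1))} (h : ¬ Disjoint T S) :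
    C.trivExtElt σ (a + disp T) S * C.trivExtElt σ a T = 0 := by
  classical
  by_cases hS : 0 ∈ S <;> by_cases hT : 0 ∈ T
  · exact C.trivExtElt_mul_of_mem_of_mem _ a hS hT
  · rw [C.trivExtElt_mul_of_mem_of_notMem _ a hS hT]
    refine inr_form_symm_eq_zero fun y => ?_
    obtain ⟨c, -, hc⟩ := hσ a T
    rw [LinearMap.comp_apply, LinearMap.mulLeft_apply, hc, smul_mul_assoc, map_smul, C.coord_x_mul,
      if_neg, smul_zero]
    rintro ⟨h1, -⟩
    exact h (Finset.subset_compl_iff_disjoint_right.1 h1)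
  · rw [C.trivExtElt_mul_of_notMem_of_mem _ a hS hT]
    refine inr_form_symm_eq_zero fun y => ?_
    rw [LinearMap.comp_apply, LinearMap.mulRight_apply, C.coord_mul_x, if_neg]
    exact fun h1 => h (Finset.subset_compl_iff_disjoint_left.1 h1)
  · rw [C.trivExtElt_of_notMem σ hS, C.trivExtElt_of_notMem σ hT, TrivSqZeroExt.inl_mul_inl,
      C.mul_of_not_disjoint _ _ _ h, TrivSqZeroExt.inl_zero]

theorem exists_trivExtElt_mul (hσ : ∀ a T, ∃ c : k, c ≠ 0 ∧ σ (C.x a T) = c • C.x a T)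
    {a : Fin (n + 1) → ℤ} {S T : Finset (Fin (n + 1))} (hT : IsCube p Finset.univ a T)
    (hS : IsCube p Finset.univ (a + disp T) S) (hd : Disjoint T S) : ∃ c : k, c ≠ 0 ∧
      C.trivExtElt σ (a + disp T) S * C.trivExtElt σ a T = c • C.trivExtElt σ a (T ∪ S) := by
  classical
  have hU := hT.union hS hd
  have hcompl : ∀ {S T : Finset (Fin (n + 1))}, Tᶜ \ S = (T ∪ S)ᶜ := fun {S T} => by
    rw [Finset.compl_union, Finset.sdiff_eq_inter_compl]
  have hform : ∀ (c : k) {φ ψ : Module.Dual k A}, (∀ y, φ y = c * ψ y) →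
      (TrivSqZeroExt.inr (TwistedDual.form.symm φ) : TwistedTrivialExtension σ) =
        c • TrivSqZeroExt.inr (TwistedDual.form.symm ψ) := by
    intro c φ ψ h
    rw [show φ = c • ψ from LinearMap.ext h, map_smul, TrivSqZeroExt.inr_smul]
  by_cases h1 : 0 ∈ S <;> by_cases h2 : 0 ∈ T
  · exact absurd h1 (Finset.disjoint_left.1 hd h2)
  · have h3 : 0 ∈ T ∪ S := Finset.mem_union_right _ h1
    obtain ⟨c, hc, hcσ⟩ := hσ a T
    have h4 : a + disp T + disp S + disp Sᶜ = a + disp T := by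
      rw [add_assoc (a + disp T), disp_compl, add_zero]
    have h5 : T ⊆ Sᶜ := Finset.subset_compl_iff_disjoint_right.2 hd
    have h6 : Sᶜ \ T = (T ∪ S)ᶜ := by rw [hcompl, Finset.union_comm]
    have h7 : a + disp T + disp S = a + disp (T ∪ S) := by rw [disp_union hd, add_assoc]
    have h8 : a + disp (T ∪ S) + disp (T ∪ S)ᶜ = a := by rw [add_assoc, disp_compl, add_zero]
    refine ⟨c * C.coeff (a + disp (T ∪ S)) (T ∪ S)ᶜ T,
      mul_ne_zero hc (C.coeff_ne_zero ?_ ?_ ?_), ?_⟩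
    · exact (isCube_univ_iff_compl h3).1 hU
    · rw [h8]
      exact (isCube_univ_iff h2).1 hT
    · exact disjoint_compl_left.mono_right Finset.subset_union_left
    · rw [C.trivExtElt_mul_of_mem_of_notMem _ a h1 h2, C.trivExtElt_of_mem σ h3]
      refine hform _ fun y => ?_
      rw [LinearMap.comp_apply, LinearMap.mulLeft_apply, hcσ, smul_mul_assoc, map_smul,
        C.coord_x_mul, if_pos ⟨h5, h4.symm⟩, h6, h7, smul_eq_mul, mul_assoc]
  · have h3 : 0 ∈ T ∪ S := Finset.mem_union_left _ h2
    have h5 : S ⊆ Tᶜ := Finset.subset_compl_iff_disjoint_left.2 hd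
    have h7 : a + disp T + disp S = a + disp (T ∪ S) := by rw [disp_union hd, add_assoc]
    refine ⟨C.coeff (a + disp T) S (T ∪ S)ᶜ, C.coeff_ne_zero ?_ ?_ ?_, ?_⟩
    · exact (isCube_univ_iff h1).1 hS
    · rw [h7]
      exact (isCube_univ_iff_compl h3).1 hU
    · exact disjoint_compl_right.mono_left Finset.subset_union_right
    · rw [C.trivExtElt_mul_of_notMem_of_mem _ a h1 h2, C.trivExtElt_of_mem σ h3]
      refine hform _ fun y => ?_
      rw [LinearMap.comp_apply, LinearMap.mulRight_apply, C.coord_mul_x, if_pos h5, hcompl, h7]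
  · have h3 : 0 ∉ T ∪ S := by simp [h1, h2]
    obtain ⟨c, hc, h⟩ := C.mul_of_disjoint a S T ((isCube_univ_iff h2).1 hT)
      ((isCube_univ_iff h1).1 hS) hd
    refine ⟨c, hc, ?_⟩
    rw [C.trivExtElt_of_notMem σ h1, C.trivExtElt_of_notMem σ h2, C.trivExtElt_of_notMem σ h3,
      TrivSqZeroExt.inl_mul_inl, h, TrivSqZeroExt.inl_smul]

/-- If the twisting automorphism rescales the basis and fixes its idempotents, then the trivial
extension has a cubical basis in which the remaining move is allowed, too. -/
def trivialExtension (hσ0 : ∀ a, σ (C.x a ∅) = C.x a ∅)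
    (hσ : ∀ a T, ∃ c : k, c ≠ 0 ∧ σ (C.x a T) = c • C.x a T) :
    CubicalBasis k (TwistedTrivialExtension σ) n p Finset.univ where
  x := C.trivExtElt σ
  eq_zero _ _ := C.trivExtElt_eq_zero σ
  indep := C.linearIndependent_trivExtElt σ
  span_eq_top := C.span_trivExtElt_eq_top σ
  mul_of_ne _ _ S T := C.trivExtElt_mul_of_ne hσ S T
  mul_of_not_disjoint a _ _ := C.trivExtElt_mul_of_not_disjoint hσ a
  mul_of_disjoint _ _ _ := C.exists_trivExtElt_mul hσ
  idem_mul a T := by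
    by_cases hT : 0 ∈ T
    · rw [C.trivExtElt_mul_of_notMem_of_mem _ a (by simp) hT, C.trivExtElt_of_mem σ hT]
      congr 2
      exact LinearMap.ext fun y => C.coord_mul_x_empty _ _ y
    · rw [C.trivExtElt_of_notMem σ hT, C.trivExtElt_of_notMem σ (by simp),
        TrivSqZeroExt.inl_mul_inl, C.idem_mul]
  mul_idem a T := by
    by_cases hT : 0 ∈ T
    · rw [C.trivExtElt_mul_of_mem_of_notMem _ a hT (by simp), C.trivExtElt_of_mem σ hT, hσ0]
      congr 2
      refine LinearMap.ext fun y => ?_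
      have h1 : a + disp T + disp Tᶜ = a := by rw [add_assoc, disp_compl, add_zero]
      have h := C.coord_x_empty_mul (a + disp T) Tᶜ y
      rw [h1] at h
      exact h
    · rw [C.trivExtElt_of_notMem σ hT, C.trivExtElt_of_notMem σ (by simp),
        TrivSqZeroExt.inl_mul_inl, C.mul_idem]

end CubicalBasis

/-- A graded automorphism that fixes the vertices rescales the elements of a cubical basis. -/
theorem Realizes.exists_automorphism_smul {V : Type} [Quiver.{0} V] [Fintype V]
    {ρ : Set (PathAlg k V)} {D : Finset (Fin (n + 1))} {C : CubicalBasis k (BoundAlg ρ) n p D}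
    {occ : V → Fin (n + 1) → ℤ} (h : Realizes C occ) (hp : 1 ≤ p)
    {σ : BoundAlg ρ ≃ₐ[k] BoundAlg ρ} (hσ0 : ∀ a, σ (C.x a ∅) = C.x a ∅)
    (hσ : ∀ t, ∀ y ∈ comp ρ t, σ y ∈ comp ρ t) (a : Fin (n + 1) → ℤ) (T : Finset (Fin (n + 1))) :
    ∃ c : k, c ≠ 0 ∧ σ (C.x a T) = c • C.x a T := by
  by_cases hT : IsCube p D a T
  swap
  · exact ⟨1, one_ne_zero, by rw [C.eq_zero a T hT, map_zero, smul_zero]⟩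
  have key : ∀ y ∈ comp ρ T.card, ∃ c : k, C.x (a + disp T) ∅ * y * C.x a ∅ = c • C.x a T := by
    intro y hy
    rw [h.comp_eq_span hp] at hy
    induction hy using Submodule.span_induction with
    | mem y hy =>
      obtain ⟨b, S, hS, hST, rfl⟩ := hy
      by_cases hb : b = a
      · subst hb
        rw [mul_assoc, C.mul_idem]
        by_cases hd : disp T = disp S
        · obtain rfl := eq_of_disp_eq_of_card_eq hd hST.symm
          exact ⟨1, by rw [C.idem_mul, one_smul]⟩
        · exact ⟨0, by rw [C.mul_of_ne _ _ _ _ fun h => hd (add_left_cancel h), zero_smul]⟩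
      · exact ⟨0, by rw [mul_assoc, C.mul_of_ne _ _ _ _ (by simpa using hb), mul_zero, zero_smul]⟩
    | zero => exact ⟨0, by simp⟩
    | add y z _ _ h1 h2 =>
      obtain ⟨c, hc⟩ := h1
      obtain ⟨c', hc'⟩ := h2
      exact ⟨c + c', by rw [mul_add, add_mul, hc, hc', add_smul]⟩
    | smul r y _ h1 =>
      obtain ⟨c, hc⟩ := h1
      exact ⟨r * c, by rw [mul_smul_comm, smul_mul_assoc, hc, smul_smul]⟩
  have hmem : C.x a T ∈ comp ρ T.card := by
    rw [h.comp_eq_span hp]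
    exact Submodule.subset_span ⟨a, T, hT, rfl, rfl⟩
  obtain ⟨c, hc⟩ := key _ (hσ _ _ hmem)
  have h1 : σ (C.x a T) = c • C.x a T := by
    rw [← hc]
    conv_lhs => rw [← C.mul_idem a T, ← C.idem_mul a T, map_mul, map_mul, hσ0, hσ0]
  refine ⟨c, ?_, h1⟩
  rintro rfl
  rw [zero_smul, map_eq_zero_iff σ σ.injective] at h1
  exact C.x_ne_zero hT h1

/-- The algebra of a bound quiver that realizes a cubical basis with the move `0` forbidden is
extendible. -/
theorem Realizes.isExtendible {V : Type} [Quiver.{0} V] [Fintype V] {ρ : Set (PathAlg k V)}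
    {C : CubicalBasis k (BoundAlg ρ) n p {0}ᶜ} {occ : V → Fin (n + 1) → ℤ} (h : Realizes C occ)
    (hp : 1 ≤ p) {N : ℕ} (hN : n = N + 1) : IsExtendible N ρ := by
  intro σ hσ0 hσ
  have h0 : ∀ a, σ (C.x a ∅) = C.x a ∅ := by
    intro a
    by_cases ha : IsConfig p a
    · obtain ⟨v, rfl⟩ := h.surjective a ha
      rw [← h.idem, hσ0]
    · rw [C.eq_zero a ∅ fun h1 => ha (isCube_empty.1 h1), map_zero]
  subst hN
  exact (C.trivialExtension h0 (h.exists_automorphism_smul hp h0 hσ)).isTranslationAlgebra hp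

end TrivialExtension

end

/-! ### The translation of the pyramid quiver -/

section Translation

variable {n m : ℕ}

theorem last_eq_succ (hn : 1 ≤ n) : Fin.last n = (⟨n - 1, by omega⟩ : Fin n).succ := by
  ext
  simp
  omega

theorem mem_projectiveVertices_iff (hn : 1 ≤ n) (v : Vertex n m) :
    v ∈ projectiveVertices m hn ↔ occ v (Fin.last n) = 0 := by
  rw [last_eq_succ hn, occ_succ, sub_eq_zero]
  rfl

theorem mem_injectiveVertices_iff (v : Vertex n m) :
    v ∈ injectiveVertices n m ↔ occ v 0 = 0 := by
  have h : v ∈ injectiveVertices n m ↔ ∑ t, v.1 t = (n : ℤ) + m - 1 := Iff.rfl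
  rw [h, occ_zero, Finset.sum_sub_distrib]
  simp
  constructor <;> intro h <;> linarith

theorem disp_compl_zero_succ (hn : 1 ≤ n) (t : Fin n) :
    disp ({0}ᶜ : Finset (Fin (n + 1))) t.succ =
      (Pi.single (⟨n - 1, by omega⟩ : Fin n) 1 : Fin n → ℤ) t := by
  have h : t.succ + 1 = 0 ↔ t = ⟨n - 1, by omega⟩ := by
    rw [show t = ⟨n - 1, by omega⟩ ↔ t.succ = Fin.last n by rw [last_eq_succ hn, Fin.succ_inj]]
    constructor
    · intro h
      by_contra h1
      have h2 := congrArg Fin.val h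
      rw [Fin.val_add_one_of_lt (Fin.lt_last_iff_ne_last.2 h1)] at h2
      simp at h2
    · intro h
      rw [h, Fin.last_add_one]
  rw [Pi.single_apply]
  by_cases ht : t = ⟨n - 1, by omega⟩
  · rw [if_pos ht]
    simp [disp, h.2 ht]
  · rw [if_neg ht]
    have h1 : t.succ + 1 ≠ 0 := fun h1 => ht (h.1 h1)
    simp [disp, h1]

/-- The moves other than `0` together take one particle from the first site to the last one. This is
possible exactly at the vertices that are not injective, and it leads exactly to the vertices that
are not projective. -/
theorem exists_translation (hn : 1 ≤ n) {p : ℕ} (hm : m = p + 1) :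
    ∃ τ : ↥((projectiveVertices m hn)ᶜ) ≃ ↥((injectiveVertices n m)ᶜ),
      ∀ i, occ i.1 = occ (τ i).1 + disp {0}ᶜ := by
  have hneg : ∀ a : Fin (n + 1) → ℤ, a + disp {0} + disp {0}ᶜ = a := fun a => by
    rw [add_assoc, disp_compl, add_zero]
  have h1 : ∀ v : ↥((projectiveVertices m hn)ᶜ), ∃ w : ↥((injectiveVertices n m)ᶜ),
      occ v.1 = occ w.1 + disp {0}ᶜ := by
    rintro ⟨v, hv⟩
    have hv' : occ v (Fin.last n) ≠ 0 := fun h => hv ((mem_projectiveVertices_iff hn v).2 h)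
    have hc := isConfig_occ hn hm v
    have h2 : IsConfig p (occ v + disp {0}) := by
      rw [isConfig_add_disp_iff hc]
      intro j hj _
      have : j = Fin.last n := by
        have h3 : j + 1 = Fin.last n + 1 := by rw [Fin.last_add_one]; simpa using hj
        exact add_right_cancel h3
      have := hc.1 (Fin.last n)
      subst j
      omega
    obtain ⟨w, hw⟩ := exists_occ_eq hm h2
    refine ⟨⟨w, fun hwI => ?_⟩, ?_⟩
    · rw [mem_injectiveVertices_iff, hw] at hwI
      have h3 := hc.1 0
      have h4 : (1 : Fin (n + 1)) ≠ 0 := by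
        rw [ne_eq, Fin.one_eq_zero_iff]
        omega
      simp [disp, h4, -occ_zero] at hwI
      linarith
    · rw [hw, hneg]
  have h2 : ∀ w : ↥((injectiveVertices n m)ᶜ), ∃ v : ↥((projectiveVertices m hn)ᶜ),
      occ v.1 = occ w.1 + disp {0}ᶜ := by
    rintro ⟨w, hw⟩
    have hw' : occ w 0 ≠ 0 := fun h => hw ((mem_injectiveVertices_iff w).2 h)
    have hc := isConfig_occ hn hm w
    have h2 : IsConfig p (occ w + disp {0}ᶜ) := by
      rw [isConfig_add_disp_iff hc]
      intro j _ hj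
      obtain rfl : j = 0 := by simpa using hj
      have := hc.1 0
      omega
    obtain ⟨v, hv⟩ := exists_occ_eq hm h2
    refine ⟨⟨v, fun hvP => ?_⟩, hv⟩
    rw [mem_projectiveVertices_iff, hv, Pi.add_apply, last_eq_succ hn,
      disp_compl_zero_succ hn] at hvP
    have h3 := hc.1 (⟨n - 1, by omega⟩ : Fin n).succ
    simp at hvP
    simp at h3
    linarith
  choose f hf using h1
  choose g hg using h2
  exact ⟨⟨f, g, fun v => Subtype.ext (occ_injective (by rw [hg, ← hf])),
    fun w => Subtype.ext (occ_injective (add_right_cancel (by rw [← hf, hg])))⟩, hf⟩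

theorem isRelationSet_pyramidRel {k : Type u} [Field k] (d : Fin n → Fin n → Vertex n m → k) :
    IsRelationSet (pyramidRel d) := by
  have hpath : ∀ {i j l : Vertex n m} (f : i ⟶ j) (g : j ⟶ l),
      arrowElt k g * arrowElt k f ∈ Submodule.span k
        {x | ∃ q : Quiver.Path i l, q.length = 2 ∧ x = pathElt k q} := fun f g =>
    Submodule.subset_span ⟨(Quiver.Path.nil.cons f).cons g, rfl, by
      rw [pathElt, pathElt, pathElt, arrowElt_mul_vertexElt]⟩
  rintro r (⟨t, s, i, x, y, z, hx, hy, hxz, hyz, hts, rfl⟩ | ⟨t, i, x, y, hx, hy, rfl⟩)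
  · exact ⟨i, z, 2, le_rfl, Submodule.sub_mem _ (Submodule.smul_mem _ _ (hpath _ _)) (hpath _ _)⟩
  · exact ⟨i, y, 2, le_rfl, hpath _ _⟩

end Translation

end NCubic

theorem mainTheorem3 {k : Type u} [Field k] (n m : ℕ) (hn : 1 ≤ n) (hm : 3 ≤ m)
    (d : Fin n → Fin n → NCubic.Vertex n m → k) (hd : NCubic.IsTwistFamily d) :
    ∃ τ : ↥((NCubic.projectiveVertices m hn)ᶜ) ≃ ↥((NCubic.injectiveVertices n m)ᶜ),
      (∀ i, (τ i).1.1 = i.1.1 - Pi.single ⟨n - 1, by omega⟩ 1) ∧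
      NCubic.IsTranslationQuiver (n - 1) (NCubic.pyramidRel d)
        (NCubic.projectiveVertices m hn) (NCubic.injectiveVertices n m) τ ∧
      NCubic.IsAdmissible (n - 1) (NCubic.pyramidRel d)
        (NCubic.projectiveVertices m hn) (NCubic.injectiveVertices n m) τ ∧
      (∃ q : ℕ∞, 1 ≤ q ∧ NCubic.IsKoszulOfType (NCubic.pyramidRel d) n q) ∧
      NCubic.IsTranslationAlgebra k (n - 1) (NCubic.BoundAlg (NCubic.pyramidRel d)) ∧
      NCubic.IsExtendible (n - 1) (NCubic.pyramidRel d) := by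
  obtain ⟨p, rfl⟩ : ∃ p, m = p + 1 := ⟨m - 1, by omega⟩
  have hp : 2 ≤ p := by omega
  have hp1 : 1 ≤ p := by omega
  have h := NCubic.realizes_pyramidBasis hn rfl hd
  have hcard : ({0}ᶜ : Finset (Fin (n + 1))).card = n := by simp [Finset.card_compl]
  have hN : ({0}ᶜ : Finset (Fin (n + 1))).card = n - 1 + 1 := by rw [hcard]; omega
  obtain ⟨τ, hτ⟩ := NCubic.exists_translation hn (m := p + 1) rfl
  have htrans : NCubic.IsTranslationQuiver (n - 1) (NCubic.pyramidRel d)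
      (NCubic.projectiveVertices (p + 1) hn) (NCubic.injectiveVertices n (p + 1)) τ := by
    refine h.isTranslationQuiver (fun s hs => by simpa using hs) hp1 hN hτ fun v w hvw hw => ?_
    rw [NCubic.mem_projectiveVertices_iff, hvw, Pi.add_apply, NCubic.last_eq_succ hn,
      NCubic.disp_compl_zero_succ hn, Pi.single_eq_same] at hw
    have := (NCubic.isConfig_occ hn rfl v).1 (⟨n - 1, by omega⟩ : Fin n).succ
    linarith
  have hkoszul : NCubic.IsKoszulOfType (NCubic.pyramidRel d) n ⊤ := by
    have h1 := h.isKoszulOfType_top hp1 fun h0 => by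
      have := congrArg Finset.card h0
      simp [Finset.card_compl] at this
    rwa [hcard] at h1
  -- `p ≥ 1` suffices for everything except admissibility, which needs `p ≥ 2`
  refine ⟨τ, fun i => ?_, htrans, ?_, ⟨⊤, le_top, hkoszul⟩, ?_, h.isExtendible hp1 (by omega)⟩
  · funext t
    have h1 := congrFun (hτ i) t.succ
    rw [Pi.add_apply, NCubic.disp_compl_zero_succ hn, NCubic.occ_succ, NCubic.occ_succ] at h1
    rw [Pi.sub_apply]
    linarith
  · exact h.isAdmissible rfl hp hN hτ (NCubic.mem_projectiveVertices_iff hn)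
      NCubic.mem_injectiveVertices_iff
  · refine ⟨NCubic.Vertex n (p + 1), inferInstance, inferInstance, NCubic.pyramidRel d,
      NCubic.isRelationSet_pyramidRel d, ⟨AlgEquiv.refl⟩, ⟨_, _, τ, htrans⟩, ⊤, le_top, ?_⟩
    rwa [Nat.sub_add_cancel hn]
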